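/- Let $d\in\mathbb N$, $1\le p<\infty$, $T>0$, and let $f:L^p(\mathbb R^d)\to L^p(\mathbb R^d)$ (real-valued functions, norm $\|\cdot\|$) satisfy $(F_f)$: $f(0)=0$, and there is $L_f>0$ with $\|f(u)-f(v)\|\le L_f\|u-v\|$ for all $u,v\in L^p(\mathbb R^d)$. A kernel $m\in L^1_{loc}([0,\infty);\mathbb R)$, not almost everywhere zero, is called completely positive if for every $\mu>0$ the solutions $s_\mu,r_\mu\in L^1_{loc}([0,\infty))$ of $s_\mu+\mu\, m*s_\mu=1$ and $r_\mu+\mu\, m*r_\mu=m$ are nonnegative, where $(a*b)(t)=\int_0^t a(t-\sigma)b(\sigma)\,d\sigma$. With $\hat m(\lambda)=\int_0^\infty e^{-\lambda t}m(t)\,dt$, its propagation function $w(t,\tau)$, $t,\tau\ge0$, is the function such that, for each $\tau\ge0$, $w(\cdot,\tau)$ is nondecreasing, left-continuous and of bounded variation on $[0,\infty)$, $w(0,\tau)=0$, and $$\int_0^\infty e^{-\lambda t}w(t,\tau)\,dt=\frac{e^{-\tau/\hat m(\lambda)}}{\lambda},\qquad \lambda>0 .$$ Let $T(\tau)$, $\tau\ge0$,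 be the heat semigroup on $L^p(\mathbb R^d)$: $T(0)=I$, and for $\tau>0$, $T(\tau)$ is convolution with $(4\pi\tau)^{-d/2}e^{-|x|^2/(4\tau)}$. The resolvent family determined by $m$ is $$S_m(t)v=-\int_0^\infty T(\tau)v\;d_\tau w(t,\tau),\qquad t\ge0,\ v\in L^p(\mathbb R^d),$$ where $-d_\tau w(t,\cdot)$ is the probability measure on $[0,\infty)$ that gives $(\tau,\infty)$ the mass $w(t,\tau)$ for every $\tau\ge0$. Then every completely positive kernel $m$ determines such a family $S_m$. For every $\varphi\in C([0,T];L^p(\mathbb R^d))$ and every completely positive $m$ the generalized mild equation $$u(t)=\varphi(t)+\int_0^tS_m(t-\sigma)f(u(\sigma))\,d\sigma,\qquad t\in[0,T],$$ has a unique solution $u=u_m(\cdot,\varphi)\in C([0,T];L^p(\mathbb R^d))$; it depends on $m$ only through the restriction $m|_{(0,T)}$, and the solution map $(\varphi,m)\mapsto u_m(\cdot,\varphi)$ is continuous from $C([0,T];L^p(\mathbb R^d))\times\mathcal K_T$ into $C([0,T];L^p(\mathbb R^d))$. Here $\mathcal K_T\subset L^1(0,T)$ is the set of restrictions to $(0,T)$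 of completely positive kernels, with the topology of $L^1(0,T)$, and $C([0,T];L^p(\mathbb R^d))$ carries the supremum norm. -/

import Mathlib

open MeasureTheory Set Filter Topology
open scoped ENNReal

noncomputable section

namespace RayleighStokes

/-- The space `L^p(ℝ^d)` of real-valued functions, for Lebesgue measure. -/
abbrev LpSpace (d : ℕ) (p : ℝ≥0∞) : Type :=
  Lp ℝ p (volume : Measure (EuclideanSpace ℝ (Fin d)))

/-- The Gaussian heat kernel `G(τ, x) = (4πτ)^{-d/2} exp(-|x|² / (4τ))`. -/
def heatKernel (d : ℕ) (τ : ℝ) (x : EuclideanSpace ℝ (Fin d)) : ℝ :=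
  (4 * Real.pi * τ) ^ (-(d : ℝ) / 2) * Real.exp (-‖x‖ ^ 2 / (4 * τ))

theorem continuous_heatKernel (d : ℕ) (τ : ℝ) : Continuous (heatKernel d τ) := by
  unfold heatKernel
  fun_prop

theorem heatKernel_nonneg (d : ℕ) {τ : ℝ} (hτ : 0 < τ) (x : EuclideanSpace ℝ (Fin d)) :
    0 ≤ heatKernel d τ x := by
  unfold heatKernel
  positivity

theorem integrable_heatKernel (d : ℕ) {τ : ℝ} (hτ : 0 < τ) :
    Integrable (heatKernel d τ) volume := by
  have hb : 0 < 1 / (4 * τ) := by positivity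
  have h := (GaussianFourier.integrable_cexp_neg_mul_sq_norm_add
    (b := ((1 / (4 * τ) : ℝ) : ℂ)) (by simpa using hτ) 0
    (0 : EuclideanSpace ℝ (Fin d))).norm
  refine (h.const_mul ((4 * Real.pi * τ) ^ (-(d : ℝ) / 2))).congr (ae_of_all _ fun x => ?_)
  have e : -((1 / (4 * τ) : ℝ) : ℂ) * (‖x‖ : ℂ) ^ 2
      + 0 * ((inner ℝ (0 : EuclideanSpace ℝ (Fin d)) x : ℝ) : ℂ)
      = ((-‖x‖ ^ 2 / (4 * τ) : ℝ) : ℂ) := by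
    push_cast
    ring
  simp only [heatKernel]
  rw [e, Complex.norm_exp_ofReal]

/-- The pointwise heat convolution `x ↦ ∫ G(τ, x - y) v(y) dy`. -/
def heatConv (d : ℕ) (τ : ℝ) (v : EuclideanSpace ℝ (Fin d) → ℝ)
    (x : EuclideanSpace ℝ (Fin d)) : ℝ :=
  ∫ y, heatKernel d τ (x - y) * v y

theorem memLp_heatConv {d : ℕ} {p : ℝ≥0∞} [h1 : Fact (1 ≤ p)] [h2 : Fact (p ≠ ∞)]
    {τ : ℝ} (hτ : 0 < τ) (v : LpSpace d p) : MemLp (heatConv d τ v) p volume := by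
  have hp0 : p ≠ 0 := (zero_lt_one.trans_le h1.out).ne'
  have hq : 0 < p.toReal := ENNReal.toReal_pos hp0 h2.out
  have hv : StronglyMeasurable (v : EuclideanSpace ℝ (Fin d) → ℝ) := Lp.stronglyMeasurable v
  have hGm : Measurable (heatKernel d τ) := (continuous_heatKernel d τ).measurable
  have hmeas : StronglyMeasurable (heatConv d τ v) := by
    refine StronglyMeasurable.integral_prod_right'
      (f := fun z : EuclideanSpace ℝ (Fin d) × EuclideanSpace ℝ (Fin d) =>
        heatKernel d τ (z.1 - z.2) * v z.2) ?_
    exact ((hGm.comp (measurable_fst.sub measurable_snd)).mul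
      (hv.measurable.comp measurable_snd)).stronglyMeasurable
  refine ⟨hmeas.aestronglyMeasurable, ?_⟩
  rw [eLpNorm_lt_top_iff_lintegral_rpow_enorm_lt_top hp0 h2.out]
  set γ : Measure (EuclideanSpace ℝ (Fin d)) :=
    volume.withDensity (fun y => ENNReal.ofReal (heatKernel d τ y)) with hγ
  have hγfin : IsFiniteMeasure γ :=
    isFiniteMeasure_withDensity_ofReal (integrable_heatKernel d hτ).2
  set C : ℝ≥0∞ := γ univ ^ (1 / (1 : ℝ≥0∞).toReal - 1 / p.toReal) with hC
  have hCtop : C ≠ ∞ := by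
    refine ENNReal.rpow_ne_top_of_nonneg ?_ (measure_ne_top _ _)
    have : 1 ≤ p.toReal := by
      simpa using (ENNReal.toReal_le_toReal ENNReal.one_ne_top h2.out).2 h1.out
    simp only [ENNReal.toReal_one, div_one, sub_nonneg]
    exact (div_le_one hq).2 this
  have hpt : ∀ x, ‖heatConv d τ v x‖ₑ ^ p.toReal
      ≤ C ^ p.toReal * ∫⁻ y, ‖v (x - y)‖ₑ ^ p.toReal ∂γ := by
    intro x
    have hvx : StronglyMeasurable fun y => v (x - y) :=
      hv.comp_measurable (measurable_const.sub measurable_id)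
    have a1 : ‖heatConv d τ v x‖ₑ ≤ eLpNorm (fun y => v (x - y)) 1 γ := by
      calc ‖heatConv d τ v x‖ₑ ≤ ∫⁻ y, ‖heatKernel d τ (x - y) * v y‖ₑ :=
            enorm_integral_le_lintegral_enorm _
        _ = ∫⁻ y, ENNReal.ofReal (heatKernel d τ (x - y)) * ‖v (x - (x - y))‖ₑ := by
            refine lintegral_congr fun y => ?_
            rw [enorm_mul, Real.enorm_of_nonneg (heatKernel_nonneg d hτ _), sub_sub_cancel]
        _ = ∫⁻ y, ENNReal.ofReal (heatKernel d τ y) * ‖v (x - y)‖ₑ :=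
            lintegral_sub_left_eq_self
              (fun y => ENNReal.ofReal (heatKernel d τ y) * ‖v (x - y)‖ₑ) x
        _ = eLpNorm (fun y => v (x - y)) 1 γ := by
            rw [eLpNorm_one_eq_lintegral_enorm, hγ,
              lintegral_withDensity_eq_lintegral_mul _ hGm.ennreal_ofReal hvx.enorm]
            rfl
    have a2 := eLpNorm_le_eLpNorm_mul_rpow_measure_univ h1.out
      (hvx.aestronglyMeasurable (μ := γ))
    calc ‖heatConv d τ v x‖ₑ ^ p.toReal
        ≤ (eLpNorm (fun y => v (x - y)) p γ * C) ^ p.toReal :=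
          ENNReal.rpow_le_rpow (a1.trans a2) hq.le
      _ = C ^ p.toReal * ∫⁻ y, ‖v (x - y)‖ₑ ^ p.toReal ∂γ := by
          rw [ENNReal.mul_rpow_of_nonneg _ _ hq.le, mul_comm,
            eLpNorm_eq_lintegral_rpow_enorm_toReal hp0 h2.out]
          congr 1
          rw [← ENNReal.rpow_mul, one_div_mul_cancel hq.ne', ENNReal.rpow_one]
  refine (lintegral_mono hpt).trans_lt ?_
  have hjm : Measurable fun z : EuclideanSpace ℝ (Fin d) × EuclideanSpace ℝ (Fin d) =>
      ‖v (z.1 - z.2)‖ₑ ^ p.toReal :=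
    ((hv.measurable.comp (measurable_fst.sub measurable_snd)).enorm).pow_const _
  rw [lintegral_const_mul _ hjm.lintegral_prod_right',
    lintegral_lintegral_swap hjm.aemeasurable]
  have hin : ∀ y, ∫⁻ x, ‖v (x - y)‖ₑ ^ p.toReal = ∫⁻ x, ‖v x‖ₑ ^ p.toReal := fun y =>
    lintegral_sub_right_eq_self (fun x => ‖v x‖ₑ ^ p.toReal) y
  simp only [hin, lintegral_const]
  have hvfin := (eLpNorm_lt_top_iff_lintegral_rpow_enorm_lt_top hp0 h2.out).1 (Lp.memLp v).2
  exact ENNReal.mul_lt_top (ENNReal.rpow_lt_top_of_nonneg hq.le hCtop)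
    (ENNReal.mul_lt_top hvfin (measure_lt_top _ _))

/-- The heat semigroup `T(τ)` generated by the Laplacian on `L^p(ℝ^d)`, `1 ≤ p < ∞`:
convolution with the heat kernel for `τ > 0`, and the identity at `τ = 0`. -/
def heatSemigroup {d : ℕ} {p : ℝ≥0∞} [Fact (1 ≤ p)] [Fact (p ≠ ∞)]
    (τ : ℝ) (v : LpSpace d p) : LpSpace d p :=
  if hτ : 0 < τ then (memLp_heatConv hτ v).toLp _ else v

/-- `b` is locally integrable on `[0, ∞)`; values at negative times are irrelevant. -/
def LocInt (b : ℝ → ℝ) : Prop :=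
  ∀ R : ℝ, IntegrableOn b (Ioc 0 R) volume

/-- The convolution `(b * s)(t) = ∫₀ᵗ b(t - σ) s(σ) dσ`. -/
def conv (b s : ℝ → ℝ) (t : ℝ) : ℝ :=
  ∫ σ in (0 : ℝ)..t, b (t - σ) * s σ

/-- Completely positive kernels: `b` is in `L¹_loc` and, for every `μ > 0`, the (unique)
locally integrable solutions of `s + μ b * s = 1` and `r + μ b * r = b` are nonnegative.
The zero kernel, which has no Bernstein function `1 / b̂`, is left out. -/
structure CompletelyPositive (b : ℝ → ℝ) : Prop where
  locInt : LocInt b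
  ne_zero : ¬ (∀ᵐ t ∂volume.restrict (Ioi (0 : ℝ)), b t = 0)
  exists_s : ∀ μ : ℝ, 0 < μ → ∃ s : ℝ → ℝ, LocInt s ∧
    (∀ᵐ t ∂volume.restrict (Ioi (0 : ℝ)), s t + μ * conv b s t = 1) ∧
    (∀ᵐ t ∂volume.restrict (Ioi (0 : ℝ)), 0 ≤ s t)
  exists_r : ∀ μ : ℝ, 0 < μ → ∃ r : ℝ → ℝ, LocInt r ∧
    (∀ᵐ t ∂volume.restrict (Ioi (0 : ℝ)), r t + μ * conv b r t = b t) ∧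
    (∀ᵐ t ∂volume.restrict (Ioi (0 : ℝ)), 0 ≤ r t)

/-- The Laplace transform `b̂(lam) = ∫₀^∞ e^{-lam t} b(t) dt`. -/
def laplace (b : ℝ → ℝ) (lam : ℝ) : ℝ :=
  ∫ t in Ioi (0 : ℝ), Real.exp (-lam * t) * b t

/-- `w` is the propagation function of the kernel `b`: for each `τ ≥ 0` the function
`w(·, τ)` is nondecreasing, left-continuous and of bounded variation on `[0, ∞)`, vanishes at
`0`, and has the Laplace transform `lam⁻¹ exp(-τ / b̂(lam))`. -/
structure IsPropagationFunction (b : ℝ → ℝ) (w : ℝ → ℝ → ℝ) : Prop where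
  mono : ∀ τ, 0 ≤ τ → MonotoneOn (fun t => w t τ) (Ici 0)
  bv : ∀ τ, 0 ≤ τ → BoundedVariationOn (fun t => w t τ) (Ici 0)
  at_zero : ∀ τ, 0 ≤ τ → w 0 τ = 0
  left_cont : ∀ τ, 0 ≤ τ → ∀ t, 0 < t → ContinuousWithinAt (fun t => w t τ) (Iic t) t
  laplace_eq : ∀ τ, 0 ≤ τ → ∀ lam : ℝ, 0 < lam →
    laplace (fun t => w t τ) lam = Real.exp (-τ * (1 / laplace b lam)) / lam

/-- `ν` is the Stieltjes measure `-d_τ w(t, τ)` on `[0, ∞)`: it has total mass one and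
distributes its mass according to `w`, where `w(t, ∞) = 0`, so that `ν (τ, ∞) = w(t, τ)`.
At `t = 0`, where `w(0, ·) = 0`, it is the unit mass at `τ = 0`. -/
structure IsNegDtau (w : ℝ → ℝ → ℝ) (t : ℝ) (ν : Measure ℝ) : Prop where
  univ_eq : ν univ = 1
  neg_eq : ν (Iio 0) = 0
  tail_eq : ∀ τ, 0 ≤ τ → ν (Ioi τ) = ENNReal.ofReal (w t τ)

/-- `S` is the resolvent family determined by the kernel `m` through subordination,
`S(t)v = -∫₀^∞ T(τ)v d_τ w(t, τ)`, with `w` the propagation function of `m`. -/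
def IsResolventFamily {d : ℕ} {p : ℝ≥0∞} [Fact (1 ≤ p)] [Fact (p ≠ ∞)]
    (m : ℝ → ℝ) (S : ℝ → LpSpace d p → LpSpace d p) : Prop :=
  ∃ w : ℝ → ℝ → ℝ, IsPropagationFunction m w ∧
    ∃ ν : ℝ → Measure ℝ, (∀ t, 0 ≤ t → IsNegDtau w t (ν t)) ∧
      ∀ t, 0 ≤ t → ∀ v : LpSpace d p,
        Integrable (fun τ => heatSemigroup τ v) (ν t) ∧
        S t v = ∫ τ, heatSemigroup τ v ∂(ν t)

/-- `u ∈ C([0,T]; X)` is a generalized mild solution: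
`u(t) = φ(t) + ∫₀ᵗ S(t - σ) f(u(σ)) dσ` for all `t ∈ [0, T]`. -/
def IsGeneralizedMildSolution {X : Type*} [NormedAddCommGroup X] [NormedSpace ℝ X]
    {T : ℝ} (hT : 0 ≤ T) (S : ℝ → X → X) (f : X → X) (φ u : C(Icc (0 : ℝ) T, X)) : Prop :=
  ∀ t : Icc (0 : ℝ) T,
    IntervalIntegrable (fun σ => S (t - σ) (f (u (projIcc 0 T hT σ)))) volume 0 t ∧
    u t = φ t + ∫ σ in (0 : ℝ)..t, S (t - σ) (f (u (projIcc 0 T hT σ)))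

/-- The elements of `L¹(0,T)` that are restrictions of completely positive kernels. -/
def kernelSet (T : ℝ) : Set (Lp ℝ 1 (volume.restrict (Ioo (0 : ℝ) T))) :=
  {g | ∃ m : ℝ → ℝ, CompletelyPositive m ∧ m =ᵐ[volume.restrict (Ioo (0 : ℝ) T)] g}

end RayleighStokes

end

/-
For `k > 0` let `r_k` be the solution of `r + k m * r = m`. The exponential moments of the measures
`ν_t = -d_τ w(t, ·)` are `∫ e^{-kτ} dν_t(τ) = 1 - k ∫₀ᵗ r_k`, because both sides have the same
Laplace transform in `t`. By a Volterra estimate these relaxation functions are continuous in `t`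
and, for `t ∈ [0, T]`, depend on `m ∈ L¹(0, T)` in a locally Lipschitz way; the moment with
`k = 1 / R` also bounds the mass of `(R, ∞)` by `2 ‖m‖_{L¹(0,T)} / R`. Approximating the bounded
continuous orbit `τ ↦ T(τ)v` on `[0, R]` by polynomials in `e^{-τ}` therefore approximates `S_m(t)v`
uniformly in `t ∈ [0, T]`, and locally uniformly in `m`, by finite combinations of relaxation
functions. Hence `S_m(t)v` is continuous in `t`, is determined by `m|_(0,T)` and depends
continuously on `m`. The mild equation is then solved by a contraction argument, and Gronwall's
inequality carries the continuity over to its solutions.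

The propagation function exists because `e^{-τ / m̂(λ)}` is the limit of the functions
`(1 + τ / (n m̂(λ)))^{-n}`, Laplace transforms of `n`-fold convolution powers of the nonnegative
functions `k r_k` with `k = n / τ`.
-/

noncomputable section

namespace RayleighStokes

section WeightedIntegral

theorem lintegral_lconvolution {G : Type*} [AddGroup G] [MeasurableSpace G] [MeasurableAdd₂ G]
    [MeasurableNeg G] {μ : Measure G} [SFinite μ] [μ.IsAddLeftInvariant] {f g : G → ℝ≥0∞}
    (hf : Measurable f) (hg : Measurable g) :
    ∫⁻ x, (f ⋆ₗ[μ] g) x ∂μ = (∫⁻ x, f x ∂μ) * ∫⁻ x, g x ∂μ := by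
  have hm : Measurable fun q : G × G => f q.2 * g (-q.2 + q.1) := by fun_prop
  simp only [lconvolution_def]
  rw [lintegral_lintegral_swap hm.aemeasurable]
  have hinner : ∀ y, ∫⁻ x, f y * g (-y + x) ∂μ = f y * ∫⁻ x, g x ∂μ := fun y => by
    rw [lintegral_const_mul _ (by fun_prop), lintegral_add_left_eq_self]
  simp only [hinner]
  exact lintegral_mul_const _ hf

/-- The exponentially weighted integral `∫_J e^{-lam t} A(t) dt`; for `J = (0, ∞)` it is the
Laplace transform of the `[0, ∞]`-valued function `A`, which need not be finite. -/
def llaplaceOn (lam : ℝ) (J : Set ℝ) (A : ℝ → ℝ≥0∞) : ℝ≥0∞ :=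
  ∫⁻ t in J, ENNReal.ofReal (Real.exp (-lam * t)) * A t

variable {lam T : ℝ} {J : Set ℝ} {A C : ℝ → ℝ≥0∞}

theorem llaplaceOn_mono (h : ∀ᵐ t ∂volume.restrict J, A t ≤ C t) :
    llaplaceOn lam J A ≤ llaplaceOn lam J C := by
  refine lintegral_mono_ae ?_
  filter_upwards [h] with t ht
  gcongr

theorem llaplaceOn_congr (h : ∀ᵐ t ∂volume.restrict J, A t = C t) :
    llaplaceOn lam J A = llaplaceOn lam J C := by
  refine lintegral_congr_ae ?_
  filter_upwards [h] with t ht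
  rw [ht]

theorem llaplaceOn_add (hA : Measurable A) :
    llaplaceOn lam J (fun t => A t + C t) = llaplaceOn lam J A + llaplaceOn lam J C := by
  simp only [llaplaceOn, mul_add]
  exact lintegral_add_left (by fun_prop) _

theorem llaplaceOn_const_mul (hA : Measurable A) (c : ℝ≥0∞) :
    llaplaceOn lam J (fun t => c * A t) = c * llaplaceOn lam J A := by
  simp only [llaplaceOn, mul_left_comm _ c]
  exact lintegral_const_mul _ (by fun_prop)

theorem llaplaceOn_univ_indicator (hJ : MeasurableSet J) :
    llaplaceOn lam univ (J.indicator A) = llaplaceOn lam J A := by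
  rw [llaplaceOn, llaplaceOn, Measure.restrict_univ, ← lintegral_indicator hJ]
  refine lintegral_congr fun t => ?_
  by_cases ht : t ∈ J <;> simp [ht]

theorem llaplaceOn_Ioi_eq_univ (hA : ∀ t ≤ 0, A t = 0) :
    llaplaceOn lam (Ioi 0) A = llaplaceOn lam univ A := by
  rw [← llaplaceOn_univ_indicator measurableSet_Ioi,
    indicator_eq_self.2 (show Function.support A ⊆ Ioi 0 from
      fun t ht => not_le.1 fun h => ht (hA t h))]

theorem llaplaceOn_univ_lconvolution (hA : Measurable A) (hC : Measurable C) :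
    llaplaceOn lam univ (A ⋆ₗ C) = llaplaceOn lam univ A * llaplaceOn lam univ C := by
  simp only [llaplaceOn, Measure.restrict_univ]
  rw [← lintegral_lconvolution (by fun_prop) (by fun_prop)]
  refine lintegral_congr fun t => ?_
  rw [lconvolution_def, lconvolution_def, ← lintegral_const_mul _ (by fun_prop)]
  refine lintegral_congr fun σ => ?_
  have hexp : ENNReal.ofReal (Real.exp (-lam * t)) = ENNReal.ofReal (Real.exp (-lam * σ))
      * ENNReal.ofReal (Real.exp (-lam * (-σ + t))) := by
    rw [← ENNReal.ofReal_mul (Real.exp_pos _).le, ← Real.exp_add]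
    ring_nf
  rw [hexp]
  ring

theorem lconvolution_eq_zero_of_nonpos (hA : ∀ t ≤ 0, A t = 0) (hC : ∀ t ≤ 0, C t = 0) {t : ℝ}
    (ht : t ≤ 0) : (A ⋆ₗ C) t = 0 := by
  refine (lintegral_congr fun σ => ?_).trans lintegral_zero
  rcases le_or_gt σ 0 with hσ | hσ
  · rw [hA σ hσ, zero_mul]
  · rw [hC (-σ + t) (by linarith), mul_zero]

theorem llaplaceOn_Ioi_lconvolution (hA : Measurable A) (hC : Measurable C)
    (hA0 : ∀ t ≤ 0, A t = 0) (hC0 : ∀ t ≤ 0, C t = 0) :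
    llaplaceOn lam (Ioi 0) (A ⋆ₗ C) = llaplaceOn lam (Ioi 0) A * llaplaceOn lam (Ioi 0) C := by
  rw [llaplaceOn_Ioi_eq_univ hA0, llaplaceOn_Ioi_eq_univ hC0,
    llaplaceOn_Ioi_eq_univ fun _ => lconvolution_eq_zero_of_nonpos hA0 hC0,
    llaplaceOn_univ_lconvolution hA hC]

theorem llaplaceOn_Ioo_lconvolution_le (hA : Measurable A) (hC : Measurable C)
    (hA0 : ∀ t ≤ 0, A t = 0) (hC0 : ∀ t ≤ 0, C t = 0) :
    llaplaceOn lam (Ioo 0 T) (A ⋆ₗ C)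
      ≤ llaplaceOn lam (Ioo 0 T) A * llaplaceOn lam (Ioo 0 T) C := by
  -- On `(0, T)` only the restrictions of `A` and `C` to `(0, T)` enter the convolution.
  have hle : ∀ t, (Ioo 0 T).indicator (A ⋆ₗ C) t
      ≤ ((Ioo 0 T).indicator A ⋆ₗ (Ioo 0 T).indicator C) t := by
    refine indicator_le fun t ht => lintegral_mono fun σ => ?_
    rcases le_or_gt σ 0 with hσ | hσ
    · simp [hA0 σ hσ]
    rcases le_or_gt (-σ + t) 0 with hσt | hσt
    · simp [hC0 _ hσt]
    · rw [indicator_of_mem (show σ ∈ Ioo 0 T from ⟨hσ, by linarith [ht.2]⟩),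
        indicator_of_mem (show -σ + t ∈ Ioo 0 T from ⟨hσt, by linarith [ht.2]⟩)]
  simp only [← llaplaceOn_univ_indicator (A := A ⋆ₗ C) measurableSet_Ioo,
    ← llaplaceOn_univ_indicator (A := A) measurableSet_Ioo,
    ← llaplaceOn_univ_indicator (A := C) measurableSet_Ioo]
  rw [← llaplaceOn_univ_lconvolution (hA.indicator measurableSet_Ioo)
    (hC.indicator measurableSet_Ioo)]
  exact llaplaceOn_mono (ae_of_all _ hle)

theorem llaplaceOn_Ioo_le_lintegral (hlam : 0 ≤ lam) :
    llaplaceOn lam (Ioo 0 T) A ≤ ∫⁻ t in Ioo 0 T, A t := by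
  refine setLIntegral_mono' measurableSet_Ioo fun t ht => mul_le_of_le_one_left zero_le ?_
  rw [ENNReal.ofReal_le_one, Real.exp_le_one_iff]
  nlinarith [ht.1]

theorem lintegral_Ioo_le_llaplaceOn (hlam : 0 ≤ lam) (hA : Measurable A) :
    ∫⁻ t in Ioo 0 T, A t ≤ ENNReal.ofReal (Real.exp (lam * T)) * llaplaceOn lam (Ioo 0 T) A := by
  rw [llaplaceOn, ← lintegral_const_mul _ (by fun_prop)]
  refine setLIntegral_mono' measurableSet_Ioo fun t ht => ?_
  rw [← mul_assoc, ← ENNReal.ofReal_mul (Real.exp_pos _).le, ← Real.exp_add]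
  refine le_mul_of_one_le_left zero_le ?_
  rw [ENNReal.one_le_ofReal, Real.one_le_exp_iff]
  nlinarith [ht.2]

theorem exists_llaplaceOn_Ioo_le (hA : Measurable A) (hfin : ∫⁻ t in Ioo 0 T, A t ≠ ∞)
    {ε : ℝ≥0∞} (hε : 0 < ε) : ∃ lam : ℝ, 0 ≤ lam ∧ llaplaceOn lam (Ioo 0 T) A ≤ ε := by
  have h : Tendsto (fun n : ℕ => llaplaceOn n (Ioo 0 T) A) atTop (𝓝 (∫⁻ _ in Ioo 0 T, 0)) := by
    refine tendsto_lintegral_of_dominated_convergence A (fun n => by fun_prop) (fun n => ?_) hfin ?_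
    · filter_upwards [ae_restrict_mem measurableSet_Ioo] with t ht
      refine mul_le_of_le_one_left zero_le ?_
      rw [ENNReal.ofReal_le_one, Real.exp_le_one_iff]
      linarith [mul_nonneg n.cast_nonneg ht.1.le]
    · filter_upwards [ae_restrict_mem measurableSet_Ioo, ae_lt_top hA hfin] with t ht htop
      have hexp : Tendsto (fun n : ℕ => Real.exp (-n * t)) atTop (𝓝 0) := by
        simp only [neg_mul]
        exact Real.tendsto_exp_neg_atTop_nhds_zero.comp
          (tendsto_natCast_atTop_atTop.atTop_mul_const ht.1)
      simpa using ENNReal.Tendsto.mul_const (ENNReal.tendsto_ofReal hexp) (Or.inr htop.ne)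
  rw [lintegral_zero] at h
  obtain ⟨n, hn⟩ := (h.eventually (ge_mem_nhds hε)).exists
  exact ⟨n, n.cast_nonneg, hn⟩

/-- For `lam` so large that `k ρ` has weighted mass at most one half, the convolution term is
absorbed into the left-hand side. -/
theorem llaplaceOn_le_two_mul_of_le_add_lconvolution {β ρ g : ℝ → ℝ≥0∞} (hβ : Measurable β)
    (hρ : Measurable ρ) (hg : Measurable g) (hβ0 : ∀ t ≤ 0, β t = 0) (hρ0 : ∀ t ≤ 0, ρ t = 0)
    {k : ℝ≥0∞} (hfin : llaplaceOn lam (Ioo 0 T) β ≠ ∞)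
    (hsmall : k * llaplaceOn lam (Ioo 0 T) ρ ≤ 2⁻¹)
    (h : ∀ᵐ t ∂volume.restrict (Ioo 0 T), β t ≤ g t + k * (β ⋆ₗ ρ) t) :
    llaplaceOn lam (Ioo 0 T) β ≤ 2 * llaplaceOn lam (Ioo 0 T) g := by
  have habsorb : llaplaceOn lam (Ioo 0 T) β
      ≤ llaplaceOn lam (Ioo 0 T) g + 2⁻¹ * llaplaceOn lam (Ioo 0 T) β := by
    calc llaplaceOn lam (Ioo 0 T) β
        ≤ llaplaceOn lam (Ioo 0 T) (fun t => g t + k * (β ⋆ₗ ρ) t) := llaplaceOn_mono h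
      _ = llaplaceOn lam (Ioo 0 T) g + k * llaplaceOn lam (Ioo 0 T) (β ⋆ₗ ρ) := by
          rw [llaplaceOn_add hg, llaplaceOn_const_mul (by fun_prop)]
      _ ≤ llaplaceOn lam (Ioo 0 T) g
          + k * (llaplaceOn lam (Ioo 0 T) β * llaplaceOn lam (Ioo 0 T) ρ) := by
          gcongr
          exact llaplaceOn_Ioo_lconvolution_le hβ hρ hβ0 hρ0
      _ ≤ llaplaceOn lam (Ioo 0 T) g + 2⁻¹ * llaplaceOn lam (Ioo 0 T) β := by
          rw [mul_left_comm, mul_comm 2⁻¹]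
          gcongr
  generalize llaplaceOn lam (Ioo 0 T) β = x at *
  generalize llaplaceOn lam (Ioo 0 T) g = y at *
  have hx : 2⁻¹ * x + 2⁻¹ * x = x := by
    rw [← add_mul, ENNReal.inv_two_add_inv_two, one_mul]
  have hhalf : 2⁻¹ * x ≤ y :=
    (ENNReal.add_le_add_iff_right (ENNReal.mul_ne_top (by simp) hfin)).1 (hx.le.trans habsorb)
  calc x = 2 * (2⁻¹ * x) := by rw [two_mul, hx]
    _ ≤ 2 * y := by gcongr

end WeightedIntegral

section Approximation

open scoped unitInterval

variable {X : Type*} [NormedAddCommGroup X] [NormedSpace ℝ X]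

theorem exists_polynomial_approx (F : C(I, X)) {ε : ℝ} (hε : 0 < ε) :
    ∃ N : ℕ, ∃ c : ℕ → X, ∀ x : I, ‖F x - ∑ k ∈ Finset.range N, (x : ℝ) ^ k • c k‖ ≤ ε := by
  obtain ⟨n, hn⟩ := Metric.tendsto_atTop.1 (bernsteinApproximation_uniform F) ε hε
  let N := Finset.univ.sup fun k : Fin (n + 1) => (bernsteinPolynomial ℝ n k).natDegree
  let c : ℕ → X := fun j =>
    ∑ k : Fin (n + 1), (bernsteinPolynomial ℝ n k).coeff j • F (bernstein.z k)
  have heval : ∀ (k : Fin (n + 1)) (x : I), bernstein n k x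
      = ∑ j ∈ Finset.range (N + 1), (x : ℝ) ^ j * (bernsteinPolynomial ℝ n k).coeff j :=
    fun k x => by
      simp only [mul_comm ((x : ℝ) ^ _)]
      exact Polynomial.eval_eq_sum_range' (Nat.lt_succ_of_le (Finset.le_sup
        (f := fun k : Fin (n + 1) => (bernsteinPolynomial ℝ n k).natDegree)
        (Finset.mem_univ k))) (x : ℝ)
  have hpoly : ∀ x : I,
      bernsteinApproximation n F x = ∑ j ∈ Finset.range (N + 1), (x : ℝ) ^ j • c j := fun x => by
    simp only [bernsteinApproximation.apply, heval, Finset.sum_smul, c, Finset.smul_sum, mul_smul]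
    exact Finset.sum_comm
  refine ⟨N + 1, c, fun x => ?_⟩
  rw [← hpoly, ← dist_eq_norm, dist_comm]
  exact (ContinuousMap.dist_le hε.le).1 (hn n le_rfl).le x

theorem ext_of_moments {P Q : Measure I} [IsFiniteMeasure P] [IsFiniteMeasure Q]
    (h : ∀ n : ℕ, ∫ x : I, (x : ℝ) ^ n ∂P = ∫ x : I, (x : ℝ) ^ n ∂Q) : P = Q := by
  have hcont : ∀ (ρ : Measure I) [IsFiniteMeasure ρ],
      Continuous fun f : C(I, ℝ) => ∫ x, f x ∂ρ := fun ρ _ => by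
    refine (continuous_integral.comp (ContinuousMap.toLp 1 ρ ℝ).continuous).congr fun f => ?_
    exact integral_congr_ae (ContinuousMap.coeFn_toLp ρ f)
  have hpoly : ∀ q : Polynomial ℝ, ∫ x : I, q.eval (x : ℝ) ∂P = ∫ x : I, q.eval (x : ℝ) ∂Q := by
    intro q
    have hmono : ∀ (ρ : Measure I) [IsFiniteMeasure ρ] (n : ℕ),
        Integrable (fun x : I => q.coeff n * (x : ℝ) ^ n) ρ := fun ρ _ n =>
      (BoundedContinuousFunction.mkOfCompact
        ⟨fun x : I => q.coeff n * (x : ℝ) ^ n, by fun_prop⟩).integrable ρ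
    simp only [Polynomial.eval_eq_sum_range]
    rw [integral_finsetSum _ fun n _ => hmono P n, integral_finsetSum _ fun n _ => hmono Q n]
    simp only [integral_const_mul, h]
  refine ext_of_forall_integral_eq_of_IsFiniteMeasure fun f => ?_
  have hf : f.toContinuousMap ∈ (polynomialFunctions I).topologicalClosure := by
    rw [polynomialFunctions_closure_eq_top']
    exact Algebra.mem_top
  refine closure_minimal (s := (polynomialFunctions I : Set C(I, ℝ)))
    (t := {f | ∫ x, f x ∂P = ∫ x, f x ∂Q}) ?_ (isClosed_eq (hcont P) (hcont Q)) hf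
  rw [polynomialFunctions_coe]
  rintro _ ⟨q, rfl⟩
  exact hpoly q

/-- The substitution `t ↦ e^{-t}`, turning Laplace transforms on the half-line into moments on the
unit interval; negative `t` are sent to `1`. -/
def expNeg (t : ℝ) : I :=
  ⟨Real.exp (-max t 0), (Real.exp_pos _).le, Real.exp_le_one_iff.2 (by simp)⟩

theorem measurable_expNeg : Measurable expNeg :=
  Measurable.subtype_mk (by fun_prop)

theorem coe_expNeg {t : ℝ} (ht : 0 ≤ t) : (expNeg t : ℝ) = Real.exp (-t) :=
  congrArg (fun s => Real.exp (-s)) (max_eq_left ht)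

/-- The moment of real order `lam` of a measure on the unit interval. -/
def lmoment (lam : ℝ) (P : Measure I) : ℝ≥0∞ := ∫⁻ x, ENNReal.ofReal ((x : ℝ) ^ lam) ∂P

theorem integral_rpow_eq_toReal_lmoment (lam : ℝ) (P : Measure I) :
    ∫ x : I, (x : ℝ) ^ lam ∂P = (lmoment lam P).toReal :=
  integral_eq_lintegral_of_nonneg_ae (ae_of_all _ fun x => Real.rpow_nonneg x.2.1 _)
    (measurable_subtype_coe.pow_const lam).aestronglyMeasurable

theorem lmoment_map_expNeg (lam : ℝ) {A : ℝ → ℝ≥0∞} (hA : Measurable A) :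
    lmoment lam (((volume.restrict (Ioi 0)).withDensity A).map expNeg)
      = llaplaceOn lam (Ioi 0) A := by
  have hpow : Measurable fun x : I => ENNReal.ofReal ((x : ℝ) ^ lam) := by fun_prop
  rw [lmoment, lintegral_map hpow measurable_expNeg,
    lintegral_withDensity_eq_lintegral_mul _ hA
      (show Measurable fun t => ENNReal.ofReal ((expNeg t : ℝ) ^ lam) from
        hpow.comp measurable_expNeg)]
  refine setLIntegral_congr_fun measurableSet_Ioi fun t ht => ?_
  rw [Pi.mul_apply, mul_comm, coe_expNeg (le_of_lt ht), ← Real.exp_mul, neg_mul_comm, mul_comm t]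

theorem ae_eq_of_llaplaceOn_eq {A C : ℝ → ℝ≥0∞} (hA : Measurable A) (hC : Measurable C)
    (hfin : ∀ lam : ℝ, 0 < lam → llaplaceOn lam (Ioi 0) A ≠ ∞)
    (h : ∀ lam : ℝ, 0 < lam → llaplaceOn lam (Ioi 0) A = llaplaceOn lam (Ioi 0) C) :
    A =ᵐ[volume.restrict (Ioi 0)] C := by
  let w : ℝ → ℝ≥0∞ := fun t => ENNReal.ofReal (Real.exp (-1 * t))
  have hw : Measurable w := by fun_prop
  let κ : (ℝ → ℝ≥0∞) → Measure ℝ := fun D => (volume.restrict (Ioi 0)).withDensity (w * D)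
  have hκfin : ∀ D, llaplaceOn 1 (Ioi 0) D ≠ ∞ → IsFiniteMeasure (κ D) := fun D hD =>
    isFiniteMeasure_withDensity hD
  have hmoment : ∀ (n : ℕ) (D : ℝ → ℝ≥0∞), Measurable D →
      lmoment n ((κ D).map expNeg) = llaplaceOn (n + 1) (Ioi 0) D := fun n D hD => by
    rw [lmoment_map_expNeg _ (hw.mul hD)]
    refine lintegral_congr fun t => ?_
    rw [Pi.mul_apply, ← mul_assoc, ← ENNReal.ofReal_mul (Real.exp_pos _).le, ← Real.exp_add]
    ring_nf
  have hrecover : ∀ D, ((κ D).map expNeg).map (fun x : I => -Real.log x) = κ D := fun D => by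
    rw [Measure.map_map (by fun_prop) measurable_expNeg]
    refine (Measure.map_congr ?_).trans Measure.map_id
    filter_upwards [(withDensity_absolutelyContinuous _ _).ae_le
      (ae_restrict_mem measurableSet_Ioi)] with t ht
    rw [Function.comp_apply, coe_expNeg (le_of_lt ht), Real.log_exp, neg_neg, id]
  have := hκfin A (hfin 1 one_pos)
  have := hκfin C (h 1 one_pos ▸ hfin 1 one_pos)
  have hmap : (κ A).map expNeg = (κ C).map expNeg := by
    refine ext_of_moments fun n => ?_
    simp only [← Real.rpow_natCast, integral_rpow_eq_toReal_lmoment]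
    rw [hmoment n A hA, hmoment n C hC, h _ (by positivity)]
  have hκ : κ A = κ C := by rw [← hrecover A, hmap, hrecover C]
  filter_upwards [(withDensity_eq_iff (hw.mul hA).aemeasurable (hw.mul hC).aemeasurable
    (hfin 1 one_pos)).1 hκ] with t ht
  exact (ENNReal.mul_right_inj (by simp [Real.exp_pos]) ENNReal.ofReal_ne_top).1 ht

theorem exists_exp_sum_approx {h : ℝ → X} (hc : Continuous h) {R : ℝ}
    (hR : ∀ t, R ≤ t → h t = 0) {ε : ℝ} (hε : 0 < ε) :
    ∃ N : ℕ, ∃ c : ℕ → X, ∀ t : ℝ, 0 ≤ t →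
      ‖h t - ∑ k ∈ Finset.range N, Real.exp (-k * t) • c k‖ ≤ ε := by
  -- Cutting `x` off at `e^{-R}` keeps `-log x` continuous down to `x = 0`.
  let F : C(I, X) := ⟨fun x => h (-Real.log (max (x : ℝ) (Real.exp (-R)))),
    hc.comp (Continuous.log (by fun_prop)
      fun x => (lt_max_of_lt_right (Real.exp_pos _)).ne').neg⟩
  have hF : ∀ t, 0 ≤ t → F (expNeg t) = h t := fun t ht => by
    change h (-Real.log (max (expNeg t : ℝ) (Real.exp (-R)))) = h t
    rw [coe_expNeg ht]
    rcases le_total t R with htR | htR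
    · rw [max_eq_left (Real.exp_le_exp.2 (by linarith)), Real.log_exp, neg_neg]
    · rw [max_eq_right (Real.exp_le_exp.2 (by linarith)), Real.log_exp, neg_neg, hR t htR,
        hR R le_rfl]
  obtain ⟨N, c, hN⟩ := exists_polynomial_approx F hε
  refine ⟨N, c, fun t ht => ?_⟩
  have hpow : ∀ k : ℕ, Real.exp (-k * t) = (expNeg t : ℝ) ^ k := fun k => by
    rw [coe_expNeg ht, ← Real.exp_nat_mul, neg_mul_comm]
  simp only [hpow, ← hF t ht]
  exact hN _

theorem exists_exp_sum_approx_of_bounded {h : ℝ → X} (hc : ContinuousOn h (Ici 0)) {C : ℝ}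
    (hC : ∀ t, 0 ≤ t → ‖h t‖ ≤ C) (R : ℝ) {ε : ℝ} (hε : 0 < ε) :
    ∃ N : ℕ, ∃ c : ℕ → X, ∀ t : ℝ, 0 ≤ t →
      ‖h t - ∑ k ∈ Finset.range N, Real.exp (-k * t) • c k‖
        ≤ ε + (Ioi R).indicator (fun _ => C) t := by
  let χ : ℝ → ℝ := fun t => max 0 (min 1 (R + 1 - t))
  have hχ0 : ∀ t, 0 ≤ χ t := fun t => le_max_left _ _
  have hχ1 : ∀ t, χ t ≤ 1 := fun t => max_le zero_le_one (min_le_left _ _)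
  have hcut : Continuous fun t => χ t • h (max t 0) :=
    Continuous.smul (by fun_prop) (hc.comp_continuous (by fun_prop) fun t => le_max_right t 0)
  obtain ⟨N, c, hN⟩ := exists_exp_sum_approx hcut (R := R + 1) (fun t ht => by
    rw [show χ t = 0 from max_eq_left ((min_le_right _ _).trans (by linarith)), zero_smul]) hε
  refine ⟨N, c, fun t ht => ?_⟩
  have hcutoff : ‖h t - χ t • h t‖ ≤ (Ioi R).indicator (fun _ => C) t := by
    rw [show h t - χ t • h t = (1 - χ t) • h t by rw [sub_smul, one_smul], norm_smul,
      Real.norm_of_nonneg (sub_nonneg.2 (hχ1 t))]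
    rcases le_or_gt t R with htR | htR
    · have hχt : χ t = 1 := by simp [χ, show 1 ≤ R + 1 - t by linarith]
      rw [hχt, sub_self, zero_mul, indicator_of_notMem (notMem_Ioi.2 htR)]
    · rw [indicator_of_mem (mem_Ioi.2 htR)]
      exact (mul_le_of_le_one_left (norm_nonneg _) (by linarith [hχ0 t])).trans (hC t ht)
  have happrox := hN t ht
  rw [max_eq_left ht] at happrox
  exact (norm_sub_le_norm_sub_add_norm_sub _ (χ t • h t) _).trans
    ((add_le_add hcutoff happrox).trans_eq (add_comm _ _))

theorem integrable_of_continuousOn_Ici {E : Type*} [NormedAddCommGroup E] {P : Measure ℝ}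
    [IsFiniteMeasure P] (hP : ∀ᵐ t ∂P, 0 ≤ t) {h : ℝ → E} (hc : ContinuousOn h (Ici 0)) {C : ℝ}
    (hC : ∀ t, 0 ≤ t → ‖h t‖ ≤ C) : Integrable h P := by
  refine Integrable.of_bound ?_ C (hP.mono hC)
  rw [← Measure.restrict_eq_self_of_ae_mem (s := Ici 0) hP]
  exact hc.aestronglyMeasurable measurableSet_Ici

theorem integrable_exp_neg_mul {P : Measure ℝ} [IsFiniteMeasure P] (hP : ∀ᵐ t ∂P, 0 ≤ t)
    {k : ℝ} (hk : 0 ≤ k) : Integrable (fun t => Real.exp (-k * t)) P := by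
  refine integrable_of_continuousOn_Ici hP (by fun_prop) (C := 1) fun t ht => ?_
  rw [Real.norm_of_nonneg (Real.exp_pos _).le, Real.exp_le_one_iff]
  nlinarith

/-- Only finitely many values of the Laplace transform of `ν` enter, and they do so with
coefficients that do not depend on `ν`. -/
theorem exists_laplace_sum_approx [CompleteSpace X] {h : ℝ → X} (hc : ContinuousOn h (Ici 0))
    {C : ℝ} (hC : ∀ t, 0 ≤ t → ‖h t‖ ≤ C) (R : ℝ) {ε : ℝ} (hε : 0 < ε) :
    ∃ N : ℕ, ∃ c : ℕ → X, ∀ ν : Measure ℝ, IsProbabilityMeasure ν → (∀ᵐ t ∂ν, 0 ≤ t) →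
      ‖∫ t, h t ∂ν - ∑ k ∈ Finset.range N, (∫ t, Real.exp (-k * t) ∂ν) • c k‖
        ≤ ε + C * ν.real (Ioi R) := by
  obtain ⟨N, c, hN⟩ := exists_exp_sum_approx_of_bounded hc hC R hε
  refine ⟨N, c, fun ν _ hν => ?_⟩
  have hexp := fun k : ℕ => integrable_exp_neg_mul hν (k.cast_nonneg (α := ℝ))
  have hsum : ∑ k ∈ Finset.range N, (∫ t, Real.exp (-k * t) ∂ν) • c k
      = ∫ t, ∑ k ∈ Finset.range N, Real.exp (-k * t) • c k ∂ν := by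
    rw [integral_finsetSum _ fun k _ => (hexp k).smul_const _]
    simp only [integral_smul_const]
  have hbound : ∫ t, (ε + (Ioi R).indicator (fun _ => C) t) ∂ν = ε + C * ν.real (Ioi R) := by
    rw [integral_add (integrable_const _) ((integrable_const C).indicator measurableSet_Ioi),
      integral_indicator_const _ measurableSet_Ioi, integral_const, probReal_univ, one_smul,
      smul_eq_mul, mul_comm C]
  rw [hsum, ← integral_sub (integrable_of_continuousOn_Ici hν hc hC)
    (integrable_finsetSum _ fun k _ => (hexp k).smul_const _), ← hbound]
  exact norm_integral_le_of_norm_le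
    ((integrable_const ε).add ((integrable_const C).indicator measurableSet_Ioi))
    (hν.mono hN)

end Approximation

section CausalKernel

variable {a a' b c c' m r x y : ℝ → ℝ} {k lam t T : ℝ}

theorem ae_restrict_Ioi_of_forall_Ioo {P : ℝ → Prop}
    (h : ∀ T : ℝ, ∀ᵐ t ∂volume.restrict (Ioo 0 T), P t) : ∀ᵐ t ∂volume.restrict (Ioi 0), P t := by
  refine ae_mono (Measure.restrict_mono (fun t ht => ?_) le_rfl)
    ((ae_restrict_iUnion_iff (fun n : ℕ => Ioo (0 : ℝ) n) P).2 fun n => h n)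
  obtain ⟨n, hn⟩ := exists_nat_gt t
  exact mem_iUnion.2 ⟨n, ht, hn⟩

theorem LocInt.aestronglyMeasurable (hb : LocInt b) :
    AEStronglyMeasurable b (volume.restrict (Ioi 0)) := by
  refine ((aestronglyMeasurable_iUnion_iff (s := fun n : ℕ => Ioc (0 : ℝ) n)).2
    fun n => (hb n).aestronglyMeasurable).mono_measure
      (Measure.restrict_mono (fun t ht => ?_) le_rfl)
  obtain ⟨n, hn⟩ := exists_nat_ge t
  exact mem_iUnion.2 ⟨n, ht, hn⟩

theorem LocInt.lintegral_enorm_Ioo_ne_top (hb : LocInt b) (T : ℝ) :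
    ∫⁻ t in Ioo 0 T, ‖b t‖ₑ ≠ ∞ :=
  ((hb T).mono_set Ioo_subset_Ioc_self).2.ne

theorem LocInt.congr_ae (hb : LocInt b) (h : a =ᵐ[volume.restrict (Ioi 0)] b) : LocInt a :=
  fun R => (hb R).congr (ae_restrict_of_ae_restrict_of_subset Ioc_subset_Ioi_self h.symm)

theorem laplace_congr_ae (h : a =ᵐ[volume.restrict (Ioi 0)] b) : laplace a lam = laplace b lam := by
  refine integral_congr_ae ?_
  filter_upwards [h] with t ht
  rw [ht]

theorem conv_congr_ae (ha : a' =ᵐ[volume.restrict (Ioi 0)] a)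
    (hc : c' =ᵐ[volume.restrict (Ioi 0)] c) (ht : 0 ≤ t) : conv a' c' t = conv a c t := by
  rw [conv, conv, intervalIntegral.integral_of_le ht, intervalIntegral.integral_of_le ht,
    integral_Ioc_eq_integral_Ioo, integral_Ioc_eq_integral_Ioo]
  refine setIntegral_congr_ae measurableSet_Ioo ?_
  rw [EventuallyEq, ae_restrict_iff' measurableSet_Ioi] at ha hc
  filter_upwards [(Measure.measurePreserving_sub_left volume t).quasiMeasurePreserving.ae ha, hc]
    with σ haσ hcσ hσ
  rw [haσ (by simpa using hσ.2), hcσ hσ.1]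

theorem conv_eq_integral (ha : ∀ t ≤ 0, a t = 0) (hc : ∀ t ≤ 0, c t = 0) (ht : 0 ≤ t) :
    conv a c t = ∫ σ, a (t - σ) * c σ := by
  rw [conv, intervalIntegral.integral_of_le ht]
  refine setIntegral_eq_integral_of_forall_compl_eq_zero fun σ hσ => ?_
  rcases le_or_gt σ 0 with h | h
  · rw [hc σ h, mul_zero]
  · rw [ha (t - σ) (by linarith [not_le.1 fun h' => hσ ⟨h, h'⟩]), zero_mul]

theorem CompletelyPositive.congr_ae (hb : CompletelyPositive b)
    (h : a =ᵐ[volume.restrict (Ioi 0)] b) : CompletelyPositive a where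
  locInt := hb.locInt.congr_ae h
  ne_zero h0 := hb.ne_zero (by filter_upwards [h, h0] with t ht h0t using ht ▸ h0t)
  exists_s μ hμ := by
    obtain ⟨s, hs, heq, hs0⟩ := hb.exists_s μ hμ
    refine ⟨s, hs, ?_, hs0⟩
    filter_upwards [heq, ae_restrict_mem measurableSet_Ioi] with t ht htpos
    rwa [conv_congr_ae h ae_eq_rfl (le_of_lt htpos)]
  exists_r μ hμ := by
    obtain ⟨s, hs, heq, hs0⟩ := hb.exists_r μ hμ
    refine ⟨s, hs, ?_, hs0⟩
    filter_upwards [heq, h, ae_restrict_mem measurableSet_Ioi] with t ht hat htpos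
    rw [conv_congr_ae h ae_eq_rfl (le_of_lt htpos), ht, hat]

theorem LocInt.exists_measurable_eq_zero (hb : LocInt b) :
    ∃ a : ℝ → ℝ, Measurable a ∧ (∀ t ≤ 0, a t = 0) ∧ a =ᵐ[volume.restrict (Ioi 0)] b := by
  have h := hb.aestronglyMeasurable
  refine ⟨(Ioi 0).indicator (h.mk b), h.stronglyMeasurable_mk.measurable.indicator
    measurableSet_Ioi, fun t ht => indicator_of_notMem (not_lt.2 ht) _, ?_⟩
  exact (indicator_ae_eq_restrict measurableSet_Ioi).trans h.ae_eq_mk.symm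

/-- A nonnegative measurable kernel that vanishes for nonpositive times. Every nonnegative
`LocInt` kernel has such a version, and for these convolutions over `(0, t)` become convolutions
over the whole line. -/
structure IsCausalKernel (b : ℝ → ℝ) : Prop where
  measurable : Measurable b
  nonneg : ∀ t, 0 ≤ b t
  eq_zero : ∀ t ≤ 0, b t = 0

theorem IsCausalKernel.enorm_eq_zero (hb : IsCausalKernel b) (t : ℝ) (ht : t ≤ 0) : ‖b t‖ₑ = 0 := by
  rw [hb.eq_zero t ht, enorm_zero]

theorem LocInt.exists_isCausalKernel (hb : LocInt b)
    (h0 : ∀ᵐ t ∂volume.restrict (Ioi (0 : ℝ)), 0 ≤ b t) :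
    ∃ a, IsCausalKernel a ∧ a =ᵐ[volume.restrict (Ioi 0)] b := by
  obtain ⟨a, ham, ha0, hab⟩ := hb.exists_measurable_eq_zero
  refine ⟨fun t => max (a t) 0, ⟨by fun_prop, fun t => le_max_right _ _,
    fun t ht => by simp [ha0 t ht]⟩, ?_⟩
  filter_upwards [h0, hab] with t h0t habt
  rw [habt, max_eq_left h0t]

theorem ae_eq_zero_of_le_lconvolution {β ρ : ℝ → ℝ≥0∞} (hβ : Measurable β) (hρ : Measurable ρ)
    (hβ0 : ∀ t ≤ 0, β t = 0) (hρ0 : ∀ t ≤ 0, ρ t = 0)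
    (hβfin : ∀ T : ℝ, ∫⁻ t in Ioo 0 T, β t ≠ ∞) (hρfin : ∀ T : ℝ, ∫⁻ t in Ioo 0 T, ρ t ≠ ∞)
    (h : ∀ᵐ t ∂volume.restrict (Ioi 0), β t ≤ (β ⋆ₗ ρ) t) :
    ∀ᵐ t ∂volume.restrict (Ioi 0), β t = 0 := by
  refine ae_restrict_Ioi_of_forall_Ioo fun T => ?_
  obtain ⟨lam, hlam, hsmall⟩ := exists_llaplaceOn_Ioo_le hρ (hρfin T)
    (show (0 : ℝ≥0∞) < 2⁻¹ by simp)
  have hzero : llaplaceOn lam (Ioo 0 T) β ≤ 2 * llaplaceOn lam (Ioo 0 T) fun _ => 0 :=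
    llaplaceOn_le_two_mul_of_le_add_lconvolution (k := 1) hβ hρ (by fun_prop) hβ0 hρ0
      (ne_top_of_le_ne_top (hβfin T) (llaplaceOn_Ioo_le_lintegral hlam)) (by rwa [one_mul])
      (by simpa only [zero_add, one_mul] using
        ae_restrict_of_ae_restrict_of_subset Ioo_subset_Ioi_self h)
  have hinteg : ∫⁻ t in Ioo 0 T, ENNReal.ofReal (Real.exp (-lam * t)) * β t = 0 := by
    simpa [llaplaceOn] using hzero
  filter_upwards [(lintegral_eq_zero_iff (by fun_prop)).1 hinteg] with t ht
  simpa [(Real.exp_pos _).not_ge] using ht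

theorem ofReal_integral_le_lintegral {α : Type*} [MeasurableSpace α] {μ : Measure α}
    (f : α → ℝ) : ENNReal.ofReal (∫ x, f x ∂μ) ≤ ∫⁻ x, ENNReal.ofReal (f x) ∂μ := by
  by_cases hf : Integrable f μ
  · rw [integral_eq_lintegral_pos_part_sub_lintegral_neg_part hf]
    exact (ENNReal.ofReal_le_ofReal (sub_le_self _ ENNReal.toReal_nonneg)).trans
      ENNReal.ofReal_toReal_le
  · simp [integral_undef hf]

/-- The negative part of `b` is dominated by its convolution with the resolvent kernel, so it
vanishes by Gronwall's argument. -/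
theorem ae_nonneg_of_add_conv_eq (hbm : Measurable b) (hb0 : ∀ t ≤ 0, b t = 0) (hb : LocInt b)
    (hr : IsCausalKernel r) (hrl : LocInt r)
    (h : ∀ᵐ t ∂volume.restrict (Ioi (0 : ℝ)), r t + conv b r t = b t) :
    ∀ᵐ t ∂volume.restrict (Ioi (0 : ℝ)), 0 ≤ b t := by
  have hrm := hr.measurable
  have hle : ∀ᵐ t ∂volume.restrict (Ioi (0 : ℝ)), ENNReal.ofReal (-b t)
      ≤ ((fun t => ENNReal.ofReal (-b t)) ⋆ₗ fun t => ‖r t‖ₑ) t := by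
    filter_upwards [h, ae_restrict_mem measurableSet_Ioi] with t ht htpos
    rw [conv_eq_integral hb0 hr.eq_zero (le_of_lt htpos)] at ht
    calc ENNReal.ofReal (-b t) ≤ ENNReal.ofReal (∫ σ, -(b (t - σ) * r σ)) := by
          rw [integral_neg]
          exact ENNReal.ofReal_le_ofReal (by linarith [hr.nonneg t])
      _ ≤ ∫⁻ σ, ENNReal.ofReal (-(b (t - σ) * r σ)) := ofReal_integral_le_lintegral _
      _ = ∫⁻ σ, ENNReal.ofReal (-b (t - σ)) * ‖r (-(t - σ) + t)‖ₑ := by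
          refine lintegral_congr fun σ => ?_
          rw [neg_sub, sub_add_cancel, Real.enorm_of_nonneg (hr.nonneg σ), ← neg_mul,
            ENNReal.ofReal_mul' (hr.nonneg σ)]
      _ = ((fun t => ENNReal.ofReal (-b t)) ⋆ₗ fun t => ‖r t‖ₑ) t :=
          lintegral_sub_left_eq_self
            (fun σ => ENNReal.ofReal (-b σ) * ‖r (-σ + t)‖ₑ) t
  have hneg : ∀ t, ENNReal.ofReal (-b t) ≤ ‖b t‖ₑ := fun t => by
    rw [← ofReal_norm]
    exact ENNReal.ofReal_le_ofReal (neg_le_abs _)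
  filter_upwards [ae_eq_zero_of_le_lconvolution (by fun_prop) (by fun_prop)
    (fun t ht => by simp [hb0 t ht]) hr.enorm_eq_zero
    (fun T => ne_top_of_le_ne_top (hb.lintegral_enorm_Ioo_ne_top T) (lintegral_mono hneg))
    hrl.lintegral_enorm_Ioo_ne_top hle] with t ht
  simpa using ht

theorem CompletelyPositive.exists_isCausalKernel (hm : CompletelyPositive m) :
    ∃ b, IsCausalKernel b ∧ CompletelyPositive b ∧ b =ᵐ[volume.restrict (Ioi 0)] m := by
  obtain ⟨b, hbm, hb0, hb⟩ := hm.locInt.exists_measurable_eq_zero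
  have hbcp := hm.congr_ae hb
  obtain ⟨r, hr, hreq, hr0⟩ := hbcp.exists_r 1 one_pos
  obtain ⟨r', hr'c, hr'⟩ := hr.exists_isCausalKernel hr0
  have hbnn : ∀ᵐ t ∂volume.restrict (Ioi (0 : ℝ)), 0 ≤ b t := by
    refine ae_nonneg_of_add_conv_eq hbm hb0 hbcp.locInt hr'c (hr.congr_ae hr') ?_
    filter_upwards [hreq, hr', ae_restrict_mem measurableSet_Ioi] with t ht hrt htpos
    rw [conv_congr_ae ae_eq_rfl hr' (le_of_lt htpos), hrt, ← ht, one_mul]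
  obtain ⟨a, ha, hab⟩ := hbcp.locInt.exists_isCausalKernel hbnn
  exact ⟨a, ha, hbcp.congr_ae hab, hab.trans hb⟩

/-- `x` is a causal solution of the Volterra equation `x + k b * x = y` on the half-line. -/
structure IsVolterraSolution (k : ℝ) (b y x : ℝ → ℝ) : Prop extends IsCausalKernel x where
  ae_eq : ∀ᵐ t ∂volume.restrict (Ioi (0 : ℝ)), Integrable (fun σ => b (t - σ) * x σ) ∧
    x t + k * ∫ σ, b (t - σ) * x σ = y t

theorem IsCausalKernel.lconvolution_lt_top (hb : IsCausalKernel b) (hx : IsCausalKernel x)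
    (hbl : LocInt b) (hxl : LocInt x) :
    ∀ᵐ t ∂volume.restrict (Ioi (0 : ℝ)), ((‖x ·‖ₑ) ⋆ₗ (‖b ·‖ₑ)) t < ∞ := by
  have hbm := hb.measurable
  have hxm := hx.measurable
  refine ae_restrict_Ioi_of_forall_Ioo fun T => ae_lt_top (by fun_prop) ?_
  have h := llaplaceOn_Ioo_lconvolution_le (lam := 0) (T := T) (by fun_prop : Measurable (‖x ·‖ₑ))
    (by fun_prop : Measurable (‖b ·‖ₑ)) hx.enorm_eq_zero hb.enorm_eq_zero
  simp only [llaplaceOn, neg_zero, zero_mul, Real.exp_zero, ENNReal.ofReal_one, one_mul] at h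
  exact ne_top_of_le_ne_top (ENNReal.mul_ne_top (hxl.lintegral_enorm_Ioo_ne_top T)
    (hbl.lintegral_enorm_Ioo_ne_top T)) h

theorem lintegral_enorm_mul_sub_eq_lconvolution (b x : ℝ → ℝ) (t : ℝ) :
    ∫⁻ σ, ‖b (t - σ) * x σ‖ₑ = ((‖x ·‖ₑ) ⋆ₗ (‖b ·‖ₑ)) t :=
  lintegral_congr fun σ => by rw [enorm_mul, mul_comm, sub_eq_neg_add]

theorem IsCausalKernel.isVolterraSolution (hb : IsCausalKernel b) (hx : IsCausalKernel x)
    (hbl : LocInt b) (hxl : LocInt x)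
    (h : ∀ᵐ t ∂volume.restrict (Ioi (0 : ℝ)), x t + k * conv b x t = y t) :
    IsVolterraSolution k b y x where
  toIsCausalKernel := hx
  ae_eq := by
    have hbm := hb.measurable
    have hxm := hx.measurable
    filter_upwards [h, hb.lconvolution_lt_top hx hbl hxl, ae_restrict_mem measurableSet_Ioi]
      with t heq htop ht
    rw [conv_eq_integral hb.eq_zero hx.eq_zero (le_of_lt ht)] at heq
    exact ⟨⟨by fun_prop, (lintegral_enorm_mul_sub_eq_lconvolution b x t).trans_lt htop⟩, heq⟩

theorem IsVolterraSolution.enorm_eq (hk : 0 ≤ k) (hb : IsCausalKernel b)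
    (h : IsVolterraSolution k b y x) :
    ∀ᵐ t ∂volume.restrict (Ioi (0 : ℝ)),
      ‖x t‖ₑ + ENNReal.ofReal k * ((‖x ·‖ₑ) ⋆ₗ (‖b ·‖ₑ)) t = ‖y t‖ₑ := by
  filter_upwards [h.ae_eq] with t ⟨hinteg, heq⟩
  have hmul : ∀ σ, 0 ≤ b (t - σ) * x σ := fun σ => mul_nonneg (hb.nonneg _) (h.nonneg _)
  have hnn : 0 ≤ ∫ σ, b (t - σ) * x σ := integral_nonneg hmul
  have hconv : ((‖x ·‖ₑ) ⋆ₗ (‖b ·‖ₑ)) t = ENNReal.ofReal (∫ σ, b (t - σ) * x σ) := by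
    rw [← lintegral_enorm_mul_sub_eq_lconvolution,
      ofReal_integral_eq_lintegral_ofReal hinteg (ae_of_all _ hmul)]
    exact lintegral_congr fun σ => Real.enorm_of_nonneg (hmul σ)
  rw [hconv, ← ENNReal.ofReal_mul hk, Real.enorm_of_nonneg (h.nonneg t),
    ← ENNReal.ofReal_add (h.nonneg t) (mul_nonneg hk hnn), heq, Real.enorm_of_nonneg]
  rw [← heq]
  exact add_nonneg (h.nonneg t) (mul_nonneg hk hnn)

theorem IsVolterraSolution.llaplaceOn_eq (hk : 0 ≤ k) (hb : IsCausalKernel b)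
    (h : IsVolterraSolution k b y x) (lam : ℝ) :
    llaplaceOn lam (Ioi 0) (‖x ·‖ₑ) + ENNReal.ofReal k *
      (llaplaceOn lam (Ioi 0) (‖x ·‖ₑ) * llaplaceOn lam (Ioi 0) (‖b ·‖ₑ))
      = llaplaceOn lam (Ioi 0) (‖y ·‖ₑ) := by
  have hbm := hb.measurable
  have hxm := h.measurable
  rw [← llaplaceOn_Ioi_lconvolution (by fun_prop) (by fun_prop) h.enorm_eq_zero hb.enorm_eq_zero,
    ← llaplaceOn_const_mul (by fun_prop), ← llaplaceOn_add (by fun_prop)]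
  exact llaplaceOn_congr (h.enorm_eq hk hb)

theorem laplace_eq_toReal_llaplaceOn (hb : Measurable b) (hb0 : ∀ t, 0 ≤ b t) (lam : ℝ) :
    laplace b lam = (llaplaceOn lam (Ioi 0) (‖b ·‖ₑ)).toReal := by
  rw [laplace, integral_eq_lintegral_of_nonneg_ae
    (ae_of_all _ fun t => mul_nonneg (Real.exp_pos _).le (hb0 t)) (by fun_prop), llaplaceOn]
  congr 1
  refine lintegral_congr fun t => ?_
  rw [ENNReal.ofReal_mul (Real.exp_pos _).le, Real.enorm_of_nonneg (hb0 t)]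

theorem llaplaceOn_one (hlam : 0 < lam) :
    llaplaceOn lam (Ioi 0) (fun _ => 1) = ENNReal.ofReal (1 / lam) := by
  simp only [llaplaceOn, mul_one]
  rw [← ofReal_integral_eq_lintegral_ofReal (integrableOn_exp_mul_Ioi (by linarith) 0)
    (ae_of_all _ fun t => (Real.exp_pos _).le), integral_exp_mul_Ioi (by linarith)]
  simp

end CausalKernel

section CompletelyPositive

variable {b r : ℝ → ℝ} {k lam : ℝ}

theorem CompletelyPositive.exists_resolvent (hm : CompletelyPositive b) (hb : IsCausalKernel b)
    (hk : 0 < k) : ∃ r, IsVolterraSolution k b b r := by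
  obtain ⟨r, hr, heq, hr0⟩ := hm.exists_r k hk
  obtain ⟨r', hr'c, hr'⟩ := hr.exists_isCausalKernel hr0
  refine ⟨r', hb.isVolterraSolution hr'c hm.locInt (hr.congr_ae hr') ?_⟩
  filter_upwards [heq, hr', ae_restrict_mem measurableSet_Ioi] with t ht hrt htpos
  rw [conv_congr_ae ae_eq_rfl hr' (le_of_lt htpos), hrt, ht]

theorem CompletelyPositive.llaplaceOn_ne_top (hm : CompletelyPositive b) (hb : IsCausalKernel b)
    (hlam : 0 < lam) : llaplaceOn lam (Ioi 0) (‖b ·‖ₑ) ≠ ∞ := by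
  obtain ⟨s, hs, heq, hs0⟩ := hm.exists_s 1 one_pos
  obtain ⟨s', hs'c, hs'⟩ := hs.exists_isCausalKernel hs0
  have hsol : IsVolterraSolution 1 b (fun _ => 1) s' := by
    refine hb.isVolterraSolution hs'c hm.locInt (hs.congr_ae hs') ?_
    filter_upwards [heq, hs', ae_restrict_mem measurableSet_Ioi] with t ht hst htpos
    rw [conv_congr_ae ae_eq_rfl hs' (le_of_lt htpos), hst, ht]
  have h := hsol.llaplaceOn_eq zero_le_one hb lam
  simp only [enorm_one] at h
  rw [llaplaceOn_one hlam, ENNReal.ofReal_one, one_mul] at h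
  intro htop
  rw [htop] at h
  by_cases h0 : llaplaceOn lam (Ioi 0) (‖s' ·‖ₑ) = 0
  · rw [h0, zero_mul, add_zero, eq_comm, ENNReal.ofReal_eq_zero] at h
    exact h.not_gt (by positivity)
  · rw [ENNReal.mul_top h0, add_top] at h
    exact ENNReal.ofReal_ne_top h.symm

theorem CompletelyPositive.llaplaceOn_ne_zero (hm : CompletelyPositive b) (hb : IsCausalKernel b)
    (lam : ℝ) : llaplaceOn lam (Ioi 0) (‖b ·‖ₑ) ≠ 0 := by
  have hbm := hb.measurable
  intro h
  rw [llaplaceOn, lintegral_eq_zero_iff (by fun_prop)] at h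
  refine hm.ne_zero ?_
  filter_upwards [h] with t ht
  simpa [(Real.exp_pos _).not_ge] using ht

theorem CompletelyPositive.laplace_pos (hm : CompletelyPositive b) (hb : IsCausalKernel b)
    (hlam : 0 < lam) : 0 < laplace b lam := by
  rw [laplace_eq_toReal_llaplaceOn hb.measurable hb.nonneg]
  exact ENNReal.toReal_pos (hm.llaplaceOn_ne_zero hb lam) (hm.llaplaceOn_ne_top hb hlam)

theorem CompletelyPositive.llaplaceOn_resolvent (hm : CompletelyPositive b)
    (hb : IsCausalKernel b) (hk : 0 ≤ k) (hr : IsVolterraSolution k b b r) (hlam : 0 < lam) :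
    llaplaceOn lam (Ioi 0) (‖r ·‖ₑ) = ENNReal.ofReal (laplace b lam / (1 + k * laplace b lam)) := by
  have h := hr.llaplaceOn_eq hk hb lam
  have hbtop := hm.llaplaceOn_ne_top hb hlam
  have hrtop : llaplaceOn lam (Ioi 0) (‖r ·‖ₑ) ≠ ∞ := by
    refine ne_top_of_le_ne_top hbtop ?_
    rw [← h]
    exact le_self_add
  have hpos := hm.laplace_pos hb hlam
  rw [← ENNReal.ofReal_toReal hrtop]
  congr 1
  have hreal := congrArg ENNReal.toReal h
  rw [ENNReal.toReal_add hrtop (ENNReal.mul_ne_top ENNReal.ofReal_ne_top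
    (ENNReal.mul_ne_top hrtop hbtop)), ENNReal.toReal_mul, ENNReal.toReal_mul,
    ENNReal.toReal_ofReal hk, ← laplace_eq_toReal_llaplaceOn hb.measurable hb.nonneg] at hreal
  rw [eq_div_iff (by positivity)]
  linarith

theorem tendsto_exp_neg_inv_mul_enorm (r : ℝ → ℝ) (t : ℝ) :
    Tendsto (fun n : ℕ => ENNReal.ofReal (Real.exp (-(1 / (n + 1 : ℝ)) * t)) * ‖r t‖ₑ) atTop
      (𝓝 ‖r t‖ₑ) := by
  have hexp : Tendsto (fun n : ℕ => Real.exp (-(1 / (n + 1 : ℝ)) * t)) atTop (𝓝 1) := by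
    simpa using ((tendsto_one_div_add_atTop_nhds_zero_nat (𝕜 := ℝ)).neg.mul_const t).rexp
  simpa using ENNReal.Tendsto.mul_const (b := ‖r t‖ₑ) (ENNReal.tendsto_ofReal hexp)
    (Or.inr enorm_ne_top)

/-- Fatou's lemma as `lam ↓ 0` in the Laplace transform of the resolvent kernel. -/
theorem CompletelyPositive.lintegral_resolvent_le (hm : CompletelyPositive b)
    (hb : IsCausalKernel b) (hk : 0 < k) (hr : IsVolterraSolution k b b r) :
    ∫⁻ t in Ioi 0, ‖r t‖ₑ ≤ ENNReal.ofReal (1 / k) := by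
  have hrm := hr.measurable
  calc ∫⁻ t in Ioi 0, ‖r t‖ₑ
      ≤ liminf (fun n : ℕ => llaplaceOn (1 / (n + 1 : ℝ)) (Ioi 0) (‖r ·‖ₑ)) atTop := by
        refine le_trans (le_of_eq ?_) (lintegral_liminf_le fun n => by fun_prop)
        exact lintegral_congr fun t => (tendsto_exp_neg_inv_mul_enorm r t).liminf_eq.symm
    _ ≤ ENNReal.ofReal (1 / k) := by
        refine liminf_le_of_frequently_le' (Frequently.of_forall fun n => ?_)
        have hn : (0 : ℝ) < 1 / (n + 1 : ℝ) := by positivity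
        have hpos := hm.laplace_pos hb hn
        rw [hm.llaplaceOn_resolvent hb hk.le hr hn]
        refine ENNReal.ofReal_le_ofReal ?_
        rw [div_le_div_iff₀ (by positivity) hk]
        linarith

theorem CompletelyPositive.integrable_resolvent (hm : CompletelyPositive b)
    (hb : IsCausalKernel b) (hk : 0 < k) (hr : IsVolterraSolution k b b r) : Integrable r := by
  rw [← integrableOn_iff_integrable_of_support_subset (show Function.support r ⊆ Ioi 0 from
    fun t ht => not_le.1 fun h => ht (hr.eq_zero t h))]
  exact ⟨hr.measurable.aestronglyMeasurable,
    (hm.lintegral_resolvent_le hb hk hr).trans_lt ENNReal.ofReal_lt_top⟩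

theorem IsVolterraSolution.ae_le {y x : ℝ → ℝ} (hk : 0 ≤ k) (hb : IsCausalKernel b)
    (h : IsVolterraSolution k b y x) : ∀ᵐ t ∂volume.restrict (Ioi (0 : ℝ)), x t ≤ y t := by
  filter_upwards [h.ae_eq] with t ⟨_, heq⟩
  have hconv : 0 ≤ k * ∫ σ, b (t - σ) * x σ :=
    mul_nonneg hk (integral_nonneg fun σ => mul_nonneg (hb.nonneg _) (h.nonneg _))
  linarith

end CompletelyPositive

section Stability

variable {b b' r r' : ℝ → ℝ} {k lam T : ℝ}

theorem IsVolterraSolution.enorm_sub_le (hk : 0 ≤ k) (hb : IsCausalKernel b)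
    (hb' : IsCausalKernel b') (hr : IsVolterraSolution k b b r)
    (hr' : IsVolterraSolution k b' b' r') :
    ∀ᵐ t ∂volume.restrict (Ioi (0 : ℝ)), ‖r' t - r t‖ₑ ≤
      (‖b' t - b t‖ₑ + ENNReal.ofReal k * ((‖r' ·‖ₑ) ⋆ₗ fun t => ‖b' t - b t‖ₑ) t)
      + ENNReal.ofReal k * ((fun t => ‖r' t - r t‖ₑ) ⋆ₗ (‖b ·‖ₑ)) t := by
  have hbm := hb.measurable
  have hbm' := hb'.measurable
  have hrm' := hr'.measurable
  filter_upwards [hr.ae_eq, hr'.ae_eq] with t ⟨hinteg, heq⟩ ⟨hinteg', heq'⟩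
  have hsub : r' t - r t
      = (b' t - b t) - k * ∫ σ, (b' (t - σ) * r' σ - b (t - σ) * r σ) := by
    rw [integral_sub hinteg' hinteg]
    linarith
  have hconv : ‖∫ σ, (b' (t - σ) * r' σ - b (t - σ) * r σ)‖ₑ
      ≤ ((‖r' ·‖ₑ) ⋆ₗ fun t => ‖b' t - b t‖ₑ) t
        + ((fun t => ‖r' t - r t‖ₑ) ⋆ₗ (‖b ·‖ₑ)) t := by
    refine (enorm_integral_le_lintegral_enorm _).trans ?_
    rw [lconvolution_def, lconvolution_def, ← lintegral_add_left (by fun_prop)]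
    refine lintegral_mono fun σ => ?_
    rw [← enorm_mul, ← enorm_mul, ← sub_eq_neg_add]
    refine le_of_eq_of_le (congrArg _ ?_) (enorm_add_le _ _)
    ring
  calc ‖r' t - r t‖ₑ ≤ ‖b' t - b t‖ₑ
        + ‖k * ∫ σ, (b' (t - σ) * r' σ - b (t - σ) * r σ)‖ₑ := by
        rw [hsub]
        exact _root_.enorm_sub_le
    _ ≤ ‖b' t - b t‖ₑ + ENNReal.ofReal k * (((‖r' ·‖ₑ) ⋆ₗ fun t => ‖b' t - b t‖ₑ) t
        + ((fun t => ‖r' t - r t‖ₑ) ⋆ₗ (‖b ·‖ₑ)) t) := by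
        rw [enorm_mul, Real.enorm_of_nonneg hk]
        gcongr
    _ = _ := by rw [mul_add, add_assoc]

theorem IsVolterraSolution.llaplaceOn_forcing_le (hm' : CompletelyPositive b')
    (hb : IsCausalKernel b) (hb' : IsCausalKernel b') (hk : 0 < k)
    (hr' : IsVolterraSolution k b' b' r') (hlam : 0 ≤ lam) :
    llaplaceOn lam (Ioo 0 T) (fun t => ‖b' t - b t‖ₑ + ENNReal.ofReal k *
      ((‖r' ·‖ₑ) ⋆ₗ fun t => ‖b' t - b t‖ₑ) t) ≤ 2 * ∫⁻ t in Ioo 0 T, ‖b' t - b t‖ₑ := by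
  have hbm := hb.measurable
  have hbm' := hb'.measurable
  have hrm' := hr'.measurable
  have hmass : ENNReal.ofReal k * llaplaceOn lam (Ioo 0 T) (‖r' ·‖ₑ) ≤ 1 := by
    calc ENNReal.ofReal k * llaplaceOn lam (Ioo 0 T) (‖r' ·‖ₑ)
        ≤ ENNReal.ofReal k * ∫⁻ t in Ioi 0, ‖r' t‖ₑ := by
          gcongr
          exact (llaplaceOn_Ioo_le_lintegral hlam).trans (lintegral_mono_set Ioo_subset_Ioi_self)
      _ ≤ ENNReal.ofReal k * ENNReal.ofReal (1 / k) := by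
          gcongr
          exact hm'.lintegral_resolvent_le hb' hk hr'
      _ = 1 := by rw [← ENNReal.ofReal_mul hk.le, mul_one_div_cancel hk.ne', ENNReal.ofReal_one]
  rw [llaplaceOn_add (by fun_prop), llaplaceOn_const_mul (by fun_prop), two_mul]
  refine add_le_add (llaplaceOn_Ioo_le_lintegral hlam) ?_
  calc ENNReal.ofReal k * llaplaceOn lam (Ioo 0 T) ((‖r' ·‖ₑ) ⋆ₗ fun t => ‖b' t - b t‖ₑ)
      ≤ ENNReal.ofReal k * (llaplaceOn lam (Ioo 0 T) (‖r' ·‖ₑ)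
        * llaplaceOn lam (Ioo 0 T) fun t => ‖b' t - b t‖ₑ) := by
        gcongr
        exact llaplaceOn_Ioo_lconvolution_le (by fun_prop) (by fun_prop) hr'.enorm_eq_zero
          fun t ht => by simp [hb.eq_zero t ht, hb'.eq_zero t ht]
    _ ≤ 1 * llaplaceOn lam (Ioo 0 T) fun t => ‖b' t - b t‖ₑ := by
        rw [← mul_assoc]
        gcongr
    _ ≤ ∫⁻ t in Ioo 0 T, ‖b' t - b t‖ₑ := by
        rw [one_mul]
        exact llaplaceOn_Ioo_le_lintegral hlam

theorem IsVolterraSolution.lintegral_enorm_sub_le (hm : CompletelyPositive b)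
    (hm' : CompletelyPositive b') (hb : IsCausalKernel b) (hb' : IsCausalKernel b') (hk : 0 < k)
    (hr : IsVolterraSolution k b b r) (hr' : IsVolterraSolution k b' b' r') (hlam : 0 ≤ lam)
    (hsmall : ENNReal.ofReal k * llaplaceOn lam (Ioo 0 T) (‖b ·‖ₑ) ≤ 2⁻¹) :
    ∫⁻ t in Ioo 0 T, ‖r' t - r t‖ₑ
      ≤ ENNReal.ofReal (4 * Real.exp (lam * T)) * ∫⁻ t in Ioo 0 T, ‖b' t - b t‖ₑ := by
  have hbm := hb.measurable
  have hbm' := hb'.measurable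
  have hrm := hr.measurable
  have hrm' := hr'.measurable
  have hfin : llaplaceOn lam (Ioo 0 T) (fun t => ‖r' t - r t‖ₑ) ≠ ∞ :=
    ((llaplaceOn_Ioo_le_lintegral hlam).trans_lt (((hm'.integrable_resolvent hb' hk hr').sub
      (hm.integrable_resolvent hb hk hr)).integrableOn (s := Ioo 0 T)).2).ne
  have habsorb := llaplaceOn_le_two_mul_of_le_add_lconvolution (by fun_prop) (by fun_prop)
    (by fun_prop) (fun t ht => by simp [hr.eq_zero t ht, hr'.eq_zero t ht]) hb.enorm_eq_zero hfin
    hsmall (ae_restrict_of_ae_restrict_of_subset Ioo_subset_Ioi_self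
      (hr.enorm_sub_le hk.le hb hb' hr'))
  calc ∫⁻ t in Ioo 0 T, ‖r' t - r t‖ₑ
      ≤ ENNReal.ofReal (Real.exp (lam * T))
        * llaplaceOn lam (Ioo 0 T) (fun t => ‖r' t - r t‖ₑ) :=
        lintegral_Ioo_le_llaplaceOn hlam (by fun_prop)
    _ ≤ ENNReal.ofReal (Real.exp (lam * T)) * (2 * (2 * ∫⁻ t in Ioo 0 T, ‖b' t - b t‖ₑ)) := by
        gcongr
        refine habsorb.trans ?_
        gcongr
        exact hr'.llaplaceOn_forcing_le hm' hb hb' hk hlam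
    _ = _ := by
        rw [ENNReal.ofReal_mul (by norm_num), show ENNReal.ofReal 4 = 2 * 2 by norm_num]
        ring

theorem CompletelyPositive.exists_abs_integral_resolvent_sub_le (hm : CompletelyPositive b)
    (hb : IsCausalKernel b) (hk : 0 < k) (hr : IsVolterraSolution k b b r) (T : ℝ) :
    ∃ C : ℝ, 0 ≤ C ∧ ∀ b' r' : ℝ → ℝ, CompletelyPositive b' → IsCausalKernel b' →
      IsVolterraSolution k b' b' r' → ∀ t ≤ T,
      |(∫ σ in Ioc 0 t, r' σ) - ∫ σ in Ioc 0 t, r σ| ≤ C * ∫ σ in Ioo 0 T, |b' σ - b σ| := by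
  have hbm := hb.measurable
  have hk0 : ENNReal.ofReal k ≠ 0 := by simpa using hk
  obtain ⟨lam, hlam, hle⟩ := exists_llaplaceOn_Ioo_le (by fun_prop)
    (hm.locInt.lintegral_enorm_Ioo_ne_top T) (ε := (ENNReal.ofReal k)⁻¹ * 2⁻¹) (by simp)
  have hsmall : ENNReal.ofReal k * llaplaceOn lam (Ioo 0 T) (‖b ·‖ₑ) ≤ 2⁻¹ := by
    calc _ ≤ ENNReal.ofReal k * ((ENNReal.ofReal k)⁻¹ * 2⁻¹) := by gcongr
      _ = 2⁻¹ := by rw [← mul_assoc, ENNReal.mul_inv_cancel hk0 ENNReal.ofReal_ne_top, one_mul]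
  refine ⟨4 * Real.exp (lam * T), by positivity, fun b' r' hm' hb' hr' t htT => ?_⟩
  have hri := hm.integrable_resolvent hb hk hr
  have hri' := hm'.integrable_resolvent hb' hk hr'
  have hrm := hr.measurable
  have hrm' := hr'.measurable
  have hbi : IntegrableOn (fun t => b' t - b t) (Ioo 0 T) :=
    ((hm'.locInt T).sub (hm.locInt T)).mono_set Ioo_subset_Ioc_self
  calc |(∫ σ in Ioc 0 t, r' σ) - ∫ σ in Ioc 0 t, r σ|
      = ‖∫ σ in Ioc 0 t, (r' σ - r σ)‖ := by
        rw [integral_sub hri'.integrableOn hri.integrableOn, Real.norm_eq_abs]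
    _ ≤ ∫ σ in Ioc 0 t, ‖r' σ - r σ‖ := norm_integral_le_integral_norm _
    _ ≤ ∫ σ in Ioc 0 T, ‖r' σ - r σ‖ :=
        setIntegral_mono_set (hri'.sub hri).norm.integrableOn (ae_of_all _ fun _ => norm_nonneg _)
          (Ioc_subset_Ioc_right htT).eventuallyLE
    _ = (∫⁻ t in Ioo 0 T, ‖r' t - r t‖ₑ).toReal := by
        rw [integral_Ioc_eq_integral_Ioo, integral_norm_eq_lintegral_enorm (by fun_prop)]
    _ ≤ (ENNReal.ofReal (4 * Real.exp (lam * T)) * ∫⁻ t in Ioo 0 T, ‖b' t - b t‖ₑ).toReal :=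
        ENNReal.toReal_mono (ENNReal.mul_ne_top ENNReal.ofReal_ne_top hbi.2.ne)
          (hr.lintegral_enorm_sub_le hm hm' hb hb' hk hr' hlam hsmall)
    _ = 4 * Real.exp (lam * T) * ∫ σ in Ioo 0 T, |b' σ - b σ| := by
        rw [ENNReal.toReal_mul, ENNReal.toReal_ofReal (by positivity),
          ← integral_norm_eq_lintegral_enorm hbi.1]
        rfl

end Stability

section Subordinator

open scoped unitInterval

variable {lam τ : ℝ} {b m : ℝ → ℝ}

theorem continuous_coe_rpow (hlam : 0 < lam) : Continuous fun x : I => (x : ℝ) ^ lam :=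
  continuous_subtype_val.rpow_const fun _ => Or.inr hlam.le

theorem lmoment_mconv (lam : ℝ) (P Q : Measure I) [SFinite Q] :
    lmoment lam (P.mconv Q) = lmoment lam P * lmoment lam Q := by
  have hpow : Measurable fun x : I => ENNReal.ofReal ((x : ℝ) ^ lam) := by fun_prop
  have hmul : ∀ x y : I, ENNReal.ofReal (((x * y : I) : ℝ) ^ lam)
      = ENNReal.ofReal ((x : ℝ) ^ lam) * ENNReal.ofReal ((y : ℝ) ^ lam) := fun x y => by
    rw [Set.Icc.coe_mul, Real.mul_rpow x.2.1 y.2.1, ENNReal.ofReal_mul (Real.rpow_nonneg x.2.1 _)]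
  rw [lmoment, Measure.lintegral_mconv hpow]
  simp only [hmul, lintegral_const_mul _ hpow]
  exact lintegral_mul_const _ hpow

/-- Convolution powers for the multiplication of the unit interval: the law of a product of
independent variables with law `P`. -/
def mconvPow (P : Measure I) : ℕ → Measure I
  | 0 => Measure.dirac 1
  | n + 1 => (mconvPow P n).mconv P

theorem isProbabilityMeasure_mconvPow (P : Measure I) [IsProbabilityMeasure P] (n : ℕ) :
    IsProbabilityMeasure (mconvPow P n) := by
  induction n with
  | zero => exact Measure.dirac.isProbabilityMeasure
  | succ n _ => exact Measure.probabilitymeasure_of_probabilitymeasures_mconv _ _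

theorem lmoment_mconvPow (lam : ℝ) (P : Measure I) [SFinite P] (n : ℕ) :
    lmoment lam (mconvPow P n) = lmoment lam P ^ n := by
  induction n with
  | zero =>
    rw [lmoment, mconvPow, lintegral_dirac' _ (by fun_prop), Set.Icc.coe_one, Real.one_rpow,
      ENNReal.ofReal_one, pow_zero]
  | succ n ih => rw [mconvPow, lmoment_mconv, ih, pow_succ]

/-- `Q` is a weak cluster point of `P`, since the probability measures on the compact space `I` are
weakly compact. -/
theorem exists_measure_of_tendsto_moments {P : ℕ → Measure I}
    (hP : ∀ n, IsProbabilityMeasure (P n)) {ℓ : ℝ → ℝ}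
    (h : ∀ lam : ℝ, 0 < lam → Tendsto (fun n => ∫ x : I, (x : ℝ) ^ lam ∂(P n)) atTop (𝓝 (ℓ lam))) :
    ∃ Q : Measure I, IsProbabilityMeasure Q ∧
      ∀ lam : ℝ, 0 < lam → ∫ x : I, (x : ℝ) ^ lam ∂Q = ℓ lam := by
  let p : ℕ → ProbabilityMeasure I := fun n => ⟨P n, hP n⟩
  let u : Ultrafilter ℕ := hyperfilter ℕ
  obtain ⟨Q, -, hQ⟩ := isCompact_univ.ultrafilter_le_nhds (u.map p) (by simp)
  have hlim : Tendsto p u (𝓝 Q) := hQ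
  refine ⟨Q, Q.2, fun lam hlam => ?_⟩
  exact tendsto_nhds_unique (ProbabilityMeasure.tendsto_iff_forall_integral_tendsto.1 hlim
    (BoundedContinuousFunction.mkOfCompact ⟨_, continuous_coe_rpow hlam⟩))
    ((h lam hlam).mono_left Nat.hyperfilter_le_atTop)

/-- The missing mass is put at `0 = e^{-∞}`, where it does not contribute to the moments. -/
theorem exists_measure_lmoment_eq_llaplaceOn {A : ℝ → ℝ≥0∞} (hA : Measurable A)
    (hmass : ∫⁻ t in Ioi 0, A t ≤ 1) :
    ∃ P : Measure I, IsProbabilityMeasure P ∧ ∀ lam : ℝ, 0 < lam →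
      lmoment lam P = llaplaceOn lam (Ioi 0) A := by
  let κ : Measure ℝ := (volume.restrict (Ioi 0)).withDensity A
  have hκ : κ univ ≤ 1 := by
    rwa [withDensity_apply _ MeasurableSet.univ, Measure.restrict_univ]
  refine ⟨κ.map expNeg + (1 - κ univ) • Measure.dirac 0, ⟨?_⟩, fun lam hlam => ?_⟩
  · rw [Measure.add_apply, Measure.map_apply measurable_expNeg MeasurableSet.univ, preimage_univ,
      Measure.smul_apply, measure_univ (μ := Measure.dirac (0 : I)), smul_eq_mul, mul_one]
    exact add_tsub_cancel_of_le hκ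
  · rw [← lmoment_map_expNeg lam hA, lmoment, lintegral_add_measure, lintegral_smul_measure,
      lintegral_dirac' _ (by fun_prop), Set.Icc.coe_zero, Real.zero_rpow hlam.ne',
      ENNReal.ofReal_zero, smul_zero, add_zero, lmoment]

/-- `k r_k` is the density of a (possibly defective) random time whose Laplace transform is
`k b̂ / (1 + k b̂)`. -/
theorem CompletelyPositive.exists_measure_lmoment_eq (hm : CompletelyPositive b)
    (hb : IsCausalKernel b) {k : ℝ} (hk : 0 < k) :
    ∃ P : Measure I, IsProbabilityMeasure P ∧ ∀ lam : ℝ, 0 < lam →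
      lmoment lam P = ENNReal.ofReal (1 + 1 / laplace b lam / k)⁻¹ := by
  obtain ⟨r, hr⟩ := hm.exists_resolvent hb hk
  have hrm := hr.measurable
  obtain ⟨P, hP, hmoment⟩ := exists_measure_lmoment_eq_llaplaceOn
    (A := fun t => ENNReal.ofReal k * ‖r t‖ₑ) (by fun_prop) (by
      rw [lintegral_const_mul _ (by fun_prop)]
      calc ENNReal.ofReal k * ∫⁻ t in Ioi 0, ‖r t‖ₑ
          ≤ ENNReal.ofReal k * ENNReal.ofReal (1 / k) := by
            gcongr
            exact hm.lintegral_resolvent_le hb hk hr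
        _ = 1 := by rw [← ENNReal.ofReal_mul hk.le, mul_one_div_cancel hk.ne', ENNReal.ofReal_one])
  refine ⟨P, hP, fun lam hlam => ?_⟩
  have hpos := hm.laplace_pos hb hlam
  rw [hmoment lam hlam, llaplaceOn_const_mul (by fun_prop),
    hm.llaplaceOn_resolvent hb hk.le hr hlam, ← ENNReal.ofReal_mul hk.le]
  congr 1
  field_simp
  ring

/-- The laws `η τ` of `e^{-X_τ}`, where `X` is a subordinator with Laplace exponent `Φ`. Passing
from the half-line to the unit interval turns sums of independent variables into products and
Laplace transforms into moments. -/
structure IsSubordinator (Φ : ℝ → ℝ) (η : ℝ → Measure I) : Prop where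
  prob : ∀ τ, IsProbabilityMeasure (η τ)
  moment : ∀ τ, 0 ≤ τ → ∀ lam : ℝ, 0 < lam → ∫ x : I, (x : ℝ) ^ lam ∂(η τ) = Real.exp (-τ * Φ lam)

/-- The `n`-fold products of independent variables with moments `(1 + τ Φ / n)⁻¹` converge in law,
since `(1 + τ Φ / n)^{-n} → e^{-τ Φ}`. -/
theorem CompletelyPositive.exists_measure_moment_eq_exp (hm : CompletelyPositive b)
    (hb : IsCausalKernel b) (hτ : 0 < τ) :
    ∃ Q : Measure I, IsProbabilityMeasure Q ∧ ∀ lam : ℝ, 0 < lam →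
      ∫ x : I, (x : ℝ) ^ lam ∂Q = Real.exp (-τ * (1 / laplace b lam)) := by
  have hstep : ∀ n : ℕ, ∃ P : Measure I, IsProbabilityMeasure P ∧ ∀ lam : ℝ, 0 < lam →
      lmoment lam P = ENNReal.ofReal (1 + 1 / laplace b lam / ((n + 1 : ℕ) / τ))⁻¹ := fun n =>
    hm.exists_measure_lmoment_eq hb (by positivity)
  choose P hP hmoment using hstep
  refine exists_measure_of_tendsto_moments (P := fun n => mconvPow (P n) (n + 1))
    (fun n => isProbabilityMeasure_mconvPow _ _) fun lam hlam => ?_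
  have hpos := hm.laplace_pos hb hlam
  have hlim := ((Real.tendsto_one_add_div_pow_exp (τ * (1 / laplace b lam))).inv₀
    (Real.exp_pos _).ne').comp (tendsto_add_atTop_nat 1)
  rw [← Real.exp_neg, ← neg_mul] at hlim
  refine hlim.congr fun n => ?_
  rw [integral_rpow_eq_toReal_lmoment, lmoment_mconvPow, hmoment n lam hlam,
    ← ENNReal.ofReal_pow (by positivity), ENNReal.toReal_ofReal (by positivity), inv_pow,
    div_div_eq_mul_div, mul_comm (1 / _) τ, Function.comp_apply]

theorem CompletelyPositive.exists_isSubordinator (hm : CompletelyPositive m) :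
    ∃ η, IsSubordinator (fun lam => 1 / laplace m lam) η := by
  obtain ⟨b, hb, hbcp, hbm⟩ := hm.exists_isCausalKernel
  have hlaw : ∀ τ : ℝ, ∃ Q : Measure I, IsProbabilityMeasure Q ∧ (0 ≤ τ → ∀ lam : ℝ, 0 < lam →
      ∫ x : I, (x : ℝ) ^ lam ∂Q = Real.exp (-τ * (1 / laplace m lam))) := fun τ => by
    rcases lt_or_ge 0 τ with hτ | hτ
    · obtain ⟨Q, hQ, hmoment⟩ := hbcp.exists_measure_moment_eq_exp hb hτ
      exact ⟨Q, hQ, fun _ lam hlam => by rw [hmoment lam hlam, laplace_congr_ae hbm]⟩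
    · refine ⟨Measure.dirac 1, Measure.dirac.isProbabilityMeasure, fun hτ' lam _ => ?_⟩
      rw [integral_dirac, le_antisymm hτ hτ', Set.Icc.coe_one, Real.one_rpow, neg_zero, zero_mul,
        Real.exp_zero]
  choose η hη hmoment using hlaw
  exact ⟨η, hη, hmoment⟩

end Subordinator

section Propagation

open scoped unitInterval

variable {Φ : ℝ → ℝ} {η : ℝ → Measure I} {m : ℝ → ℝ} {lam t ρ τ : ℝ}

theorem tendsto_of_tendsto_moments {ι : Type*} {l : Filter ι} {P : ι → ProbabilityMeasure I}
    {Q : ProbabilityMeasure I}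
    (h : ∀ n : ℕ, Tendsto (fun i => ∫ x : I, (x : ℝ) ^ n ∂(P i)) l (𝓝 (∫ x : I, (x : ℝ) ^ n ∂Q))) :
    Tendsto P l (𝓝 Q) := by
  refine tendsto_nhds_of_unique_mapClusterPt fun Q' hQ' => Subtype.ext ?_
  have := Q.2
  have := Q'.2
  refine ext_of_moments fun n => ?_
  have hcont : ContinuousAt (fun P : ProbabilityMeasure I => ∫ x : I, (x : ℝ) ^ n ∂P) Q' :=
    ProbabilityMeasure.tendsto_iff_forall_integral_tendsto.1 tendsto_id
      (BoundedContinuousFunction.mkOfCompact ⟨fun x : I => (x : ℝ) ^ n, by fun_prop⟩)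
  have hcluster : MapClusterPt (∫ x : I, (x : ℝ) ^ n ∂Q') l fun i => ∫ x : I, (x : ℝ) ^ n ∂(P i) :=
    hQ'.continuousAt_comp hcont
  exact eq_of_nhds_neBot (ClusterPt.mono hcluster (h n))

theorem boundedVariationOn_of_monotoneOn {f : ℝ → ℝ} {s : Set ℝ} (hf : MonotoneOn f s) {a b : ℝ}
    (hs : MapsTo f s (Icc a b)) : BoundedVariationOn f s := by
  have hvar : eVariationOn f s ≤ ENNReal.ofReal (b - a) := by
    calc eVariationOn f s = eVariationOn id (f '' s) := eVariationOn.comp_eq_of_monotoneOn id f hf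
      _ ≤ eVariationOn id (univ ∩ Icc a b) :=
        eVariationOn.mono _ (by rwa [univ_inter, image_subset_iff])
      _ ≤ ENNReal.ofReal (b - a) :=
        ((monotone_id.monotoneOn univ).eVariationOn_eq (mem_univ a) (mem_univ b)).le
  exact ne_top_of_le_ne_top ENNReal.ofReal_ne_top hvar

theorem exists_measure_Ioi_eq_ofReal {F : ℝ → ℝ} (hanti : AntitoneOn F (Ici 0)) (hF : F 0 ≤ 1)
    (hcont : ∀ τ, 0 ≤ τ → ContinuousWithinAt F (Ici τ) τ) (hlim : Tendsto F atTop (𝓝 0)) :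
    ∃ ν : Measure ℝ, ν univ = 1 ∧ ν (Iio 0) = 0 ∧
      ∀ τ, 0 ≤ τ → ν (Ioi τ) = ENNReal.ofReal (F τ) := by
  let G : ℝ → ℝ := fun τ => if τ < 0 then 0 else 1 - F τ
  have hneg : ∀ {τ}, τ < 0 → G τ = 0 := fun hτ => if_pos hτ
  have hnonneg : ∀ {τ}, 0 ≤ τ → G τ = 1 - F τ := fun hτ => if_neg (not_lt.2 hτ)
  have hmono : Monotone G := fun ρ τ hρτ => by
    rcases lt_or_ge ρ 0 with hρ | hρ
    · rcases lt_or_ge τ 0 with hτ | hτ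
      · rw [hneg hρ, hneg hτ]
      · rw [hneg hρ, hnonneg hτ]
        linarith [hanti self_mem_Ici hτ hτ]
    · rw [hnonneg hρ, hnonneg (hρ.trans hρτ)]
      linarith [hanti hρ (hρ.trans hρτ) hρτ]
  have hright : ∀ τ, ContinuousWithinAt G (Ici τ) τ := fun τ => by
    rcases lt_or_ge τ 0 with hτ | hτ
    · refine ((continuousAt_const (y := (0 : ℝ))).congr ?_).continuousWithinAt
      filter_upwards [Iio_mem_nhds hτ] with ρ hρ using (hneg hρ).symm
    · exact (continuousWithinAt_const.sub (hcont τ hτ)).congr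
        (fun ρ hρ => hnonneg (hτ.trans hρ)) (hnonneg hτ)
  let S : StieltjesFunction ℝ := ⟨G, hmono, hright⟩
  have hbot : Tendsto S atBot (𝓝 0) := by
    refine tendsto_const_nhds.congr' ?_
    filter_upwards [eventually_lt_atBot 0] with τ hτ using (hneg hτ).symm
  have htop : Tendsto S atTop (𝓝 1) := by
    refine (sub_zero (1 : ℝ) ▸ hlim.const_sub 1).congr' ?_
    filter_upwards [eventually_ge_atTop 0] with τ hτ using (hnonneg hτ).symm
  have hleft : Function.leftLim S 0 = 0 := by
    refine leftLim_eq_of_tendsto (tendsto_const_nhds.congr' ?_)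
    filter_upwards [self_mem_nhdsWithin] with τ hτ using (hneg hτ).symm
  refine ⟨S.measure, ?_, ?_, fun τ hτ => ?_⟩
  · rw [S.measure_univ hbot htop, sub_zero, ENNReal.ofReal_one]
  · rw [S.measure_Iio hbot, hleft, sub_zero, ENNReal.ofReal_zero]
  · rw [S.measure_Ioi htop, show S τ = 1 - F τ from hnonneg hτ, sub_sub_cancel]

/-- The propagation function `w(t, τ) = P(X_τ < t)`, where `η τ` is the law of `e^{-X_τ}`. -/
def propFun (η : ℝ → Measure I) (t τ : ℝ) : ℝ := (η τ).real {x : I | Real.exp (-t) < x}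

theorem measurableSet_exp_lt (t : ℝ) : MeasurableSet {x : I | Real.exp (-t) < x} :=
  measurableSet_lt measurable_const measurable_subtype_coe

theorem propFun_zero (η : ℝ → Measure I) (τ : ℝ) : propFun η 0 τ = 0 := by
  have hempty : {x : I | Real.exp (-0) < x} = ∅ :=
    eq_empty_of_forall_notMem fun x hx => absurd x.2.2 (by simpa using hx)
  rw [propFun, hempty, measureReal_empty]

theorem propFun_eq_integral (η : ℝ → Measure I) (t τ : ℝ) :
    propFun η t τ = ∫ x, {x : I | Real.exp (-t) < x}.indicator (fun _ => (1 : ℝ)) x ∂(η τ) := by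
  rw [integral_indicator_const _ (measurableSet_exp_lt t), smul_eq_mul, mul_one, propFun]

theorem integral_exp_mul_indicator (hlam : 0 < lam) (x : I) :
    ∫ t in Ioi (0 : ℝ), Real.exp (-lam * t) *
      {x : I | Real.exp (-t) < x}.indicator (fun _ => (1 : ℝ)) x = (x : ℝ) ^ lam / lam := by
  rcases x.2.1.eq_or_lt with hx | hx
  · have hzero : ∀ t, {x : I | Real.exp (-t) < x}.indicator (fun _ => (1 : ℝ)) x = 0 := fun t =>
      indicator_of_notMem (by simp [← hx, Real.exp_nonneg]) _
    simp [hzero, ← hx, Real.zero_rpow hlam.ne']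
  · have hiff : ∀ t, x ∈ {x : I | Real.exp (-t) < x} ↔ t ∈ Ioi (-Real.log x) := fun t => by
      rw [mem_ofPred_eq, ← Real.lt_log_iff_exp_lt hx, mem_Ioi, neg_lt]
    have hind : ∀ t, Real.exp (-lam * t) *
        {x : I | Real.exp (-t) < x}.indicator (fun _ => (1 : ℝ)) x
        = (Ioi (-Real.log x)).indicator (fun t => Real.exp (-lam * t)) t := fun t => by
      simp only [indicator_apply, hiff, mul_ite, mul_one, mul_zero]
    have hlog : 0 ≤ -Real.log x := neg_nonneg.2 (Real.log_nonpos x.2.1 x.2.2)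
    simp only [hind]
    rw [setIntegral_indicator measurableSet_Ioi, Ioi_inter_Ioi, sup_eq_right.2 hlog,
      integral_exp_mul_Ioi (by linarith), Real.rpow_def_of_pos hx, neg_div_neg_eq, neg_mul_neg,
      mul_comm]

namespace IsSubordinator

theorem monotone_propFun (h : IsSubordinator Φ η) (τ : ℝ) : Monotone fun t => propFun η t τ :=
  fun _ _ hst =>
    have := h.prob τ
    measureReal_mono fun _ hx => (Real.exp_le_exp.2 (neg_le_neg hst)).trans_lt hx

theorem propFun_mem_Icc (h : IsSubordinator Φ η) (t τ : ℝ) : propFun η t τ ∈ Icc (0 : ℝ) 1 :=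
  have := h.prob τ
  ⟨measureReal_nonneg, measureReal_le_one⟩

theorem leftContinuous_propFun (h : IsSubordinator Φ η) (t τ : ℝ) :
    ContinuousWithinAt (fun t => propFun η t τ) (Iic t) t := by
  have := h.prob τ
  simp only [ContinuousWithinAt, propFun_eq_integral]
  refine tendsto_integral_filter_of_dominated_convergence (fun _ => 1)
    (Eventually.of_forall fun s => (measurable_const.indicator
      (measurableSet_exp_lt s)).aestronglyMeasurable)
    (Eventually.of_forall fun s => ae_of_all _ fun x => ?_) (integrable_const _)
    (ae_of_all _ fun x => ?_)
  · exact (norm_indicator_le_norm_self _ _).trans (by simp)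
  · refine tendsto_const_nhds.congr' ?_
    by_cases hx : Real.exp (-t) < x
    · have hexp : ContinuousAt (fun s : ℝ => Real.exp (-s)) t := by fun_prop
      filter_upwards [nhdsWithin_le_nhds (hexp.eventually (gt_mem_nhds hx))] with s hs
      rw [indicator_of_mem (s := {x : I | Real.exp (-t) < x}) hx,
        indicator_of_mem (s := {x : I | Real.exp (-s) < x}) hs]
    · filter_upwards [self_mem_nhdsWithin] with s hs
      have hx' : ¬ Real.exp (-s) < x := fun h' =>
        hx ((Real.exp_le_exp.2 (neg_le_neg hs)).trans_lt h')
      rw [indicator_of_notMem (s := {x : I | Real.exp (-t) < x}) hx,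
        indicator_of_notMem (s := {x : I | Real.exp (-s) < x}) hx']

theorem laplace_propFun (h : IsSubordinator Φ η) (hτ : 0 ≤ τ) (hlam : 0 < lam) :
    laplace (fun t => propFun η t τ) lam = Real.exp (-τ * Φ lam) / lam := by
  have := h.prob τ
  have hmeas : MeasurableSet {q : ℝ × I | Real.exp (-q.1) < q.2} :=
    measurableSet_lt (by fun_prop) (measurable_subtype_coe.comp measurable_snd)
  have hdom : Integrable (fun q : ℝ × I => Real.exp (-lam * q.1))
      ((volume.restrict (Ioi 0)).prod (η τ)) := by
    simpa using (integrableOn_exp_mul_Ioi (neg_lt_zero.2 hlam) 0).mul_prod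
      (integrable_const (μ := η τ) (1 : ℝ))
  simp only [laplace, propFun_eq_integral, ← integral_const_mul]
  rw [integral_integral_swap]
  · simp only [integral_exp_mul_indicator hlam]
    rw [integral_div, h.moment τ hτ lam hlam]
  · refine (hdom.indicator hmeas).congr (ae_of_all _ fun q => ?_)
    simp only [indicator_apply, mem_ofPred_eq, Function.uncurry, mul_ite, mul_one, mul_zero]

theorem moment_natCast (h : IsSubordinator Φ η) (hτ : 0 ≤ τ) {n : ℕ} (hn : n ≠ 0) :
    ∫ x : I, (x : ℝ) ^ n ∂(η τ) = Real.exp (-τ * Φ n) := by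
  simp only [← h.moment τ hτ n (by positivity), Real.rpow_natCast]

theorem add_eq_mconv (h : IsSubordinator Φ η) (hρ : 0 ≤ ρ) (hτ : 0 ≤ τ) :
    η (τ + ρ) = (η τ).mconv (η ρ) := by
  have := h.prob τ
  have := h.prob ρ
  have := h.prob (τ + ρ)
  refine ext_of_moments fun n => ?_
  rcases eq_or_ne n 0 with rfl | hn
  · simp
  have hmconv : ∫ x : I, (x : ℝ) ^ n ∂((η τ).mconv (η ρ))
      = (∫ x : I, (x : ℝ) ^ n ∂(η τ)) * ∫ x : I, (x : ℝ) ^ n ∂(η ρ) := by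
    simp only [← Real.rpow_natCast, integral_rpow_eq_toReal_lmoment, lmoment_mconv,
      ENNReal.toReal_mul]
  rw [hmconv, h.moment_natCast hτ hn, h.moment_natCast hρ hn,
    h.moment_natCast (add_nonneg hτ hρ) hn, ← Real.exp_add]
  ring_nf

/-- The subordinator is nondecreasing: `e^{-X_τ} = e^{-X_ρ} e^{-(X_τ - X_ρ)} ≤ e^{-X_ρ}`. -/
theorem antitoneOn_propFun (h : IsSubordinator Φ η) (t : ℝ) :
    AntitoneOn (propFun η t) (Ici 0) := fun ρ hρ τ _ hρτ => by
  have := h.prob ρ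
  have := h.prob (τ - ρ)
  have hconv := h.add_eq_mconv (sub_nonneg.2 hρτ) hρ
  rw [add_sub_cancel] at hconv
  calc propFun η t τ = ((η ρ).prod (η (τ - ρ))).real
          ((fun q : I × I => q.1 * q.2) ⁻¹' {x | Real.exp (-t) < x}) := by
        rw [propFun, hconv, Measure.mconv, map_measureReal_apply measurable_mul
          (measurableSet_exp_lt t)]
    _ ≤ ((η ρ).prod (η (τ - ρ))).real ({x : I | Real.exp (-t) < x} ×ˢ univ) := by
        refine measureReal_mono fun q hq => ⟨?_, mem_univ _⟩
        rw [mem_preimage, mem_ofPred_eq, Set.Icc.coe_mul] at hq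
        exact hq.trans_le (mul_le_of_le_one_right q.1.2.1 q.2.2.2)
    _ = propFun η t ρ := by rw [measureReal_prod_prod, probReal_univ, mul_one, propFun]

/-- The laws `η τ` are weakly continuous in `τ`, so the mass of the open set `{x | e^{-t} < x}`
is lower semicontinuous; being antitone, it is right-continuous. -/
theorem rightContinuous_propFun (h : IsSubordinator Φ η) (t : ℝ) (hτ : 0 ≤ τ) :
    ContinuousWithinAt (propFun η t) (Ici τ) τ := by
  let law : ℝ → ProbabilityMeasure I := fun ρ => ⟨η ρ, h.prob ρ⟩
  have hweak : Tendsto law (𝓝[Ici τ] τ) (𝓝 (law τ)) := by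
    refine tendsto_of_tendsto_moments fun n => ?_
    change Tendsto (fun ρ => ∫ x : I, (x : ℝ) ^ n ∂(η ρ)) _ (𝓝 (∫ x : I, (x : ℝ) ^ n ∂(η τ)))
    rcases eq_or_ne n 0 with rfl | hn
    · have := h.prob
      simp
    rw [h.moment_natCast hτ hn]
    refine Tendsto.congr' ?_ ((by fun_prop : Continuous fun ρ => Real.exp (-ρ * Φ n)).tendsto' τ _
      rfl |>.mono_left nhdsWithin_le_nhds)
    filter_upwards [self_mem_nhdsWithin] with ρ hρ using (h.moment_natCast (hτ.trans hρ) hn).symm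
  have hopen : IsOpen {x : I | Real.exp (-t) < x} :=
    isOpen_lt continuous_const continuous_subtype_val
  refine tendsto_order.2 ⟨fun a ha => ?_, fun a ha => ?_⟩
  · rcases lt_or_ge a 0 with ha0 | ha0
    · exact Eventually.of_forall fun ρ => ha0.trans_le (h.propFun_mem_Icc t ρ).1
    have := h.prob τ
    have hlt : ENNReal.ofReal a < η τ {x : I | Real.exp (-t) < x} :=
      (ENNReal.ofReal_lt_iff_lt_toReal ha0 (measure_ne_top _ _)).2 ha
    filter_upwards [eventually_lt_of_lt_liminf (hlt.trans_le
      (ProbabilityMeasure.le_liminf_measure_open_of_tendsto hweak hopen))] with ρ hρ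
    have := h.prob ρ
    exact (ENNReal.ofReal_lt_iff_lt_toReal ha0 (measure_ne_top _ _)).1 hρ
  · filter_upwards [self_mem_nhdsWithin] with ρ hρ
    exact (h.antitoneOn_propFun t hτ (hτ.trans hρ) hρ).trans_lt ha

/-- Markov's inequality for `e^{-X_τ}`. -/
theorem propFun_le_exp (h : IsSubordinator Φ η) (hτ : 0 ≤ τ) (t : ℝ) :
    propFun η t τ ≤ Real.exp t * Real.exp (-τ * Φ 1) := by
  have := h.prob τ
  have hinteg : Integrable (fun x : I => (x : ℝ)) (η τ) :=
    Integrable.of_bound (by fun_prop) 1 (ae_of_all _ fun x =>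
      (Real.norm_of_nonneg x.2.1).trans_le x.2.2)
  have hmarkov := mul_meas_ge_le_integral_of_nonneg (ae_of_all _ fun x : I => x.2.1) hinteg
    (Real.exp (-t))
  have hmean : ∫ x : I, (x : ℝ) ∂(η τ) = Real.exp (-τ * Φ 1) := by
    simpa using h.moment_natCast hτ one_ne_zero
  rw [hmean] at hmarkov
  calc propFun η t τ ≤ (η τ).real {x : I | Real.exp (-t) ≤ x} :=
        measureReal_mono (ofPred_subset_ofPred.2 fun _ hx => hx.le)
    _ = Real.exp t * (Real.exp (-t) * (η τ).real {x : I | Real.exp (-t) ≤ x}) := by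
        rw [← mul_assoc, ← Real.exp_add, add_neg_cancel, Real.exp_zero, one_mul]
    _ ≤ Real.exp t * Real.exp (-τ * Φ 1) := by gcongr

theorem tendsto_propFun_atTop (h : IsSubordinator Φ η) (hΦ : 0 < Φ 1) (t : ℝ) :
    Tendsto (propFun η t) atTop (𝓝 0) := by
  have hexp : Tendsto (fun τ => Real.exp t * Real.exp (-τ * Φ 1)) atTop (𝓝 0) := by
    rw [← mul_zero (Real.exp t)]
    simp only [neg_mul]
    exact (Real.tendsto_exp_atBot.comp
      (tendsto_neg_atTop_atBot.comp (tendsto_id.atTop_mul_const hΦ))).const_mul _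
  refine squeeze_zero' (Eventually.of_forall fun τ => (h.propFun_mem_Icc t τ).1) ?_ hexp
  filter_upwards [eventually_ge_atTop 0] with τ hτ using h.propFun_le_exp hτ t

theorem exists_isNegDtau (h : IsSubordinator Φ η) (hΦ : 0 < Φ 1) (t : ℝ) :
    ∃ ν : Measure ℝ, IsNegDtau (propFun η) t ν := by
  obtain ⟨ν, huniv, hneg, htail⟩ := exists_measure_Ioi_eq_ofReal (h.antitoneOn_propFun t)
    (h.propFun_mem_Icc t 0).2 (fun τ hτ => h.rightContinuous_propFun t hτ)
    (h.tendsto_propFun_atTop hΦ t)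
  exact ⟨ν, huniv, hneg, htail⟩

theorem isPropagationFunction (h : IsSubordinator (fun lam => 1 / laplace m lam) η) :
    IsPropagationFunction m (propFun η) where
  mono τ _ := (h.monotone_propFun τ).monotoneOn _
  bv τ _ := boundedVariationOn_of_monotoneOn ((h.monotone_propFun τ).monotoneOn _)
    fun t _ => h.propFun_mem_Icc t τ
  at_zero τ _ := propFun_zero η τ
  left_cont τ _ t _ := h.leftContinuous_propFun t τ
  laplace_eq _ hτ _ hlam := h.laplace_propFun hτ hlam

end IsSubordinator

/-- `ν t` is the Stieltjes measure `-d_τ w(t, ·)` of a propagation function `w` of the kernel `m`;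
these are the measures against which an operator semigroup is subordinated. -/
def IsSubordinatingFamily (m : ℝ → ℝ) (ν : ℝ → Measure ℝ) : Prop :=
  ∃ w, IsPropagationFunction m w ∧ ∀ t, 0 ≤ t → IsNegDtau w t (ν t)

theorem CompletelyPositive.exists_isSubordinatingFamily (hm : CompletelyPositive m) :
    ∃ ν, IsSubordinatingFamily m ν := by
  obtain ⟨η, h⟩ := hm.exists_isSubordinator
  obtain ⟨b, hb, hbcp, hbm⟩ := hm.exists_isCausalKernel
  have hΦ : 0 < 1 / laplace m 1 :=
    one_div_pos.2 (laplace_congr_ae hbm ▸ hbcp.laplace_pos hb one_pos)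
  choose ν hν using h.exists_isNegDtau hΦ
  exact ⟨ν, propFun η, h.isPropagationFunction, fun t _ => hν t⟩

end Propagation

section LeftContinuous

variable {α : Type*} [MeasurableSpace α]

theorem iSup_rat_indicator_Ioi_eq_self {g : ℝ → ℝ≥0∞} (hmono : Monotone g) {t : ℝ}
    (hleft : ContinuousWithinAt g (Iio t) t) :
    ⨆ s : ℚ, (Ioi (s : ℝ)).indicator (fun _ => g s) t = g t := by
  apply le_antisymm
  · refine iSup_le fun s => indicator_le (s := Ioi (s : ℝ)) (g := g) (fun t ht => ?_) t
    exact hmono (mem_Ioi.1 ht).le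
  · refine le_of_forall_lt fun c hc => ?_
    obtain ⟨l, hl, hlt⟩ := mem_nhdsLT_iff_exists_Ioo_subset.1 (hleft.eventually (lt_mem_nhds hc))
    obtain ⟨s, hls, hst⟩ := exists_rat_btwn (mem_Iio.1 hl)
    refine (show c < g s from hlt ⟨hls, hst⟩).trans_le ?_
    simpa [hst] using le_iSup (fun s : ℚ => (Ioi (s : ℝ)).indicator (fun _ => g s) t) s

theorem measurable_uncurry_of_leftContinuous {g : ℝ → α → ℝ≥0∞} (hmeas : ∀ t, Measurable (g t))
    (hmono : ∀ x, Monotone fun t => g t x)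
    (hleft : ∀ x t, ContinuousWithinAt (fun t => g t x) (Iio t) t) :
    Measurable (Function.uncurry g) := by
  have hsup : Function.uncurry g =
      fun q => ⨆ s : ℚ, (Ioi (s : ℝ)).indicator (fun _ => g s q.2) q.1 :=
    funext fun q => (iSup_rat_indicator_Ioi_eq_self (hmono q.2) (hleft q.2 q.1)).symm
  rw [hsup]
  exact Measurable.iSup fun s => (((hmeas s).comp measurable_snd).indicator
    (measurable_fst measurableSet_Ioi) : Measurable ((Prod.fst ⁻¹' Ioi (s : ℝ)).indicator _))

theorem eq_of_ae_eq_of_leftContinuous {X : Type*} [TopologicalSpace X] [T2Space X] {F G : ℝ → X}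
    {a t : ℝ} (h : F =ᵐ[volume.restrict (Ioi a)] G) (ht : a < t)
    (hF : ContinuousWithinAt F (Iio t) t) (hG : ContinuousWithinAt G (Iio t) t) : F t = G t := by
  refine tendsto_nhds_unique_of_frequently_eq hF hG fun hne => ?_
  obtain ⟨l, hl, hsub⟩ := (mem_nhdsLT_iff_exists_Ioo_subset' ht).1 hne
  have hnull : volume (Ioo (max l a) t) = 0 := by
    rw [EventuallyEq, ae_restrict_iff' measurableSet_Ioi, ae_iff] at h
    have hne_of_mem : Ioo (max l a) t ⊆ {s | ¬(s ∈ Ioi a → F s = G s)} := fun s hs himp =>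
      hsub ⟨(le_max_left _ _).trans_lt hs.1, hs.2⟩ (himp ((le_max_right _ _).trans_lt hs.1))
    exact measure_mono_null hne_of_mem h
  exact ((Measure.measure_Ioo_pos volume).2 (max_lt hl ht)).ne' hnull

end LeftContinuous

section SubordinatingMeasure

variable {m b r : ℝ → ℝ} {ν : ℝ → Measure ℝ} {t k lam : ℝ}

theorem integral_mul_exp_neg (k τ : ℝ) :
    ∫ x in (0 : ℝ)..τ, k * Real.exp (-k * x) = 1 - Real.exp (-k * τ) := by
  have h : ∀ x ∈ uIcc 0 τ, HasDerivAt (fun x => -Real.exp (-k * x)) (k * Real.exp (-k * x)) x :=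
    fun x _ => ((hasDerivAt_id x).const_mul (-k)).exp.neg.congr_deriv (by simp [mul_comm])
  rw [intervalIntegral.integral_eq_sub_of_hasDerivAt h
    (Continuous.intervalIntegrable (by fun_prop) _ _)]
  simp only [mul_zero, Real.exp_zero]
  ring

theorem lintegral_one_sub_exp_eq_lintegral_measure_Ioi {P : Measure ℝ} (hP : ∀ᵐ τ ∂P, 0 ≤ τ)
    (hk : 0 ≤ k) : ∫⁻ τ, ENNReal.ofReal (1 - Real.exp (-k * τ)) ∂P
      = ∫⁻ x in Ioi 0, P (Ioi x) * ENNReal.ofReal (k * Real.exp (-k * x)) := by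
  simp_rw [← integral_mul_exp_neg k]
  exact lintegral_comp_eq_lintegral_meas_lt_mul P hP aemeasurable_id
    (fun x _ => Continuous.intervalIntegrable (by fun_prop) _ _)
    (ae_of_all _ fun x => by positivity)

theorem integral_exp_eq_one_sub_toReal {P : Measure ℝ} [IsProbabilityMeasure P]
    (hP : ∀ᵐ τ ∂P, 0 ≤ τ) (hk : 0 ≤ k) : ∫ τ, Real.exp (-k * τ) ∂P
      = 1 - (∫⁻ x in Ioi 0, P (Ioi x) * ENNReal.ofReal (k * Real.exp (-k * x))).toReal := by
  rw [← lintegral_one_sub_exp_eq_lintegral_measure_Ioi hP hk,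
    ← integral_eq_lintegral_of_nonneg_ae _ (by fun_prop),
    integral_sub (integrable_const _) (integrable_exp_neg_mul hP hk)]
  · simp
  · filter_upwards [hP] with τ hτ
    rw [Pi.zero_apply, sub_nonneg, Real.exp_le_one_iff]
    nlinarith

theorem IsSubordinatingFamily.congr_ae (hν : IsSubordinatingFamily m ν)
    (h : b =ᵐ[volume.restrict (Ioi 0)] m) : IsSubordinatingFamily b ν := by
  obtain ⟨w, hw, hwν⟩ := hν
  exact ⟨w, ⟨hw.mono, hw.bv, hw.at_zero, hw.left_cont, fun τ hτ lam hlam => by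
    rw [hw.laplace_eq τ hτ lam hlam, laplace_congr_ae h]⟩, hwν⟩

theorem IsSubordinatingFamily.isProbabilityMeasure (hν : IsSubordinatingFamily m ν) (ht : 0 ≤ t) :
    IsProbabilityMeasure (ν t) := by
  obtain ⟨w, -, hwν⟩ := hν
  exact ⟨(hwν t ht).univ_eq⟩

theorem IsSubordinatingFamily.ae_nonneg (hν : IsSubordinatingFamily m ν) (ht : 0 ≤ t) :
    ∀ᵐ τ ∂(ν t), 0 ≤ τ := by
  obtain ⟨w, -, hwν⟩ := hν
  rw [ae_iff]
  simpa only [not_le] using! (hwν t ht).neg_eq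

/-- The tail function `(t, x) ↦ ν t (x, ∞)` of a family of measures. Only `t, x > 0` matter; the
extension by zero makes it monotone and left-continuous in `t` on the whole line. -/
def tail (ν : ℝ → Measure ℝ) (t x : ℝ) : ℝ≥0∞ :=
  if 0 < t ∧ 0 < x then ν t (Ioi x) else 0

theorem tail_of_pos {x : ℝ} (ht : 0 < t) (hx : 0 < x) : tail ν t x = ν t (Ioi x) :=
  if_pos ⟨ht, hx⟩

theorem tail_of_nonpos (ht : t ≤ 0) (x : ℝ) : tail ν t x = 0 :=
  if_neg fun h => ht.not_gt h.1

theorem tail_of_nonpos_right {x : ℝ} (hx : x ≤ 0) (t : ℝ) : tail ν t x = 0 :=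
  if_neg fun h => hx.not_gt h.2

theorem measurable_tail (ν : ℝ → Measure ℝ) (t : ℝ) : Measurable (tail ν t) := by
  have hanti : Antitone fun x : ℝ => ν t (Ioi x) := fun x y hxy =>
    measure_mono (Ioi_subset_Ioi hxy)
  refine Measurable.ite ?_ hanti.measurable measurable_const
  exact (MeasurableSet.const _).inter measurableSet_Ioi

namespace IsSubordinatingFamily

theorem measure_Ioi_zero (hν : IsSubordinatingFamily m ν) {x : ℝ} (hx : 0 ≤ x) :
    ν 0 (Ioi x) = 0 := by
  obtain ⟨w, hw, hwν⟩ := hν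
  rw [(hwν 0 le_rfl).tail_eq x hx, hw.at_zero x hx, ENNReal.ofReal_zero]

theorem tail_eq (hν : IsSubordinatingFamily m ν) (ht : 0 ≤ t) {x : ℝ} (hx : 0 < x) :
    tail ν t x = ν t (Ioi x) := by
  rcases ht.eq_or_lt with rfl | ht
  · rw [tail_of_nonpos le_rfl, hν.measure_Ioi_zero hx.le]
  · exact tail_of_pos ht hx

theorem monotone_tail (hν : IsSubordinatingFamily m ν) (x : ℝ) : Monotone fun t => tail ν t x := by
  obtain ⟨w, hw, hwν⟩ := hν
  intro s t hst
  rcases le_or_gt s 0 with hs | hs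
  · exact (tail_of_nonpos hs x).trans_le zero_le
  rcases le_or_gt x 0 with hx | hx
  · exact (tail_of_nonpos_right hx s).trans_le zero_le
  have ht := hs.trans_le hst
  simp only [tail_of_pos hs hx, tail_of_pos ht hx, (hwν s hs.le).tail_eq x hx.le,
    (hwν t ht.le).tail_eq x hx.le]
  exact ENNReal.ofReal_le_ofReal (hw.mono x hx.le hs.le ht.le hst)

theorem leftContinuous_tail (hν : IsSubordinatingFamily m ν) (x t : ℝ) :
    ContinuousWithinAt (fun t => tail ν t x) (Iio t) t := by
  obtain ⟨w, hw, hwν⟩ := hν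
  rcases le_or_gt x 0 with hx | hx
  · simp only [tail_of_nonpos_right hx]
    exact continuousWithinAt_const
  rcases le_or_gt t 0 with ht | ht
  · exact (continuousWithinAt_const (b := (0 : ℝ≥0∞))).congr (fun s hs =>
      tail_of_nonpos ((mem_Iio.1 hs).le.trans ht) x) (tail_of_nonpos ht x)
  have hw_left : ContinuousWithinAt (fun t => ENNReal.ofReal (w t x)) (Iio t) t :=
    ENNReal.tendsto_ofReal ((hw.left_cont x hx.le t ht).mono Iio_subset_Iic_self)
  refine hw_left.congr_of_eventuallyEq ?_ ?_
  · filter_upwards [mem_nhdsWithin_of_mem_nhds (Ioi_mem_nhds ht)] with s hs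
    rw [tail_of_pos hs hx, (hwν s (mem_Ioi.1 hs).le).tail_eq x hx.le]
  · rw [tail_of_pos ht hx, (hwν t ht.le).tail_eq x hx.le]

theorem tail_le_one (hν : IsSubordinatingFamily m ν) (t x : ℝ) : tail ν t x ≤ 1 := by
  rcases le_or_gt t 0 with ht | ht
  · exact (tail_of_nonpos ht x).trans_le zero_le
  rcases le_or_gt x 0 with hx | hx
  · exact (tail_of_nonpos_right hx t).trans_le zero_le
  have := hν.isProbabilityMeasure ht.le
  exact (tail_of_pos ht hx).trans_le prob_le_one

theorem measurable_uncurry_tail (hν : IsSubordinatingFamily m ν) :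
    Measurable (Function.uncurry (tail ν)) :=
  measurable_uncurry_of_leftContinuous (measurable_tail ν) hν.monotone_tail hν.leftContinuous_tail

theorem llaplaceOn_tail (hν : IsSubordinatingFamily m ν) {x : ℝ} (hx : 0 < x) (hlam : 0 < lam) :
    llaplaceOn lam (Ioi 0) (fun t => tail ν t x)
      = ENNReal.ofReal (Real.exp (-x * (1 / laplace m lam)) / lam) := by
  have htail_ne : ∀ t, tail ν t x ≠ ∞ := fun t =>
    ne_top_of_le_ne_top ENNReal.one_ne_top (hν.tail_le_one t x)
  have hfin : llaplaceOn lam (Ioi 0) (fun t => tail ν t x) ≠ ∞ := by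
    refine ne_top_of_le_ne_top ENNReal.ofReal_ne_top ((llaplaceOn_mono
      (ae_of_all _ fun t => hν.tail_le_one t x)).trans_eq (llaplaceOn_one hlam))
  have hmeas : Measurable fun t => (tail ν t x).toReal :=
    (hν.monotone_tail x).measurable.ennreal_toReal
  obtain ⟨w, hw, hwν⟩ := id hν
  have hwtail : laplace (fun t => w t x) lam = laplace (fun t => (tail ν t x).toReal) lam := by
    refine laplace_congr_ae ?_
    filter_upwards [ae_restrict_mem measurableSet_Ioi] with t ht
    have ht' : 0 ≤ t := (mem_Ioi.1 ht).le
    rw [hν.tail_eq ht' hx, (hwν t ht').tail_eq x hx.le, ENNReal.toReal_ofReal]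
    exact (hw.at_zero x hx.le).symm.trans_le (hw.mono x hx.le self_mem_Ici ht' ht')
  rw [← hw.laplace_eq x hx.le lam hlam, hwtail,
    laplace_eq_toReal_llaplaceOn hmeas fun _ => ENNReal.toReal_nonneg]
  simp only [Real.enorm_of_nonneg ENNReal.toReal_nonneg, ENNReal.ofReal_toReal (htail_ne _)]
  exact (ENNReal.ofReal_toReal hfin).symm

end IsSubordinatingFamily

/-- The weighted tail integral `∫₀^∞ ν t (x, ∞) k e^{-kx} dx`, which for `t > 0` is
`∫ (1 - e^{-kτ}) ν t (dτ)`. -/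
def tailIntegral (ν : ℝ → Measure ℝ) (k t : ℝ) : ℝ≥0∞ :=
  ∫⁻ x in Ioi 0, tail ν t x * ENNReal.ofReal (k * Real.exp (-k * x))

namespace IsSubordinatingFamily

theorem integral_exp_eq_one_sub_tailIntegral (hν : IsSubordinatingFamily m ν) (hk : 0 ≤ k)
    (ht : 0 ≤ t) : ∫ τ, Real.exp (-k * τ) ∂(ν t) = 1 - (tailIntegral ν k t).toReal := by
  have := hν.isProbabilityMeasure ht
  rw [integral_exp_eq_one_sub_toReal (hν.ae_nonneg ht) hk, tailIntegral]
  congr 2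
  refine setLIntegral_congr_fun measurableSet_Ioi fun x hx => ?_
  rw [hν.tail_eq ht hx]

theorem measurable_tailIntegral (hν : IsSubordinatingFamily m ν) (k : ℝ) :
    Measurable (tailIntegral ν k) :=
  Monotone.measurable fun _ _ hst => lintegral_mono fun x => by
    gcongr
    exact hν.monotone_tail x hst

theorem leftContinuous_tailIntegral (hν : IsSubordinatingFamily m ν) (hk : 0 < k) (t : ℝ) :
    ContinuousWithinAt (tailIntegral ν k) (Iio t) t := by
  have hexp : IntegrableOn (fun x => k * Real.exp (-k * x)) (Ioi 0) :=
    (integrableOn_exp_mul_Ioi (neg_lt_zero.2 hk) 0).const_mul _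
  refine tendsto_lintegral_filter_of_dominated_convergence
    (fun x => ENNReal.ofReal (k * Real.exp (-k * x))) ?_ ?_ hexp.lintegral_lt_top.ne ?_
  · exact Eventually.of_forall fun s => (measurable_tail ν s).mul (by fun_prop)
  · exact Eventually.of_forall fun s => ae_of_all _ fun x =>
      mul_le_of_le_one_left zero_le (hν.tail_le_one s x)
  · exact ae_of_all _ fun x => ENNReal.Tendsto.mul_const (hν.leftContinuous_tail x t)
      (Or.inr ENNReal.ofReal_ne_top)

theorem llaplaceOn_tailIntegral (hν : IsSubordinatingFamily m ν) (hk : 0 < k) (hlam : 0 < lam)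
    (hm : 0 < laplace m lam) : llaplaceOn lam (Ioi 0) (tailIntegral ν k)
      = ENNReal.ofReal (k / (lam * (k + 1 / laplace m lam))) := by
  have hW := hν.measurable_uncurry_tail
  have hrate : 0 < k + 1 / laplace m lam := by positivity
  calc llaplaceOn lam (Ioi 0) (tailIntegral ν k)
      = ∫⁻ t in Ioi 0, ∫⁻ x in Ioi 0, ENNReal.ofReal (Real.exp (-lam * t)) *
          (Function.uncurry (tail ν) (t, x) * ENNReal.ofReal (k * Real.exp (-k * x))) := by
        simp only [llaplaceOn, tailIntegral, Function.uncurry_apply_pair,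
          lintegral_const_mul' _ _ ENNReal.ofReal_ne_top]
    _ = ∫⁻ x in Ioi 0, ∫⁻ t in Ioi 0, ENNReal.ofReal (Real.exp (-lam * t)) *
          (Function.uncurry (tail ν) (t, x) * ENNReal.ofReal (k * Real.exp (-k * x))) :=
        lintegral_lintegral_swap (by fun_prop)
    _ = ∫⁻ x in Ioi 0, llaplaceOn lam (Ioi 0) (fun t => tail ν t x)
          * ENNReal.ofReal (k * Real.exp (-k * x)) := by
        simp only [llaplaceOn, Function.uncurry_apply_pair, ← mul_assoc,
          lintegral_mul_const' _ _ ENNReal.ofReal_ne_top]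
    _ = ∫⁻ x in Ioi 0, ENNReal.ofReal (k / lam * Real.exp (-(k + 1 / laplace m lam) * x)) := by
        refine setLIntegral_congr_fun measurableSet_Ioi fun x hx => ?_
        rw [hν.llaplaceOn_tail hx hlam, ← ENNReal.ofReal_mul (by positivity),
          show -(k + 1 / laplace m lam) * x = -x * (1 / laplace m lam) + -k * x by ring,
          Real.exp_add]
        ring_nf
    _ = ENNReal.ofReal (k / (lam * (k + 1 / laplace m lam))) := by
        rw [← ofReal_integral_eq_lintegral_ofReal
            ((integrableOn_exp_mul_Ioi (neg_lt_zero.2 hrate) 0).const_mul _)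
            (ae_of_all _ fun x => by positivity),
          integral_const_mul, integral_exp_mul_Ioi (neg_lt_zero.2 hrate), mul_zero, Real.exp_zero,
          neg_div_neg_eq, div_mul_div_comm, mul_one]

end IsSubordinatingFamily

theorem lconvolution_indicator_one {ρ : ℝ → ℝ≥0∞} (hρ : ∀ t ≤ 0, ρ t = 0) (t : ℝ) :
    (ρ ⋆ₗ (Ioi 0).indicator fun _ => 1) t = ∫⁻ σ in Ioc 0 t, ρ σ := by
  rw [lconvolution_def, setLIntegral_congr (Ioo_ae_eq_Ioc (a := (0 : ℝ)) (b := t)).symm,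
    ← lintegral_indicator measurableSet_Ioo]
  refine lintegral_congr fun σ => ?_
  rcases le_or_gt σ 0 with hσ | hσ
  · simp [hρ σ hσ, indicator_of_notMem (show σ ∉ Ioo 0 t from fun h => hσ.not_gt h.1)]
  · by_cases hσt : σ < t <;> simp [indicator, hσ, hσt]

theorem continuous_integral_Ioc (hr : Integrable r) (hr0 : ∀ t ≤ 0, r t = 0) :
    Continuous fun t => ∫ σ in Ioc 0 t, r σ := by
  refine (intervalIntegral.continuous_primitive
    (fun a b => hr.intervalIntegrable (a := a) (b := b)) 0).congr fun t => ?_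
  rcases le_total 0 t with ht | ht
  · rw [intervalIntegral.integral_of_le ht]
  · rw [intervalIntegral.integral_of_ge ht, Ioc_eq_empty ht.not_gt, Measure.restrict_empty,
      integral_zero_measure, neg_eq_zero]
    exact setIntegral_eq_zero_of_forall_eq_zero fun x hx => hr0 x hx.2

theorem CompletelyPositive.llaplaceOn_integral_resolvent (hm : CompletelyPositive b)
    (hb : IsCausalKernel b) (hk : 0 < k) (hr : IsVolterraSolution k b b r) (hlam : 0 < lam) :
    llaplaceOn lam (Ioi 0) (fun t => ENNReal.ofReal (k * ∫ σ in Ioc 0 t, r σ))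
      = ENNReal.ofReal (k / (lam * (k + 1 / laplace b lam))) := by
  have hrm := hr.measurable
  have hpos := hm.laplace_pos hb hlam
  have hone : Measurable ((Ioi (0 : ℝ)).indicator fun _ => (1 : ℝ≥0∞)) :=
    measurable_const.indicator measurableSet_Ioi
  have hr0 : ∀ t ≤ 0, ‖r t‖ₑ = 0 := fun t ht => hr.enorm_eq_zero t ht
  have hconv : ∀ t, ENNReal.ofReal (k * ∫ σ in Ioc 0 t, r σ)
      = ENNReal.ofReal k * ((‖r ·‖ₑ) ⋆ₗ (Ioi 0).indicator fun _ => 1) t := fun t => by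
    rw [lconvolution_indicator_one hr0, ENNReal.ofReal_mul hk.le,
      ofReal_integral_eq_lintegral_ofReal (hm.integrable_resolvent hb hk hr).integrableOn
        (ae_of_all _ hr.nonneg)]
    simp only [Real.enorm_of_nonneg (hr.nonneg _)]
  have hlap_one : llaplaceOn lam (Ioi 0) ((Ioi 0).indicator fun _ => 1)
      = ENNReal.ofReal (1 / lam) := by
    rw [← llaplaceOn_one hlam]
    exact llaplaceOn_congr ((ae_restrict_mem measurableSet_Ioi).mono fun t ht =>
      indicator_of_mem ht _)
  simp_rw [hconv]
  rw [llaplaceOn_const_mul (by fun_prop), llaplaceOn_Ioi_lconvolution (by fun_prop) hone hr0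
      fun t ht => indicator_of_notMem (not_lt.2 ht) _,
    hm.llaplaceOn_resolvent hb hk.le hr hlam, hlap_one, ← ENNReal.ofReal_mul (by positivity),
    ← ENNReal.ofReal_mul hk.le]
  congr 1
  field_simp
  ring

/-- Both sides have the same double Laplace transform and are left-continuous in `t`. -/
theorem IsSubordinatingFamily.tailIntegral_eq (hν : IsSubordinatingFamily b ν)
    (hm : CompletelyPositive b) (hb : IsCausalKernel b) (hk : 0 < k)
    (hr : IsVolterraSolution k b b r) (t : ℝ) :
    tailIntegral ν k t = ENNReal.ofReal (k * ∫ σ in Ioc 0 t, r σ) := by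
  have hcont : Continuous fun t => ENNReal.ofReal (k * ∫ σ in Ioc 0 t, r σ) :=
    ENNReal.continuous_ofReal.comp (continuous_const.mul
      (continuous_integral_Ioc (hm.integrable_resolvent hb hk hr) hr.eq_zero))
  have hlap : ∀ lam : ℝ, 0 < lam → llaplaceOn lam (Ioi 0) (tailIntegral ν k)
      = ENNReal.ofReal (k / (lam * (k + 1 / laplace b lam))) := fun lam hlam =>
    hν.llaplaceOn_tailIntegral hk hlam (hm.laplace_pos hb hlam)
  have hae : tailIntegral ν k =ᵐ[volume.restrict (Ioi 0)]
      fun t => ENNReal.ofReal (k * ∫ σ in Ioc 0 t, r σ) := by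
    refine ae_eq_of_llaplaceOn_eq (hν.measurable_tailIntegral k) hcont.measurable
      (fun lam hlam => ?_) fun lam hlam => ?_
    · exact (hlap lam hlam).trans_ne ENNReal.ofReal_ne_top
    · rw [hlap lam hlam, hm.llaplaceOn_integral_resolvent hb hk hr hlam]
  rcases le_or_gt t 0 with ht | ht
  · simp [tailIntegral, tail_of_nonpos ht, Ioc_eq_empty ht.not_gt]
  · exact eq_of_ae_eq_of_leftContinuous hae ht (hν.leftContinuous_tailIntegral hk t)
      hcont.continuousWithinAt

theorem IsSubordinatingFamily.integral_exp_eq (hν : IsSubordinatingFamily b ν)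
    (hm : CompletelyPositive b) (hb : IsCausalKernel b) (hk : 0 < k)
    (hr : IsVolterraSolution k b b r) (ht : 0 ≤ t) :
    ∫ τ, Real.exp (-k * τ) ∂(ν t) = 1 - k * ∫ σ in Ioc 0 t, r σ := by
  rw [hν.integral_exp_eq_one_sub_tailIntegral hk.le ht, hν.tailIntegral_eq hm hb hk hr,
    ENNReal.toReal_ofReal (mul_nonneg hk.le (integral_nonneg hr.nonneg))]

end SubordinatingMeasure

section Relaxation

variable {m m' : ℝ → ℝ} {ν ν' : ℝ → Measure ℝ} {k t T : ℝ}

theorem half_mul_measureReal_Ioi_le {P : Measure ℝ} [IsProbabilityMeasure P]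
    (hP : ∀ᵐ τ ∂P, 0 ≤ τ) {R : ℝ} (hR : 0 < R) :
    1 / 2 * P.real (Ioi R) ≤ 1 - ∫ τ, Real.exp (-(1 / R) * τ) ∂P := by
  have hexp := integrable_exp_neg_mul hP (one_div_pos.2 hR).le
  have hsplit : 1 - ∫ τ, Real.exp (-(1 / R) * τ) ∂P
      = ∫ τ, (1 - Real.exp (-(1 / R) * τ)) ∂P := by
    rw [integral_sub (integrable_const _) hexp]
    simp
  rw [hsplit, mul_comm, ← smul_eq_mul, ← integral_indicator_const _ measurableSet_Ioi]
  refine integral_mono_ae ((integrable_const _).indicator measurableSet_Ioi)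
    ((integrable_const _).sub hexp) ?_
  filter_upwards [hP] with τ hτ
  by_cases hτR : τ ∈ Ioi R
  · have hle : Real.exp (-(1 / R) * τ) ≤ Real.exp (-1) := by
      rw [Real.exp_le_exp, neg_mul, neg_le_neg_iff, one_div_mul_eq_div, one_le_div hR]
      exact (mem_Ioi.1 hτR).le
    rw [indicator_of_mem hτR]
    linarith [Real.exp_neg_one_lt_half]
  · rw [indicator_of_notMem hτR, sub_nonneg, Real.exp_le_one_iff, neg_mul, neg_nonpos]
    positivity

namespace IsSubordinatingFamily

theorem exists_integral_exp_eq (hν : IsSubordinatingFamily m ν) (hm : CompletelyPositive m)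
    (hk : 0 < k) : ∃ b r, IsCausalKernel b ∧ CompletelyPositive b ∧
      b =ᵐ[volume.restrict (Ioi 0)] m ∧ IsVolterraSolution k b b r ∧
      ∀ t, 0 ≤ t → ∫ τ, Real.exp (-k * τ) ∂(ν t) = 1 - k * ∫ σ in Ioc 0 t, r σ := by
  obtain ⟨b, hb, hbcp, hbm⟩ := hm.exists_isCausalKernel
  obtain ⟨r, hr⟩ := hbcp.exists_resolvent hb hk
  exact ⟨b, r, hb, hbcp, hbm, hr, fun t ht => (hν.congr_ae hbm).integral_exp_eq hbcp hb hk hr ht⟩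

theorem integral_exp_zero (hν : IsSubordinatingFamily m ν) (ht : 0 ≤ t) :
    ∫ τ, Real.exp (-0 * τ) ∂(ν t) = 1 := by
  have := hν.isProbabilityMeasure ht
  simp

theorem continuousOn_integral_exp (hν : IsSubordinatingFamily m ν) (hm : CompletelyPositive m)
    (hk : 0 ≤ k) : ContinuousOn (fun t => ∫ τ, Real.exp (-k * τ) ∂(ν t)) (Ici 0) := by
  rcases hk.eq_or_lt with rfl | hk
  · exact continuousOn_const.congr fun t ht => hν.integral_exp_zero ht
  obtain ⟨b, r, hb, hbcp, -, hr, hinteg⟩ := hν.exists_integral_exp_eq hm hk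
  exact (continuous_const.sub (continuous_const.mul (continuous_integral_Ioc
    (hbcp.integrable_resolvent hb hk hr) hr.eq_zero))).continuousOn.congr hinteg

theorem exists_abs_integral_exp_sub_le (hν : IsSubordinatingFamily m ν)
    (hm : CompletelyPositive m) (hk : 0 ≤ k) (T : ℝ) :
    ∃ C : ℝ, 0 ≤ C ∧ ∀ m' ν', CompletelyPositive m' → IsSubordinatingFamily m' ν' →
      ∀ t ∈ Icc 0 T, |∫ τ, Real.exp (-k * τ) ∂(ν' t) - ∫ τ, Real.exp (-k * τ) ∂(ν t)|
        ≤ C * ∫ σ in Ioo 0 T, |m' σ - m σ| := by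
  rcases hk.eq_or_lt with rfl | hk
  · refine ⟨0, le_rfl, fun m' ν' _ hν' t ht => ?_⟩
    rw [hν.integral_exp_zero ht.1, hν'.integral_exp_zero ht.1, sub_self, abs_zero, zero_mul]
  obtain ⟨b, r, hb, hbcp, hbm, hr, hinteg⟩ := hν.exists_integral_exp_eq hm hk
  obtain ⟨C, hC0, hC⟩ := hbcp.exists_abs_integral_resolvent_sub_le hb hk hr T
  refine ⟨k * C, by positivity, fun m' ν' hm' hν' t ht => ?_⟩
  obtain ⟨b', r', hb', hbcp', hbm', hr', hinteg'⟩ := hν'.exists_integral_exp_eq hm' hk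
  have hdist : ∫ σ in Ioo 0 T, |m' σ - m σ| = ∫ σ in Ioo 0 T, |b' σ - b σ| := by
    refine integral_congr_ae (ae_restrict_of_ae_restrict_of_subset Ioo_subset_Ioi_self ?_)
    filter_upwards [hbm, hbm'] with σ hσ hσ'
    rw [hσ, hσ']
  rw [hinteg t ht.1, hinteg' t ht.1, sub_sub_sub_cancel_left, ← mul_sub, abs_mul, abs_of_pos hk,
    abs_sub_comm, hdist, mul_assoc]
  exact mul_le_mul_of_nonneg_left (hC b' r' hbcp' hb' hr' t ht.2) hk.le

theorem one_sub_integral_exp_le (hν : IsSubordinatingFamily m ν) (hm : CompletelyPositive m)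
    (hk : 0 < k) (ht : t ∈ Icc 0 T) :
    1 - ∫ τ, Real.exp (-k * τ) ∂(ν t) ≤ k * ∫ σ in Ioo 0 T, m σ := by
  obtain ⟨b, r, hb, hbcp, hbm, hr, hinteg⟩ := hν.exists_integral_exp_eq hm hk
  have hrint := hbcp.integrable_resolvent hb hk hr
  rw [hinteg t ht.1, sub_sub_cancel]
  refine mul_le_mul_of_nonneg_left ?_ hk.le
  calc ∫ σ in Ioc 0 t, r σ ≤ ∫ σ in Ioc 0 T, r σ :=
        setIntegral_mono_set hrint.integrableOn (ae_of_all _ hr.nonneg)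
          (Ioc_subset_Ioc_right ht.2).eventuallyLE
    _ = ∫ σ in Ioo 0 T, r σ := integral_Ioc_eq_integral_Ioo
    _ ≤ ∫ σ in Ioo 0 T, m σ := by
        refine integral_mono_ae hrint.integrableOn ((hm.locInt T).mono_set Ioo_subset_Ioc_self)
          (ae_restrict_of_ae_restrict_of_subset Ioo_subset_Ioi_self ?_)
        filter_upwards [hr.ae_le hk.le hb, hbm] with σ hle hσ
        exact hle.trans_eq hσ

theorem measureReal_Ioi_le (hν : IsSubordinatingFamily m ν) (hm : CompletelyPositive m)
    (ht : t ∈ Icc 0 T) {R : ℝ} (hR : 0 < R) :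
    (ν t).real (Ioi R) ≤ 2 * (∫ σ in Ioo 0 T, m σ) / R := by
  have := hν.isProbabilityMeasure ht.1
  have htail := (half_mul_measureReal_Ioi_le (hν.ae_nonneg ht.1) hR).trans
    (hν.one_sub_integral_exp_le hm (one_div_pos.2 hR) ht)
  calc (ν t).real (Ioi R) = 2 * (1 / 2 * (ν t).real (Ioi R)) := by ring
    _ ≤ 2 * (1 / R * ∫ σ in Ioo 0 T, m σ) := by gcongr
    _ = 2 * (∫ σ in Ioo 0 T, m σ) / R := by ring

end IsSubordinatingFamily

end Relaxation

section WeakContinuity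

variable {X : Type*} [NormedAddCommGroup X] [NormedSpace ℝ X] {h : ℝ → X} {C ε t : ℝ}
  {m m' : ℝ → ℝ} {ν ν' : ℝ → Measure ℝ}

theorem IsSubordinatingFamily.exists_norm_relaxation_sum_sub_le (hν : IsSubordinatingFamily m ν)
    (hm : CompletelyPositive m) (T : ℝ) (N : ℕ) (c : ℕ → X) :
    ∃ K : ℝ, 0 ≤ K ∧ ∀ m' ν', CompletelyPositive m' → IsSubordinatingFamily m' ν' →
      ∀ t ∈ Icc 0 T, ‖∑ k ∈ Finset.range N, (∫ τ, Real.exp (-k * τ) ∂(ν' t)) • c k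
        - ∑ k ∈ Finset.range N, (∫ τ, Real.exp (-k * τ) ∂(ν t)) • c k‖
        ≤ K * ∫ σ in Ioo 0 T, |m' σ - m σ| := by
  choose K hK0 hK using fun k : ℕ =>
    hν.exists_abs_integral_exp_sub_le hm (k.cast_nonneg (α := ℝ)) T
  refine ⟨∑ k ∈ Finset.range N, K k * ‖c k‖,
    Finset.sum_nonneg fun k _ => mul_nonneg (hK0 k) (norm_nonneg _), fun m' ν' hm' hν' t ht => ?_⟩
  rw [← Finset.sum_sub_distrib, Finset.sum_mul]
  refine norm_sum_le_of_le _ fun k _ => ?_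
  rw [← sub_smul, norm_smul, Real.norm_eq_abs, mul_right_comm]
  exact mul_le_mul_of_nonneg_right (hK k m' ν' hm' hν' t ht) (norm_nonneg _)

variable [CompleteSpace X]

/-- The coefficients do not depend on the kernel: on `[0, R]` this is Weierstrass' theorem in the
variable `e^{-τ}`, and `∫₀ᵀ m ≤ B` makes the masses of `(R, ∞)` uniformly small. -/
theorem exists_relaxation_sum_approx (hc : ContinuousOn h (Ici 0))
    (hC : ∀ τ, 0 ≤ τ → ‖h τ‖ ≤ C) (B : ℝ) (hε : 0 < ε) :
    ∃ N : ℕ, ∃ c : ℕ → X, ∀ m ν T, CompletelyPositive m → IsSubordinatingFamily m ν →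
      ∫ σ in Ioo 0 T, m σ ≤ B → ∀ t ∈ Icc 0 T,
      ‖∫ τ, h τ ∂(ν t) - ∑ k ∈ Finset.range N, (∫ τ, Real.exp (-k * τ) ∂(ν t)) • c k‖ ≤ ε := by
  have hC0 : 0 ≤ C := (norm_nonneg _).trans (hC 0 le_rfl)
  obtain ⟨R, hR, hRpos⟩ := (((tendsto_const_nhds (x := C * (2 * B))).div_atTop tendsto_id
    |>.eventually (ge_mem_nhds (half_pos hε))).and (eventually_gt_atTop 0)).exists
  obtain ⟨N, c, happrox⟩ := exists_laplace_sum_approx hc hC R (half_pos hε)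
  refine ⟨N, c, fun m ν T hm hν hB t ht => ?_⟩
  have htail : C * (ν t).real (Ioi R) ≤ ε / 2 := by
    calc C * (ν t).real (Ioi R) ≤ C * (2 * (∫ σ in Ioo 0 T, m σ) / R) := by
          gcongr
          exact hν.measureReal_Ioi_le hm ht hRpos
      _ ≤ C * (2 * B / R) := by gcongr
      _ = C * (2 * B) / R := (mul_div_assoc _ _ _).symm
      _ ≤ ε / 2 := hR
  linarith [happrox (ν t) (hν.isProbabilityMeasure ht.1) (hν.ae_nonneg ht.1)]

namespace IsSubordinatingFamily

theorem continuousOn_integral (hν : IsSubordinatingFamily m ν) (hm : CompletelyPositive m)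
    (hc : ContinuousOn h (Ici 0)) (hC : ∀ τ, 0 ≤ τ → ‖h τ‖ ≤ C) (T : ℝ) :
    ContinuousOn (fun t => ∫ τ, h τ ∂(ν t)) (Icc 0 T) := by
  refine continuousOn_of_uniform_approx_of_continuousOn fun U hU => ?_
  obtain ⟨ε, hε, hεU⟩ := Metric.mem_uniformity_dist.1 hU
  obtain ⟨N, c, happrox⟩ :=
    exists_relaxation_sum_approx hc hC (∫ σ in Ioo 0 T, m σ) (half_pos hε)
  refine ⟨fun t => ∑ k ∈ Finset.range N, (∫ τ, Real.exp (-k * τ) ∂(ν t)) • c k,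
    continuousOn_finsetSum _ fun k _ => ((hν.continuousOn_integral_exp hm
      k.cast_nonneg).mono Icc_subset_Ici_self).smul continuousOn_const, fun t ht => hεU ?_⟩
  rw [dist_eq_norm]
  exact (happrox m ν T hm hν le_rfl t ht).trans_lt (half_lt_self hε)

theorem exists_norm_integral_sub_le (hν : IsSubordinatingFamily m ν) (hm : CompletelyPositive m)
    (hc : ContinuousOn h (Ici 0)) (hC : ∀ τ, 0 ≤ τ → ‖h τ‖ ≤ C) (T : ℝ) (hε : 0 < ε) :
    ∃ δ > 0, ∀ m' ν', CompletelyPositive m' → IsSubordinatingFamily m' ν' →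
      ∫ σ in Ioo 0 T, |m' σ - m σ| < δ →
      ∀ t ∈ Icc 0 T, ‖∫ τ, h τ ∂(ν' t) - ∫ τ, h τ ∂(ν t)‖ ≤ ε := by
  obtain ⟨N, c, happrox⟩ := exists_relaxation_sum_approx hc hC ((∫ σ in Ioo 0 T, m σ) + 1)
    (show 0 < ε / 3 by positivity)
  obtain ⟨K, hK0, hK⟩ := hν.exists_norm_relaxation_sum_sub_le hm T N c
  refine ⟨min 1 (ε / 3 / (K + 1)), by positivity, fun m' ν' hm' hν' hδ t ht => ?_⟩
  have hmi : IntegrableOn m (Ioo 0 T) := (hm.locInt T).mono_set Ioo_subset_Ioc_self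
  have hmi' : IntegrableOn m' (Ioo 0 T) := (hm'.locInt T).mono_set Ioo_subset_Ioc_self
  have hmass : ∫ σ in Ioo 0 T, m' σ ≤ (∫ σ in Ioo 0 T, m σ) + 1 := by
    have hle : (∫ σ in Ioo 0 T, m' σ) - ∫ σ in Ioo 0 T, m σ ≤ ∫ σ in Ioo 0 T, |m' σ - m σ| := by
      rw [← integral_sub hmi' hmi]
      exact integral_mono (hmi'.sub hmi) (hmi'.sub hmi).abs fun σ => le_abs_self _
    linarith [hδ.trans_le (min_le_left _ _)]
  have hsum : K * ∫ σ in Ioo 0 T, |m' σ - m σ| ≤ ε / 3 := by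
    calc K * ∫ σ in Ioo 0 T, |m' σ - m σ| ≤ (K + 1) * (ε / 3 / (K + 1)) := by
          gcongr
          · linarith
          · exact (hδ.trans_le (min_le_right _ _)).le
      _ = ε / 3 := by field_simp
  have happrox' := happrox m' ν' T hm' hν' hmass t ht
  have happrox₀ := happrox m ν T hm hν (by linarith) t ht
  rw [norm_sub_rev] at happrox₀
  have hmid := hK m' ν' hm' hν' t ht
  have htri := norm_sub_le_norm_sub_add_norm_sub (∫ τ, h τ ∂(ν' t))
    (∑ k ∈ Finset.range N, (∫ τ, Real.exp (-k * τ) ∂(ν t)) • c k) (∫ τ, h τ ∂(ν t))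
  have htri' := norm_sub_le_norm_sub_add_norm_sub (∫ τ, h τ ∂(ν' t))
    (∑ k ∈ Finset.range N, (∫ τ, Real.exp (-k * τ) ∂(ν' t)) • c k)
    (∑ k ∈ Finset.range N, (∫ τ, Real.exp (-k * τ) ∂(ν t)) • c k)
  linarith

theorem integral_eq_of_ae_eq (hν : IsSubordinatingFamily m ν) (hm : CompletelyPositive m)
    (hν' : IsSubordinatingFamily m' ν') (hm' : CompletelyPositive m')
    (hc : ContinuousOn h (Ici 0)) (hC : ∀ τ, 0 ≤ τ → ‖h τ‖ ≤ C) {T : ℝ}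
    (hmm' : m' =ᵐ[volume.restrict (Ioo 0 T)] m) (ht : t ∈ Icc 0 T) :
    ∫ τ, h τ ∂(ν' t) = ∫ τ, h τ ∂(ν t) := by
  have hzero : ∫ σ in Ioo 0 T, |m' σ - m σ| = 0 := integral_eq_zero_of_ae (by
    filter_upwards [hmm'] with σ hσ
    simp [hσ])
  refine sub_eq_zero.1 (norm_le_zero_iff.1 (le_of_forall_pos_le_add fun ε hε => ?_))
  obtain ⟨δ, hδ, hstab⟩ := hν.exists_norm_integral_sub_le hm hc hC T hε
  rw [zero_add]
  exact hstab m' ν' hm' hν' (hzero.trans_lt hδ) t ht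

end IsSubordinatingFamily

end WeakContinuity

section MildEquation

variable {X : Type*} [NormedAddCommGroup X] {T : ℝ} {S S' : ℝ → X → X} {f : X → X} {M K : NNReal}

theorem eventually_forall_norm_sub_le_of_isCompact {ι α : Type*} {l : Filter ι} {J : Set α}
    {R : ι → α → X → X} {R₀ : α → X → X} (hR : ∀ i, ∀ t ∈ J, LipschitzWith M (R i t))
    (hR₀ : ∀ t ∈ J, LipschitzWith M (R₀ t))
    (h : ∀ v, ∀ ε > 0, ∀ᶠ i in l, ∀ t ∈ J, ‖R i t v - R₀ t v‖ ≤ ε) {s : Set X}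
    (hs : IsCompact s) {ε : ℝ} (hε : 0 < ε) :
    ∀ᶠ i in l, ∀ t ∈ J, ∀ x ∈ s, ‖R i t x - R₀ t x‖ ≤ ε := by
  set η := ε / (2 * M + 1)
  have hη : 0 < η := by positivity
  have hηε : (2 * M + 1) * η = ε := mul_div_cancel₀ _ (by positivity)
  obtain ⟨F, hF, hsF⟩ := Metric.totallyBounded_iff.1 hs.totallyBounded η hη
  filter_upwards [(eventually_all_finite hF).2 fun y _ => h y η hη] with i hi t ht x hx
  obtain ⟨y, hy, hxy⟩ := mem_iUnion₂.1 (hsF hx)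
  have hclose : M * ‖x - y‖ ≤ M * η := by
    rw [← dist_eq_norm]
    exact mul_le_mul_of_nonneg_left (Metric.mem_ball.1 hxy).le M.2
  have hleft := (hR i t ht).norm_sub_le x y
  have hright := (hR₀ t ht).norm_sub_le y x
  rw [norm_sub_rev y x] at hright
  have htri := norm_sub_le_norm_sub_add_norm_sub (R i t x) (R i t y) (R₀ t x)
  have htri' := norm_sub_le_norm_sub_add_norm_sub (R i t y) (R₀ t y) (R₀ t x)
  linarith [hi y hy t ht]

theorem le_mul_exp_of_le_add_integral {D : ℝ → ℝ} (hD : Continuous D) (hD0 : ∀ t, 0 ≤ D t)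
    {δ L : ℝ} (hL : 0 ≤ L) (h : ∀ t ∈ Icc 0 T, D t ≤ δ + L * ∫ σ in (0 : ℝ)..t, D σ) {t : ℝ}
    (ht : t ∈ Icc 0 T) : D t ≤ δ * Real.exp (L * t) := by
  have hderiv : ∀ t, HasDerivAt (fun t => ∫ σ in (0 : ℝ)..t, D σ) (D t) t := fun t =>
    intervalIntegral.integral_hasDerivAt_right (hD.intervalIntegrable _ _)
      (hD.stronglyMeasurableAtFilter _ _) hD.continuousAt
  have hinteg : ∀ t, 0 ≤ t → ‖∫ σ in (0 : ℝ)..t, D σ‖ = ∫ σ in (0 : ℝ)..t, D σ := fun t ht =>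
    Real.norm_of_nonneg (intervalIntegral.integral_nonneg ht fun σ _ => hD0 σ)
  have hgronwall := norm_le_gronwallBound_of_norm_deriv_right_le (δ := 0) (K := L) (ε := δ)
    (fun t _ => (hderiv t).continuousAt.continuousWithinAt)
    (fun t _ => (hderiv t).hasDerivWithinAt) (by simp)
    (fun t ht => by
      rw [Real.norm_of_nonneg (hD0 t), hinteg t ht.1, add_comm]
      exact h t (Ico_subset_Icc_self ht)) t ht
  rw [hinteg t ht.1, sub_zero] at hgronwall
  refine (h t ht).trans ((add_le_add_right (mul_le_mul_of_nonneg_left hgronwall hL) δ).trans_eq ?_)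
  rcases hL.eq_or_lt with rfl | hL
  · simp
  · rw [gronwallBound_of_K_ne_0 hL.ne']
    field_simp
    ring

/-- A family of (possibly nonlinear) maps that is Lipschitz with a common constant and strongly
continuous along the time set `J`; values at other times are irrelevant. -/
structure IsLipschitzFamilyOn (J : Set ℝ) (M : NNReal) (S : ℝ → X → X) : Prop where
  lipschitzWith : ∀ t ∈ J, LipschitzWith M (S t)
  continuousOn : ∀ v, ContinuousOn (fun t => S t v) J

/-- The integrand of the mild equation at time `t`, extended continuously to all times by
projecting them onto `[0, T]`. -/
def mildIntegrand (hT : 0 ≤ T) (S : ℝ → X → X) (f : X → X) (u : C(Icc (0 : ℝ) T, X))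
    (t σ : ℝ) : X :=
  S (projIcc 0 T hT (t - σ)) (f (u (projIcc 0 T hT σ)))

theorem mildIntegrand_eq (hT : 0 ≤ T) (S : ℝ → X → X) (f : X → X) (u : C(Icc (0 : ℝ) T, X))
    {t σ : ℝ} (ht : t ≤ T) (hσ : σ ∈ Icc 0 t) :
    mildIntegrand hT S f u t σ = S (t - σ) (f (u (projIcc 0 T hT σ))) := by
  rw [mildIntegrand, projIcc_of_mem hT ⟨by linarith [hσ.2], by linarith [hσ.1]⟩]

theorem norm_apply_sub_apply_le {t : ℝ} (hS : LipschitzWith M (S t)) (hf : LipschitzWith K f)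
    (x y : X) : ‖S t (f x) - S t (f y)‖ ≤ M * K * ‖x - y‖ :=
  (hS.comp hf).norm_sub_le x y

namespace IsLipschitzFamilyOn

theorem continuous_projIcc_apply (hT : 0 ≤ T) (hS : IsLipschitzFamilyOn (Icc 0 T) M S) :
    Continuous fun q : ℝ × X => S (projIcc 0 T hT q.1) q.2 :=
  continuous_prod_of_continuous_lipschitzWith' _ M
    (fun t => hS.lipschitzWith _ (projIcc 0 T hT t).2) fun v =>
      (hS.continuousOn v).comp_continuous (continuous_subtype_val.comp continuous_projIcc)
        fun t => (projIcc 0 T hT t).2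

theorem continuous_mildIntegrand (hT : 0 ≤ T) (hS : IsLipschitzFamilyOn (Icc 0 T) M S)
    (hf : Continuous f) (u : C(Icc (0 : ℝ) T, X)) :
    Continuous (Function.uncurry (mildIntegrand hT S f u)) :=
  (hS.continuous_projIcc_apply hT).comp ((continuous_fst.sub continuous_snd).prodMk
    (hf.comp (u.continuous.comp (continuous_projIcc.comp continuous_snd))))

theorem intervalIntegrable_mildIntegrand (hT : 0 ≤ T) (hS : IsLipschitzFamilyOn (Icc 0 T) M S)
    (hf : Continuous f) (u : C(Icc (0 : ℝ) T, X)) (t a b : ℝ) :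
    IntervalIntegrable (mildIntegrand hT S f u t) volume a b :=
  ((hS.continuous_mildIntegrand hT hf u).comp (Continuous.prodMk_right t)).intervalIntegrable a b

end IsLipschitzFamilyOn

variable [NormedSpace ℝ X] {φ φ' u u' : C(Icc (0 : ℝ) T, X)}

theorem IsGeneralizedMildSolution.congr {hT : 0 ≤ T} (h : IsGeneralizedMildSolution hT S f φ u)
    (hSS' : ∀ t ∈ Icc 0 T, S t = S' t) : IsGeneralizedMildSolution hT S' f φ u := fun t => by
  have hcongr : ∀ σ ∈ uIcc 0 (t : ℝ), S (t - σ) (f (u (projIcc 0 T hT σ)))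
      = S' (t - σ) (f (u (projIcc 0 T hT σ))) := fun σ hσ => by
    rw [uIcc_of_le t.2.1] at hσ
    rw [hSS' _ ⟨by linarith [hσ.2], by linarith [hσ.1, t.2.2]⟩]
  rw [← intervalIntegral.integral_congr hcongr]
  exact ⟨(intervalIntegrable_congr fun σ hσ => hcongr σ (uIoc_subset_uIcc hσ)).1 (h t).1, (h t).2⟩

/-- The right-hand side of the mild equation, as an operator on `C([0, T]; X)`. -/
def mildOperator (hT : 0 ≤ T) (hS : IsLipschitzFamilyOn (Icc 0 T) M S) (hf : Continuous f)
    (φ u : C(Icc (0 : ℝ) T, X)) : C(Icc (0 : ℝ) T, X) where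
  toFun t := φ t + ∫ σ in (0 : ℝ)..t, mildIntegrand hT S f u t σ
  continuous_toFun := φ.continuous.add
    ((intervalIntegral.continuous_parametric_intervalIntegral_of_continuous (a₀ := 0)
      (hS.continuous_mildIntegrand hT hf u) continuous_id).comp continuous_subtype_val)

theorem isGeneralizedMildSolution_iff_isFixedPt (hT : 0 ≤ T)
    (hS : IsLipschitzFamilyOn (Icc 0 T) M S) (hf : Continuous f) :
    IsGeneralizedMildSolution hT S f φ u ↔ Function.IsFixedPt (mildOperator hT hS hf φ) u := by
  have hcongr : ∀ t : Icc (0 : ℝ) T, EqOn (mildIntegrand hT S f u t)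
      (fun σ => S (t - σ) (f (u (projIcc 0 T hT σ)))) (uIcc 0 (t : ℝ)) := fun t σ hσ => by
    rw [uIcc_of_le t.2.1] at hσ
    exact mildIntegrand_eq hT S f u t.2.2 hσ
  have hintegrable : ∀ t : Icc (0 : ℝ) T, IntervalIntegrable
      (fun σ => S (t - σ) (f (u (projIcc 0 T hT σ)))) volume 0 t := fun t =>
    (intervalIntegrable_congr ((hcongr t).mono uIoc_subset_uIcc)).1
      (hS.intervalIntegrable_mildIntegrand hT hf u t 0 t)
  refine (forall_congr' fun t => ?_).trans ContinuousMap.ext_iff.symm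
  rw [and_iff_right (hintegrable t), ← intervalIntegral.integral_congr (hcongr t), eq_comm]
  rfl

theorem norm_mildOperator_sub_le (hT : 0 ≤ T) (hS : IsLipschitzFamilyOn (Icc 0 T) M S)
    (hf : LipschitzWith K f) (φ : C(Icc (0 : ℝ) T, X)) {u v : C(Icc (0 : ℝ) T, X)} {C : ℝ} {n : ℕ}
    (huv : ∀ s, ‖u s - v s‖ ≤ C * (s : ℝ) ^ n) (t : Icc (0 : ℝ) T) :
    ‖mildOperator hT hS hf.continuous φ u t - mildOperator hT hS hf.continuous φ v t‖
      ≤ M * K * C * ((t : ℝ) ^ (n + 1) / (n + 1)) := by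
  have hbound : ∀ σ ∈ Ioc (0 : ℝ) t, ‖mildIntegrand hT S f u t σ - mildIntegrand hT S f v t σ‖
      ≤ M * K * C * σ ^ n := fun σ hσ => by
    have hprev := huv (projIcc 0 T hT σ)
    rw [show ((projIcc 0 T hT σ : Icc (0 : ℝ) T) : ℝ) = σ by
      rw [projIcc_of_mem hT ⟨hσ.1.le, hσ.2.trans t.2.2⟩]] at hprev
    refine (norm_apply_sub_apply_le (hS.lipschitzWith _ (projIcc 0 T hT (t - σ)).2) hf _ _).trans ?_
    rw [mul_assoc _ C]
    gcongr
  calc _ = ‖∫ σ in (0 : ℝ)..t, (mildIntegrand hT S f u t σ - mildIntegrand hT S f v t σ)‖ := by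
        rw [intervalIntegral.integral_sub
          (hS.intervalIntegrable_mildIntegrand hT hf.continuous u t 0 t)
          (hS.intervalIntegrable_mildIntegrand hT hf.continuous v t 0 t)]
        exact congrArg norm (add_sub_add_left_eq_sub _ _ _)
    _ ≤ ∫ σ in (0 : ℝ)..t, M * K * C * σ ^ n :=
        intervalIntegral.norm_integral_le_of_norm_le t.2.1 (ae_of_all _ hbound)
          (Continuous.intervalIntegrable (by fun_prop) _ _)
    _ = M * K * C * ((t : ℝ) ^ (n + 1) / (n + 1)) := by
        rw [intervalIntegral.integral_const_mul, integral_pow, zero_pow n.succ_ne_zero, sub_zero]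

theorem norm_iterate_mildOperator_sub_le (hT : 0 ≤ T) (hS : IsLipschitzFamilyOn (Icc 0 T) M S)
    (hf : LipschitzWith K f) (φ u v : C(Icc (0 : ℝ) T, X)) (n : ℕ) (t : Icc (0 : ℝ) T) :
    ‖(mildOperator hT hS hf.continuous φ)^[n] u t - (mildOperator hT hS hf.continuous φ)^[n] v t‖
      ≤ (M * K) ^ n / n.factorial * ‖u - v‖ * (t : ℝ) ^ n := by
  induction n generalizing t with
  | zero => simpa using (u - v).norm_coe_le_norm t
  | succ n ih =>
    rw [Function.iterate_succ_apply', Function.iterate_succ_apply']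
    refine (norm_mildOperator_sub_le hT hS hf φ ih t).trans_eq ?_
    rw [Nat.factorial_succ]
    push_cast
    field_simp
    ring

theorem existsUnique_isGeneralizedMildSolution [CompleteSpace X] (hT : 0 ≤ T)
    (hS : IsLipschitzFamilyOn (Icc 0 T) M S) (hf : LipschitzWith K f) (φ : C(Icc (0 : ℝ) T, X)) :
    ∃! u, IsGeneralizedMildSolution hT S f φ u := by
  let Φ := mildOperator hT hS hf.continuous φ
  obtain ⟨n, hn⟩ := ((FloorSemiring.tendsto_pow_div_factorial_atTop (M * K * T : ℝ)).eventually
    (gt_mem_nhds one_pos)).exists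
  let q : NNReal := ⟨(M * K * T) ^ n / n.factorial, by positivity⟩
  have hcontr : ContractingWith q Φ^[n] := by
    refine ⟨hn, LipschitzWith.of_dist_le_mul fun u v => ?_⟩
    rw [dist_eq_norm, dist_eq_norm, ContinuousMap.norm_le _ (by positivity)]
    intro t
    have := t.2.1
    calc _ ≤ (M * K) ^ n / n.factorial * ‖u - v‖ * (t : ℝ) ^ n :=
          norm_iterate_mildOperator_sub_le hT hS hf φ u v n t
      _ ≤ (M * K) ^ n / n.factorial * ‖u - v‖ * T ^ n := by
          gcongr
          exact t.2.2
      _ = (M * K * T : ℝ) ^ n / n.factorial * ‖u - v‖ := by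
          rw [mul_pow _ T]
          ring
  simp only [isGeneralizedMildSolution_iff_isFixedPt hT hS hf.continuous]
  exact ⟨_, hcontr.isFixedPt_fixedPoint_iterate,
    fun u hu => hcontr.fixedPoint_unique (hu.iterate n)⟩

theorem IsGeneralizedMildSolution.dist_le {hT : 0 ≤ T}
    (hu : IsGeneralizedMildSolution hT S f φ u) (hu' : IsGeneralizedMildSolution hT S' f φ' u')
    (hS' : ∀ t ∈ Icc 0 T, LipschitzWith M (S' t)) (hf : LipschitzWith K f) {ε : ℝ}
    (hSS' : ∀ t ∈ Icc 0 T, ∀ s, ‖S' t (f (u s)) - S t (f (u s))‖ ≤ ε) :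
    dist u' u ≤ (dist φ' φ + ε * T) * Real.exp (M * K * T) := by
  have hε : 0 ≤ ε := (norm_nonneg _).trans (hSS' 0 (left_mem_Icc.2 hT) ⟨0, left_mem_Icc.2 hT⟩)
  let D : ℝ → ℝ := fun t => ‖u' (projIcc 0 T hT t) - u (projIcc 0 T hT t)‖
  have hD : Continuous D := ((u'.continuous.comp continuous_projIcc).sub
    (u.continuous.comp continuous_projIcc)).norm
  have hforced : ∀ t ∈ Icc 0 T, D t ≤ (dist φ' φ + ε * T) + M * K * ∫ σ in (0 : ℝ)..t, D σ := by
    intro t ht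
    have hdiff : ‖∫ σ in (0 : ℝ)..t, (S' (t - σ) (f (u' (projIcc 0 T hT σ)))
        - S (t - σ) (f (u (projIcc 0 T hT σ))))‖ ≤ ∫ σ in (0 : ℝ)..t, (M * K * D σ + ε) := by
      refine intervalIntegral.norm_integral_le_of_norm_le ht.1 (ae_of_all _ fun σ hσ => ?_)
        (Continuous.intervalIntegrable (by fun_prop) _ _)
      have hmem : t - σ ∈ Icc 0 T := ⟨by linarith [hσ.2], by linarith [hσ.1, ht.2]⟩
      exact (norm_sub_le_norm_sub_add_norm_sub _ (S' (t - σ) (f (u (projIcc 0 T hT σ)))) _).trans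
        (add_le_add (norm_apply_sub_apply_le (hS' _ hmem) hf _ _) (hSS' _ hmem _))
    rw [intervalIntegral.integral_add (Continuous.intervalIntegrable (by fun_prop) _ _)
      intervalIntegrable_const, intervalIntegral.integral_const_mul,
      intervalIntegral.integral_const, sub_zero, smul_eq_mul] at hdiff
    have hforce : ‖φ' ⟨t, ht⟩ - φ ⟨t, ht⟩‖ ≤ dist φ' φ := by
      rw [← dist_eq_norm]
      exact ContinuousMap.dist_apply_le_dist _
    simp only [D, projIcc_of_mem hT ht] at hdiff ⊢
    rw [(hu ⟨t, ht⟩).2, (hu' ⟨t, ht⟩).2, add_sub_add_comm,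
      ← intervalIntegral.integral_sub (hu' ⟨t, ht⟩).1 (hu ⟨t, ht⟩).1]
    exact (norm_add_le _ _).trans (by linarith [mul_le_mul_of_nonneg_left ht.2 hε, mul_comm t ε])
  rw [ContinuousMap.dist_le (by positivity)]
  intro t
  have hDt := le_mul_exp_of_le_add_integral hD (fun _ => norm_nonneg _) (by positivity) hforced t.2
  simp only [D, projIcc_val] at hDt
  rw [dist_eq_norm]
  refine hDt.trans ?_
  gcongr
  exact t.2.2

theorem exists_continuous_solutionMap [CompleteSpace X] {G : Type*} [TopologicalSpace G]
    (hT : 0 ≤ T) {R : G → ℝ → X → X} (hR : ∀ g, IsLipschitzFamilyOn (Icc 0 T) M (R g))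
    (hcont : ∀ g v, ∀ ε > 0, ∀ᶠ g' in 𝓝 g, ∀ t ∈ Icc 0 T, ‖R g' t v - R g t v‖ ≤ ε)
    (hf : LipschitzWith K f) :
    ∃ U : C(Icc (0 : ℝ) T, X) × G → C(Icc (0 : ℝ) T, X),
      (∀ φ g u, IsGeneralizedMildSolution hT (R g) f φ u ↔ u = U (φ, g)) ∧ Continuous U := by
  choose U hU hunique using fun q : C(Icc (0 : ℝ) T, X) × G =>
    existsUnique_isGeneralizedMildSolution hT (hR q.2) hf q.1
  refine ⟨U, fun φ g u => ⟨hunique (φ, g) u, fun h => h ▸ hU (φ, g)⟩,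
    continuous_iff_continuousAt.2 fun ⟨φ, g⟩ => Metric.tendsto_nhds.2 fun ε hε => ?_⟩
  set E := Real.exp (M * K * T)
  have hE : 0 < E := Real.exp_pos _
  set δ := ε / (E * (1 + T))
  have hδ : 0 < δ := by positivity
  have hR' := eventually_forall_norm_sub_le_of_isCompact (fun g => (hR g).lipschitzWith)
    (hR g).lipschitzWith (hcont g)
    (isCompact_range (hf.continuous.comp (U (φ, g)).continuous)) hδ
  rw [nhds_prod_eq]
  filter_upwards [Eventually.prod_mk (Metric.ball_mem_nhds φ hδ) hR'] with q hq
  calc dist (U q) (U (φ, g)) ≤ (dist q.1 φ + δ * T) * E :=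
        (hU (φ, g)).dist_le (hU q) (hR q.2).lipschitzWith hf
          fun t ht s => hq.2 t ht _ (mem_range_self s)
    _ < (δ + δ * T) * E := by
        gcongr
        exact hq.1
    _ = ε := by
        simp only [δ]
        field_simp

end MildEquation

section SubordinateFamily

variable {X : Type*} [NormedAddCommGroup X] [NormedSpace ℝ X] {𝒯 S S' : ℝ → X → X} {m m' : ℝ → ℝ}

/-- `S` is the family `S(t)v = -∫₀^∞ 𝒯(τ)v d_τ w(t, τ)` subordinated to `𝒯` by the propagation
function `w` of `m`; for the heat semigroup this is `IsResolventFamily`. -/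
def IsSubordinateFamily (𝒯 : ℝ → X → X) (m : ℝ → ℝ) (S : ℝ → X → X) : Prop :=
  ∃ w : ℝ → ℝ → ℝ, IsPropagationFunction m w ∧
    ∃ ν : ℝ → Measure ℝ, (∀ t, 0 ≤ t → IsNegDtau w t (ν t)) ∧
      ∀ t, 0 ≤ t → ∀ v, Integrable (fun τ => 𝒯 τ v) (ν t) ∧ S t v = ∫ τ, 𝒯 τ v ∂(ν t)

theorem CompletelyPositive.exists_isSubordinateFamily (hm : CompletelyPositive m)
    (h𝒯 : ∀ v, ContinuousOn (fun τ => 𝒯 τ v) (Ici 0))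
    (hbdd : ∀ v, ∃ C, ∀ τ, 0 ≤ τ → ‖𝒯 τ v‖ ≤ C) : ∃ S, IsSubordinateFamily 𝒯 m S := by
  obtain ⟨ν, hν⟩ := hm.exists_isSubordinatingFamily
  obtain ⟨w, hw, hνw⟩ := id hν
  refine ⟨fun t v => ∫ τ, 𝒯 τ v ∂(ν t), w, hw, ν, hνw, fun t ht v => ⟨?_, rfl⟩⟩
  obtain ⟨C, hC⟩ := hbdd v
  have := hν.isProbabilityMeasure ht
  exact integrable_of_continuousOn_Ici (hν.ae_nonneg ht) (h𝒯 v) hC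

namespace IsSubordinateFamily

theorem exists_measure (hS : IsSubordinateFamily 𝒯 m S) : ∃ ν, IsSubordinatingFamily m ν ∧
    ∀ t, 0 ≤ t → ∀ v, Integrable (fun τ => 𝒯 τ v) (ν t) ∧ S t v = ∫ τ, 𝒯 τ v ∂(ν t) :=
  let ⟨w, hw, ν, hν, hSν⟩ := hS
  ⟨ν, ⟨w, hw, hν⟩, hSν⟩

theorem lipschitzWith {M : NNReal} (hS : IsSubordinateFamily 𝒯 m S)
    (h𝒯 : ∀ τ, 0 ≤ τ → LipschitzWith M (𝒯 τ)) {t : ℝ} (ht : 0 ≤ t) : LipschitzWith M (S t) := by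
  obtain ⟨ν, hν, hSν⟩ := hS.exists_measure
  have := hν.isProbabilityMeasure ht
  refine LipschitzWith.of_dist_le_mul fun u v => ?_
  rw [dist_eq_norm, dist_eq_norm, (hSν t ht u).2, (hSν t ht v).2,
    ← integral_sub (hSν t ht u).1 (hSν t ht v).1]
  refine (norm_integral_le_of_norm_le_const (C := M * ‖u - v‖) ?_).trans_eq (by simp)
  filter_upwards [hν.ae_nonneg ht] with τ hτ
  exact (h𝒯 τ hτ).norm_sub_le u v

variable [CompleteSpace X]

theorem isLipschitzFamilyOn {M : NNReal} (hS : IsSubordinateFamily 𝒯 m S)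
    (hm : CompletelyPositive m) (h𝒯 : IsLipschitzFamilyOn (Ici 0) M 𝒯)
    (hbdd : ∀ v, ∃ C, ∀ τ, 0 ≤ τ → ‖𝒯 τ v‖ ≤ C) (T : ℝ) : IsLipschitzFamilyOn (Icc 0 T) M S := by
  refine ⟨fun t ht => hS.lipschitzWith h𝒯.lipschitzWith ht.1, fun v => ?_⟩
  obtain ⟨ν, hν, hSν⟩ := hS.exists_measure
  obtain ⟨C, hC⟩ := hbdd v
  exact (hν.continuousOn_integral hm (h𝒯.continuousOn v) hC T).congr fun t ht => (hSν t ht.1 v).2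

theorem exists_norm_sub_le (hS : IsSubordinateFamily 𝒯 m S) (hm : CompletelyPositive m) {v : X}
    (h𝒯 : ContinuousOn (fun τ => 𝒯 τ v) (Ici 0)) (hbdd : ∃ C, ∀ τ, 0 ≤ τ → ‖𝒯 τ v‖ ≤ C) (T : ℝ)
    {ε : ℝ} (hε : 0 < ε) :
    ∃ δ > 0, ∀ m' S', CompletelyPositive m' → IsSubordinateFamily 𝒯 m' S' →
      ∫ σ in Ioo 0 T, |m' σ - m σ| < δ → ∀ t ∈ Icc 0 T, ‖S' t v - S t v‖ ≤ ε := by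
  obtain ⟨ν, hν, hSν⟩ := hS.exists_measure
  obtain ⟨C, hC⟩ := hbdd
  obtain ⟨δ, hδ, hstab⟩ := hν.exists_norm_integral_sub_le hm h𝒯 hC T hε
  refine ⟨δ, hδ, fun m' S' hm' hS' hmm' t ht => ?_⟩
  obtain ⟨ν', hν', hSν'⟩ := hS'.exists_measure
  rw [(hSν t ht.1 v).2, (hSν' t ht.1 v).2]
  exact hstab m' ν' hm' hν' hmm' t ht

theorem eq_of_ae_eq (hS : IsSubordinateFamily 𝒯 m S) (hm : CompletelyPositive m)
    (hS' : IsSubordinateFamily 𝒯 m' S') (hm' : CompletelyPositive m')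
    (h𝒯 : ∀ v, ContinuousOn (fun τ => 𝒯 τ v) (Ici 0))
    (hbdd : ∀ v, ∃ C, ∀ τ, 0 ≤ τ → ‖𝒯 τ v‖ ≤ C) {T : ℝ}
    (hmm' : m' =ᵐ[volume.restrict (Ioo 0 T)] m) {t : ℝ} (ht : t ∈ Icc 0 T) : S' t = S t := by
  funext v
  obtain ⟨ν, hν, hSν⟩ := hS.exists_measure
  obtain ⟨ν', hν', hSν'⟩ := hS'.exists_measure
  obtain ⟨C, hC⟩ := hbdd v
  rw [(hSν t ht.1 v).2, (hSν' t ht.1 v).2]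
  exact hν.integral_eq_of_ae_eq hm hν' hm' (h𝒯 v) hC hmm' ht

end IsSubordinateFamily

theorem dist_kernelSet {T : ℝ} {g g' : kernelSet T} (hg : m =ᵐ[volume.restrict (Ioo 0 T)] g)
    (hg' : m' =ᵐ[volume.restrict (Ioo 0 T)] g') :
    dist g' g = ∫ σ in Ioo 0 T, |m' σ - m σ| := by
  rw [Subtype.dist_eq, dist_eq_norm, L1.norm_eq_integral_norm]
  refine integral_congr_ae ?_
  filter_upwards [hg, hg', Lp.coeFn_sub g'.1 g.1] with t hgt hgt' hsub
  rw [hsub, Pi.sub_apply, ← hgt, ← hgt', Real.norm_eq_abs]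

end SubordinateFamily

section LpBochner

variable {α Ω E : Type*} [MeasurableSpace α] [MeasurableSpace Ω] {ν : Measure α} {μ : Measure Ω}
  [NormedAddCommGroup E] {p : ℝ≥0∞} [Fact (1 ≤ p)] {A : Set α}

theorem integrableOn_Lp (hνA : ν A ≠ ∞) (v : Lp E p ν) : IntegrableOn v A ν :=
  have : IsFiniteMeasure (ν.restrict A) := isFiniteMeasure_restrict.2 hνA
  ((Lp.memLp v).restrict A).integrable Fact.out

theorem exists_clm_eq_setIntegral [NormedSpace ℝ E] [CompleteSpace E] (hA : MeasurableSet A)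
    (hνA : ν A ≠ ∞) :
    ∃ Λ : Lp E p ν →L[ℝ] E, ∀ v : Lp E p ν, Λ v = ∫ x in A, v x ∂ν := by
  have : Fact (1 ≤ p.conjExponent) := ⟨le_self_add⟩
  refine ⟨((ContinuousLinearMap.lsmul ℝ ℝ).flip.lpPairing ν p p.conjExponent).flip
    (indicatorConstLp p.conjExponent hA hνA (1 : ℝ)), fun v => ?_⟩
  rw [ContinuousLinearMap.flip_apply, ContinuousLinearMap.lpPairing_eq_integral,
    ← integral_indicator hA]
  refine integral_congr_ae ?_
  filter_upwards [indicatorConstLp_coeFn (p := p.conjExponent) (hs := hA) (hμs := hνA)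
    (c := (1 : ℝ))] with x hx
  by_cases hxA : x ∈ A <;> simp [hx, hxA]

theorem exists_setIntegral_norm_le (hA : MeasurableSet A) (hνA : ν A ≠ ∞) :
    ∃ C : ℝ, ∀ v : Lp E p ν, ∫ x in A, ‖v x‖ ∂ν ≤ C * ‖v‖ := by
  obtain ⟨Λ, hΛ⟩ := exists_clm_eq_setIntegral (E := ℝ) (p := p) hA hνA
  refine ⟨‖Λ‖, fun v => ?_⟩
  have hv : MemLp (fun x => ‖v x‖) p ν := (Lp.memLp v).norm
  calc ∫ x in A, ‖v x‖ ∂ν = Λ hv.toLp := by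
        rw [hΛ]
        exact integral_congr_ae (ae_restrict_of_ae hv.coeFn_toLp.symm)
    _ ≤ ‖Λ‖ * ‖hv.toLp‖ := (le_abs_self _).trans (Λ.le_opNorm _)
    _ = ‖Λ‖ * ‖v‖ := by rw [Lp.norm_toLp, eLpNorm_norm, Lp.norm_def]

variable {F : Ω → Lp E p ν} {g : Ω → α → E}

theorem integrable_uncurry_of_Lp [SFinite ν] [SFinite μ] (hA : MeasurableSet A) (hνA : ν A ≠ ∞)
    (hF : Integrable F μ) (hg : StronglyMeasurable (Function.uncurry g))
    (hFg : ∀ z, F z =ᵐ[ν] g z) :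
    Integrable (Function.uncurry g) (μ.prod (ν.restrict A)) := by
  obtain ⟨C, hC⟩ := exists_setIntegral_norm_le (E := E) (p := p) hA hνA
  refine (integrable_prod_iff hg.aestronglyMeasurable).2
    ⟨ae_of_all _ fun z => (integrableOn_Lp hνA (F z)).congr (ae_restrict_of_ae (hFg z)), ?_⟩
  refine (hF.norm.const_mul C).mono'
    hg.norm.integral_prod_right'.aestronglyMeasurable (ae_of_all _ fun z => ?_)
  calc ‖∫ x in A, ‖g z x‖ ∂ν‖ = ∫ x in A, ‖F z x‖ ∂ν := by
        rw [Real.norm_of_nonneg (integral_nonneg fun _ => norm_nonneg _)]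
        exact integral_congr_ae (ae_restrict_of_ae ((hFg z).symm.fun_comp norm))
    _ ≤ C * ‖F z‖ := hC _

theorem coeFn_integral_Lp [NormedSpace ℝ E] [CompleteSpace E] [SigmaFinite ν] [SFinite μ]
    (hF : Integrable F μ) (hg : StronglyMeasurable (Function.uncurry g))
    (hFg : ∀ z, F z =ᵐ[ν] g z) :
    (∫ z, F z ∂μ : Lp E p ν) =ᵐ[ν] fun x => ∫ z, g z x ∂μ := by
  refine ae_eq_of_forall_setIntegral_eq_of_sigmaFinite
    (fun A _ hνA => integrableOn_Lp hνA.ne _)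
    (fun A hA hνA => (integrable_uncurry_of_Lp hA hνA.ne hF hg hFg).integral_prod_right)
    fun A hA hνA => ?_
  obtain ⟨Λ, hΛ⟩ := exists_clm_eq_setIntegral (E := E) (p := p) hA hνA.ne
  calc ∫ x in A, (∫ z, F z ∂μ : Lp E p ν) x ∂ν = ∫ z, ∫ x in A, F z x ∂ν ∂μ := by
        simp_rw [← hΛ]
        exact (Λ.integral_comp_comm hF).symm
    _ = ∫ z, ∫ x in A, g z x ∂ν ∂μ :=
        integral_congr_ae (ae_of_all _ fun z => integral_congr_ae (ae_restrict_of_ae (hFg z)))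
    _ = ∫ x in A, ∫ z, g z x ∂μ ∂ν :=
        integral_integral_swap (integrable_uncurry_of_Lp hA hνA.ne hF hg hFg)

end LpBochner

section Heat

variable {d : ℕ} {p : ℝ≥0∞}

theorem integral_heatKernel_one (d : ℕ) : ∫ x, heatKernel d 1 x = 1 := by
  have hGauss := GaussianFourier.integral_rexp_neg_mul_sq_norm (V := EuclideanSpace ℝ (Fin d))
    (b := 1 / 4) (by norm_num)
  have heatKernel_eq (x : EuclideanSpace ℝ (Fin d)) : heatKernel d 1 x
      = (4 * Real.pi) ^ (-(d : ℝ) / 2) * Real.exp (-(1 / 4) * ‖x‖ ^ 2) := by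
    simp only [heatKernel, mul_one]
    congr 2
    ring
  simp_rw [heatKernel_eq]
  rw [integral_const_mul, hGauss, finrank_euclideanSpace_fin,
    show Real.pi / (1 / 4) = 4 * Real.pi by ring,
    ← Real.rpow_add (by positivity), show -(d : ℝ) / 2 + d / 2 = 0 by ring, Real.rpow_zero]

/-- The Gaussian law on `ℝ^d` whose density is the heat kernel at time one. -/
def heatMeasure (d : ℕ) : Measure (EuclideanSpace ℝ (Fin d)) :=
  volume.withDensity fun y => ENNReal.ofReal (heatKernel d 1 y)

instance isProbabilityMeasure_heatMeasure (d : ℕ) : IsProbabilityMeasure (heatMeasure d) := by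
  constructor
  rw [heatMeasure, withDensity_apply _ MeasurableSet.univ, Measure.restrict_univ,
    ← ofReal_integral_eq_lintegral_ofReal (integrable_heatKernel d one_pos)
      (ae_of_all _ (heatKernel_nonneg d one_pos)), integral_heatKernel_one, ENNReal.ofReal_one]

theorem heatKernel_one_eq (d : ℕ) {τ : ℝ} (hτ : 0 < τ) (z : EuclideanSpace ℝ (Fin d)) :
    heatKernel d 1 z = √τ ^ d * heatKernel d τ (√τ • z) := by
  have sqrt_pow : √τ ^ d = τ ^ ((d : ℝ) / 2) := by
    rw [Real.sqrt_eq_rpow, ← Real.rpow_natCast, ← Real.rpow_mul hτ.le]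
    ring_nf
  have normalization : τ ^ (-(d : ℝ) / 2) * τ ^ ((d : ℝ) / 2) = 1 := by
    rw [← Real.rpow_add hτ, show -(d : ℝ) / 2 + d / 2 = 0 by ring, Real.rpow_zero]
  have exponent : -(τ * ‖z‖ ^ 2) / (4 * τ) = -‖z‖ ^ 2 / (4 * 1) := by
    field_simp
  simp only [heatKernel, norm_smul, Real.norm_eq_abs, abs_of_nonneg (Real.sqrt_nonneg τ), mul_pow,
    Real.sq_sqrt hτ.le]
  rw [Real.mul_rpow (by positivity) hτ.le, sqrt_pow, mul_one, exponent]
  linear_combination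
    (-(4 * Real.pi) ^ (-(d : ℝ) / 2) * Real.exp (-‖z‖ ^ 2 / (4 * 1))) * normalization

theorem heatConv_eq_integral_heatMeasure {τ : ℝ} (hτ : 0 < τ) (v : EuclideanSpace ℝ (Fin d) → ℝ)
    (x : EuclideanSpace ℝ (Fin d)) :
    heatConv d τ v x = ∫ z, v (x - √τ • z) ∂heatMeasure d := by
  have : 0 < √τ := Real.sqrt_pos.2 hτ
  let φ (y : EuclideanSpace ℝ (Fin d)) : ℝ := heatKernel d τ y * v (x - y)
  symm
  calc ∫ z, v (x - √τ • z) ∂heatMeasure d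
      = ∫ z, heatKernel d 1 z * v (x - √τ • z) := by
        rw [heatMeasure, integral_withDensity_eq_integral_toReal_smul
          (continuous_heatKernel d 1).measurable.ennreal_ofReal
          (ae_of_all _ fun _ => ENNReal.ofReal_lt_top)]
        simp_rw [ENNReal.toReal_ofReal (heatKernel_nonneg d one_pos _), smul_eq_mul]
    _ = √τ ^ d * ∫ z, φ (√τ • z) := by
        simp_rw [← integral_const_mul, heatKernel_one_eq d hτ, mul_assoc, φ]
    _ = ∫ y, φ y := by
        rw [Measure.integral_comp_smul, finrank_euclideanSpace_fin, abs_of_pos (by positivity),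
          smul_eq_mul, mul_inv_cancel_left₀ (by positivity)]
    _ = ∫ y, φ (x - y) := (integral_sub_left_eq_self φ volume x).symm
    _ = heatConv d τ v x := by simp only [φ, heatConv, sub_sub_cancel]

/-- The translate `v(· - a)` of `v ∈ L^p(ℝ^d)`. -/
def translate (a : EuclideanSpace ℝ (Fin d)) (v : LpSpace d p) : LpSpace d p :=
  Lp.compMeasurePreserving (fun x => x - a) (measurePreserving_sub_right volume a) v

theorem norm_translate (a : EuclideanSpace ℝ (Fin d)) (v : LpSpace d p) :
    ‖translate a v‖ = ‖v‖ :=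
  Lp.norm_compMeasurePreserving _ _

theorem translate_sub (a : EuclideanSpace ℝ (Fin d)) (u v : LpSpace d p) :
    translate a (u - v) = translate a u - translate a v :=
  map_sub _ _ _

theorem coeFn_translate (a : EuclideanSpace ℝ (Fin d)) (v : LpSpace d p) :
    translate a v =ᵐ[volume] fun x => v (x - a) :=
  Lp.coeFn_compMeasurePreserving _ _

theorem translate_zero (v : LpSpace d p) : translate 0 v = v :=
  Lp.ext ((coeFn_translate 0 v).trans (ae_of_all _ fun x => by simp only [sub_zero]))

variable [Fact (1 ≤ p)] [hp : Fact (p ≠ ∞)]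

theorem continuous_translate (v : LpSpace d p) : Continuous fun a => translate a v := by
  let sub : C(EuclideanSpace ℝ (Fin d) × EuclideanSpace ℝ (Fin d), EuclideanSpace ℝ (Fin d)) :=
    ⟨fun q => q.2 - q.1, by fun_prop⟩
  exact Continuous.compMeasurePreservingLp (f := fun _ => v) (g := sub.curry) continuous_const
    sub.curry.continuous (fun a => measurePreserving_sub_right volume a) hp.out

theorem integrable_translate_smul (s : ℝ) (v : LpSpace d p) :
    Integrable (fun z => translate (s • z) v) (heatMeasure d) :=
  Integrable.of_bound
    ((continuous_translate v).comp (continuous_const_smul s)).aestronglyMeasurable ‖v‖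
    (ae_of_all _ fun _ => (norm_translate _ _).le)

/-- The substitution `y = √τ z` turns the heat kernel at time `τ` into the Gaussian density at time
one, so that `τ` only enters through the translations, which are strongly continuous. -/
theorem heatSemigroup_eq_integral (τ : ℝ) (v : LpSpace d p) :
    heatSemigroup τ v = ∫ z, translate (√τ • z) v ∂heatMeasure d := by
  by_cases hτ : 0 < τ
  · have hmeas : StronglyMeasurable (Function.uncurry fun z x : EuclideanSpace ℝ (Fin d) =>
        v (x - √τ • z)) :=
      (Lp.stronglyMeasurable v).comp_measurable (by fun_prop)
    rw [heatSemigroup, dif_pos hτ]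
    refine Lp.ext ((MemLp.coeFn_toLp _).trans ?_)
    simp_rw [funext (heatConv_eq_integral_heatMeasure hτ v)]
    exact (coeFn_integral_Lp (integrable_translate_smul _ v) hmeas
      fun z => coeFn_translate _ v).symm
  · rw [heatSemigroup, dif_neg hτ, Real.sqrt_eq_zero_of_nonpos (not_lt.1 hτ)]
    simp only [zero_smul, translate_zero, integral_const, probReal_univ, one_smul]

theorem continuous_heatSemigroup (v : LpSpace d p) : Continuous fun τ => heatSemigroup τ v := by
  simp_rw [heatSemigroup_eq_integral]
  exact continuous_of_dominated (bound := fun _ => ‖v‖)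
    (fun τ => (integrable_translate_smul _ v).aestronglyMeasurable)
    (fun τ => ae_of_all _ fun z => (norm_translate _ _).le) (integrable_const _)
    (ae_of_all _ fun z =>
      (continuous_translate v).comp (Real.continuous_sqrt.smul continuous_const))

theorem norm_heatSemigroup_le (τ : ℝ) (v : LpSpace d p) : ‖heatSemigroup τ v‖ ≤ ‖v‖ := by
  rw [heatSemigroup_eq_integral]
  simpa using norm_integral_le_of_norm_le_const (μ := heatMeasure d)
    (ae_of_all _ fun z => (norm_translate (√τ • z) v).le)

theorem heatSemigroup_sub (τ : ℝ) (u v : LpSpace d p) :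
    heatSemigroup τ (u - v) = heatSemigroup τ u - heatSemigroup τ v := by
  simp_rw [heatSemigroup_eq_integral, translate_sub]
  exact integral_sub (integrable_translate_smul _ _) (integrable_translate_smul _ _)

theorem isLipschitzFamilyOn_heatSemigroup :
    IsLipschitzFamilyOn (Ici 0) 1 (heatSemigroup (d := d) (p := p)) where
  lipschitzWith τ _ := LipschitzWith.of_dist_le_mul fun u v => by
    simpa [dist_eq_norm, heatSemigroup_sub] using norm_heatSemigroup_le τ (u - v)
  continuousOn v := (continuous_heatSemigroup v).continuousOn

end Heat

end RayleighStokes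

end

open RayleighStokes in
theorem mainTheorem4_general {X : Type*} [NormedAddCommGroup X] [NormedSpace ℝ X] [CompleteSpace X]
    {M K : NNReal} {𝒯 : ℝ → X → X} (h𝒯 : IsLipschitzFamilyOn (Ici 0) M 𝒯)
    (hbdd : ∀ v, ∃ C, ∀ τ, 0 ≤ τ → ‖𝒯 τ v‖ ≤ C) {f : X → X} (hf : LipschitzWith K f)
    {T : ℝ} (hT : 0 ≤ T) :
    (∀ m : ℝ → ℝ, CompletelyPositive m → ∃ S : ℝ → X → X, IsSubordinateFamily 𝒯 m S) ∧
    ∃ U : C(Icc (0 : ℝ) T, X) × kernelSet T → C(Icc (0 : ℝ) T, X),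
      (∀ (φ : C(Icc (0 : ℝ) T, X)) (g : kernelSet T) (m : ℝ → ℝ) (S : ℝ → X → X),
        CompletelyPositive m →
        m =ᵐ[volume.restrict (Ioo (0 : ℝ) T)] (g : Lp ℝ 1 (volume.restrict (Ioo (0 : ℝ) T))) →
        IsSubordinateFamily 𝒯 m S →
        ∀ u : C(Icc (0 : ℝ) T, X), IsGeneralizedMildSolution hT S f φ u ↔ u = U (φ, g)) ∧
      Continuous U := by
  have hexists := fun m (hm : CompletelyPositive m) =>
    hm.exists_isSubordinateFamily h𝒯.continuousOn hbdd
  choose κ hκ hκg using fun g : kernelSet T => g.2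
  choose R hR using fun g : kernelSet T => hexists (κ g) (hκ g)
  obtain ⟨U, hU, hUcont⟩ := exists_continuous_solutionMap hT
    (fun g => (hR g).isLipschitzFamilyOn (hκ g) h𝒯 hbdd T) (fun g v ε hε => by
      obtain ⟨δ, hδ, hstab⟩ :=
        (hR g).exists_norm_sub_le (hκ g) (h𝒯.continuousOn v) (hbdd v) T hε
      filter_upwards [Metric.ball_mem_nhds g hδ] with g' hg'
      exact hstab _ _ (hκ g') (hR g') (dist_kernelSet (hκg g) (hκg g') ▸ hg')) hf
  refine ⟨hexists, U, fun φ g m S hm hmg hS u => ?_, hUcont⟩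
  have heq : ∀ t ∈ Icc 0 T, S t = R g t := fun t ht =>
    (hR g).eq_of_ae_eq (hκ g) hS hm h𝒯.continuousOn hbdd (hmg.trans (hκg g).symm) ht
  rw [← hU]
  exact ⟨fun h => h.congr heq, fun h => h.congr fun t ht => (heq t ht).symm⟩

open RayleighStokes in
theorem mainTheorem4 (d : ℕ) (p : ℝ≥0∞) [Fact (1 ≤ p)] [Fact (p ≠ ∞)]
    (f : LpSpace d p → LpSpace d p) (hf0 : f 0 = 0)
    (hf : ∃ L : ℝ, 0 < L ∧ ∀ u v, ‖f u - f v‖ ≤ L * ‖u - v‖)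
    (T : ℝ) (hT : 0 < T) :
    (∀ m : ℝ → ℝ, CompletelyPositive m →
      ∃ S : ℝ → LpSpace d p → LpSpace d p, IsResolventFamily m S) ∧
    ∃ U : C(Icc (0 : ℝ) T, LpSpace d p) × kernelSet T → C(Icc (0 : ℝ) T, LpSpace d p),
      (∀ (φ : C(Icc (0 : ℝ) T, LpSpace d p)) (g : kernelSet T) (m : ℝ → ℝ)
        (S : ℝ → LpSpace d p → LpSpace d p),
        CompletelyPositive m →
        m =ᵐ[volume.restrict (Ioo (0 : ℝ) T)] (g : Lp ℝ 1 (volume.restrict (Ioo (0 : ℝ) T))) →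
        IsResolventFamily m S →
        ∀ u : C(Icc (0 : ℝ) T, LpSpace d p),
          IsGeneralizedMildSolution hT.le S f φ u ↔ u = U (φ, g)) ∧
      Continuous U := by
  obtain ⟨L, hL, hf⟩ := hf
  exact mainTheorem4_general isLipschitzFamilyOn_heatSemigroup
    (fun v => ⟨‖v‖, fun τ _ => norm_heatSemigroup_le τ v⟩) (K := L.toNNReal)
    (LipschitzWith.of_dist_le_mul fun u v => by
      simpa only [dist_eq_norm, Real.coe_toNNReal L hL.le] using hf u v) hT.le
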